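/- **Setting.** Let $\mathbf{M}$ be the free strict monoidal category monad on the category $Cat$ of small categories: $\mathbf{M}(O)$ has as objects the finite words $\vec o=\langle o_1,\dots,o_n\rangle$ of objects of $O$, and as arrows $\vec o\to\vec p$, for words of equal length, the families of arrows $o_i\to p_i$; $\eta_O(o)=\langle o\rangle$, and $\mu$ is concatenation. We work in the 2-category $CAT/Cat$ (categories over $Cat$, functors over $Cat$, natural transformations with vertical components). * $Gph_{2fi}(\mathbf{M})\to Cat$ has over $O$ the spans $O\xleftarrow{\gamma}A\xrightarrow{\delta}\mathbf{M}(O)$ with $A$ small that are two-sided discrete fibrations ($\gamma$ a fibration, $\delta$ an opfibration); an arrow over $u:O\to Q$ is a map of spans over $(u,\mathbf{M}(u))$. Equivalently, an object over $O$ is a functor $O^{op}\times\mathbf{M}(O)\to Set$, $(o,\vec o)\mapsto A(o;\vec o)$ (the fibre of $A$), and an arrow over $u$ is a natural family $A(o;\vec o)\to B(u(o);\mathbf{M}(u)(\vec o))$. * $DFib\to Cat$ has over $O$ the small discrete fibrations $X\to O$, equivalently the presheaves $X:O^{op}\to Set$; an arrow $X\to Y$ over $u$ is a map $X\to u^*Y$.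 * $End(DFib)\to Cat$ is the exponential of $DFib$ by itself in $CAT/Cat$: functors over $Cat$ from $E\times_{Cat}DFib$ to $DFib$ correspond bijectively to functors over $Cat$ from $E$ to $End(DFib)$. Its objects over $O$ are the functors $DFib(O)\to DFib(O)$, and an arrow $P\to H$ over $u$ is a natural transformation $P\,u^*\to u^*H$. Composition of functors makes it a strict monoidal object of $CAT/Cat$. * The tensor product of $Gph_{2fi}(\mathbf{M})$ is $$(A\otimes B)(o;\vec o)=\int^{\vec p\in\mathbf{M}(O)}A(o;\vec p)\times\mathbf{M}(B)(\vec p;\vec o),$$ where $\mathbf{M}(B)$ stands for the span $(\mathbf{M}(B),\mathbf{M}(\gamma),\mu_O\circ\mathbf{M}(\delta))$, so that an element of $\mathbf{M}(B)(\vec p;\vec o)$ is a family $b_i\in B(p_i;\vec o_i)$ with $\vec o$ the concatenation of the words $\vec o_i$. Its unit is $I(o;\vec o)=\mathbf{M}(O)(\eta_O(o),\vec o)$. * For a word $\vec p$ of length $n$ put $X^{\vec p}=\prod_{i=1}^{n}X(p_i)$. The action $\star:Gph_{2fi}(\mathbf{M})\times_{Cat}DFib\to DFib$ is $$(A\star X)(o)=\int^{\vec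 p\in\mathbf{M}(O)}A(o;\vec p)\times X^{\vec p},$$ and the representation $r:Gph_{2fi}(\mathbf{M})\to End(DFib)$ is its exponential adjoint; so $r(A)(X)=A\star X$. * $\iota=\iota_O:\mathbf{M}(O)\to\widehat O\simeq DFib(O)$ sends $\vec o=\langle o_1,\dots,o_n\rangle$ to the coproduct $Y(o_1)+\dots+Y(o_n)$ of representable presheaves. The 1-cell $U:End(DFib)\to Gph_{2fi}(\mathbf{M})$ is $U(H)(o;\vec o)=H(\iota(\vec o))(o)$. * An object $C$ of $CAT/Cat$ is an *rc 0-cell* if every category of 1-cells $X\to C$ and 2-cells between them has reflexive coequalizers, and these are preserved by precomposition with 1-cells; a 1-cell between rc 0-cells is an *rc 1-cell* if postcomposition with it preserves them. **Proposition.** 1. $r$ is strong monoidal: with the tensor product $\otimes$ and unit $I$, $Gph_{2fi}(\mathbf{M})$ is a monoidal object of $CAT/Cat$ (there are coherent associativity and unit isomorphisms), and $r$ carries the structure of a strong monoidal 1-cell to $End(DFib)$, whose structure isomorphisms are $$X(o)\cong(I\star X)(o),\quad x\mapsto[1_{\eta(o)},x],$$ $$\bigl(A\star(B\star X)\bigr)(o)\cong\bigl((A\otimes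 B)\star X\bigr)(o),\quad [a,([b_i,\vec x_i])_i]\mapsto[[a,(b_i)_i],\vec x],$$ where $\vec x$ is the concatenation of the $\vec x_i$. 2. $r$ is a morphism of bifibrations: $Gph_{2fi}(\mathbf{M})\to Cat$ and $End(DFib)\to Cat$ are bifibrations, and $r$ preserves prone (cartesian) and supine (opcartesian) arrows. 3. $U$ is an rc 1-cell, and it is right adjoint to $r$ in $CAT/Cat$, with unit $A(o;\vec o)\to U r(A)(o;\vec o)$, $a\mapsto[a,1_{\iota(\vec o)}]$, and counit $(rU(H))(X)(o)\to H(X)(o)$, $[h,\vec x]\mapsto H(\vec x)(h)$, where $\vec x\in X^{\vec p}$ is regarded as a map $\iota(\vec p)\to X$. -/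

import Mathlib

open CategoryTheory Opposite Limits

set_option linter.checkUnivs false

universe w v w' v' w'' v'' w₃ v₃ v₁ u₁ u

/-- A category over `S`, presented by its fibres and by its sets of arrows over each arrow of the
base.  Composition takes a proof that the base arrows compose to the given one. -/
structure CatOver (S : Type u₁) [Category.{v₁} S] where
  /-- the objects over `a` -/
  Ob : S → Type w
  /-- the arrows over `u` -/
  Hom : ∀ {a b : S}, (a ⟶ b) → Ob a → Ob b → Type v
  id : ∀ {a : S} (x : Ob a), Hom (𝟙 a) x x
  comp : ∀ {a b c : S} {u : a ⟶ b} {v : b ⟶ c} {t : a ⟶ c} {x : Ob a} {y : Ob b} {z : Ob c},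
    u ≫ v = t → Hom u x y → Hom v y z → Hom t x z
  id_comp : ∀ {a b : S} {u : a ⟶ b} {x : Ob a} {y : Ob b} (f : Hom u x y),
    comp (Category.id_comp u) (id x) f = f
  comp_id : ∀ {a b : S} {u : a ⟶ b} {x : Ob a} {y : Ob b} (f : Hom u x y),
    comp (Category.comp_id u) f (id y) = f
  assoc : ∀ {a b c d : S} {u : a ⟶ b} {v : b ⟶ c} {t : c ⟶ d} {uv : a ⟶ c} {vt : b ⟶ d}
    {uvt : a ⟶ d} {x : Ob a} {y : Ob b} {z : Ob c} {z' : Ob d}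
    (h₁ : u ≫ v = uv) (h₂ : uv ≫ t = uvt) (h₃ : v ≫ t = vt) (h₄ : u ≫ vt = uvt)
    (f : Hom u x y) (g : Hom v y z) (k : Hom t z z'),
    comp h₂ (comp h₁ f g) k = comp h₄ f (comp h₃ g k)

namespace CatOver

variable {S : Type u₁} [Category.{v₁} S]

/-- Composition of arrows in a fibre. -/
abbrev vcomp (C : CatOver.{w, v} S) {a : S} {x y z : C.Ob a} (f : C.Hom (𝟙 a) x y)
    (g : C.Hom (𝟙 a) y z) : C.Hom (𝟙 a) x z :=
  C.comp (Category.id_comp (𝟙 a)) f g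

/-- A 1-cell: a functor over `S`. -/
structure OneCell (C : CatOver.{w, v} S) (D : CatOver.{w', v'} S) where
  obj : ∀ {a : S}, C.Ob a → D.Ob a
  map : ∀ {a b : S} {u : a ⟶ b} {x : C.Ob a} {y : C.Ob b}, C.Hom u x y → D.Hom u (obj x) (obj y)
  map_id : ∀ {a : S} (x : C.Ob a), map (C.id x) = D.id (obj x)
  map_comp : ∀ {a b c : S} {u : a ⟶ b} {v : b ⟶ c} {t : a ⟶ c}
    {x : C.Ob a} {y : C.Ob b} {z : C.Ob c} (h : u ≫ v = t) (f : C.Hom u x y) (g : C.Hom v y z),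
    map (C.comp h f g) = D.comp h (map f) (map g)

/-- A 2-cell: a natural transformation whose components are vertical. -/
@[ext]
structure TwoCell {C : CatOver.{w, v} S} {D : CatOver.{w', v'} S} (F G : OneCell C D) where
  app : ∀ {a : S} (x : C.Ob a), D.Hom (𝟙 a) (F.obj x) (G.obj x)
  naturality : ∀ {a b : S} {u : a ⟶ b} {x : C.Ob a} {y : C.Ob b} (f : C.Hom u x y),
    D.comp (Category.comp_id u) (F.map f) (app y) = D.comp (Category.id_comp u) (app x) (G.map f)

/-- The category of 1-cells and 2-cells between two categories over `S`. -/
instance (C : CatOver.{w, v} S) (D : CatOver.{w', v'} S) : Category (OneCell C D) where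
  Hom F G := TwoCell F G
  id F := ⟨fun x => D.id (F.obj x), fun f => by rw [D.comp_id, D.id_comp]⟩
  comp σ τ := ⟨fun x => D.vcomp (σ.app x) (τ.app x), fun {a b u x y} f => by
    rw [← D.assoc (Category.comp_id u) (Category.comp_id u), σ.naturality,
      D.assoc _ _ (Category.comp_id u) (Category.id_comp u), τ.naturality, D.assoc]⟩
  id_comp σ := by ext; exact D.id_comp _
  comp_id σ := by ext; exact D.comp_id _
  assoc σ τ υ := by ext; exact D.assoc _ _ _ _ _ _ _

/-- The product of two categories over `S`. -/
def prod (C : CatOver.{w, v} S) (D : CatOver.{w', v'} S) : CatOver.{max w w', max v v'} S where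
  Ob a := C.Ob a × D.Ob a
  Hom u x y := C.Hom u x.1 y.1 × D.Hom u x.2 y.2
  id x := (C.id x.1, D.id x.2)
  comp h f g := (C.comp h f.1 g.1, D.comp h f.2 g.2)
  id_comp f := by simp only [C.id_comp, D.id_comp]
  comp_id f := by simp only [C.comp_id, D.comp_id]
  assoc h₁ h₂ h₃ h₄ f g k := by rw [C.assoc h₁ h₂ h₃ h₄, D.assoc h₁ h₂ h₃ h₄]

/-- The arrow of the product given by two arrows over the same arrow of the base. -/
abbrev pair {C : CatOver.{w, v} S} {D : CatOver.{w', v'} S} {a b : S} {u : a ⟶ b}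
    {x : C.Ob a} {y : C.Ob b} {x' : D.Ob a} {y' : D.Ob b} (f : C.Hom u x y) (g : D.Hom u x' y') :
    (C.prod D).Hom u (x, x') (y, y') :=
  (f, g)

/-- The terminal category over `S`, namely `S` itself. -/
def one (S : Type u₁) [Category.{v₁} S] : CatOver.{0, 0} S where
  Ob _ := PUnit
  Hom _ _ _ := PUnit
  id _ := ⟨⟩
  comp _ _ _ := ⟨⟩
  id_comp _ := rfl
  comp_id _ := rfl
  assoc _ _ _ _ _ _ _ := rfl

namespace OneCell

variable {C : CatOver.{w, v} S} {D : CatOver.{w', v'} S} {E : CatOver.{w'', v''} S}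

/-- The identity 1-cell. -/
def id (C : CatOver.{w, v} S) : OneCell C C where
  obj x := x
  map f := f
  map_id _ := rfl
  map_comp _ _ _ := rfl

/-- Composition of 1-cells, in diagrammatic order. -/
def comp (F : OneCell C D) (G : OneCell D E) : OneCell C E where
  obj x := G.obj (F.obj x)
  map f := G.map (F.map f)
  map_id x := by rw [F.map_id, G.map_id]
  map_comp h f g := by rw [F.map_comp, G.map_comp]

/-- The 1-cell `F × G`. -/
def prodMap {C' : CatOver.{w'', v''} S} {D' : CatOver.{w₃, v₃} S}
    (F : OneCell C D) (G : OneCell C' D') : OneCell (C.prod C') (D.prod D') where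
  obj x := (F.obj x.1, G.obj x.2)
  map f := (F.map f.1, G.map f.2)
  map_id _ := Prod.ext (F.map_id _) (G.map_id _)
  map_comp _ _ _ := Prod.ext (F.map_comp _ _ _) (G.map_comp _ _ _)

/-- The functor "precede by the 1-cell `F`" on 1-cells and 2-cells. -/
def precomp (F : OneCell C D) (E : CatOver.{w'', v''} S) : OneCell D E ⥤ OneCell C E where
  obj G := F.comp G
  map σ := ⟨fun x => σ.app (F.obj x), fun f => σ.naturality (F.map f)⟩
  map_id _ := rfl
  map_comp _ _ := rfl

/-- The functor "follow by the 1-cell `G`" on 1-cells and 2-cells. -/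
def postcomp (C : CatOver.{w, v} S) (G : OneCell D E) : OneCell C D ⥤ OneCell C E where
  obj F := F.comp G
  map σ := ⟨fun x => G.map (σ.app x), fun f => by
    have := congrArg G.map (σ.naturality f)
    rwa [G.map_comp, G.map_comp] at this⟩
  map_id F := TwoCell.ext (by funext a x; exact G.map_id _)
  map_comp σ τ := TwoCell.ext (by funext a x; exact G.map_comp _ _ _)

end OneCell

/-! ### Bifibrations -/

section Fibrations

variable (C : CatOver.{w, v} S)

/-- An arrow is prone (cartesian) if every arrow over a composite factors uniquely through it. -/
def IsProne {a b : S} {u : a ⟶ b} {x : C.Ob a} {y : C.Ob b} (f : C.Hom u x y) : Prop :=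
  ∀ {c : S} (t : c ⟶ a) {tu : c ⟶ b} (h : t ≫ u = tu) (z : C.Ob c) (g : C.Hom tu z y),
    ∃! k : C.Hom t z x, C.comp h k f = g

/-- An arrow is supine (opcartesian) if every arrow over a composite factors uniquely through
it. -/
def IsSupine {a b : S} {u : a ⟶ b} {x : C.Ob a} {y : C.Ob b} (f : C.Hom u x y) : Prop :=
  ∀ {c : S} (t : b ⟶ c) {ut : a ⟶ c} (h : u ≫ t = ut) (z : C.Ob c) (g : C.Hom ut x z),
    ∃! k : C.Hom t y z, C.comp h f k = g

/-- A bifibration: every arrow of the base has a prone lift with given codomain and a supine lift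
with given domain. -/
structure IsBifibration : Prop where
  exists_prone : ∀ {a b : S} (u : a ⟶ b) (y : C.Ob b), ∃ (x : C.Ob a) (f : C.Hom u x y), C.IsProne f
  exists_supine : ∀ {a b : S} (u : a ⟶ b) (x : C.Ob a),
    ∃ (y : C.Ob b) (f : C.Hom u x y), C.IsSupine f

end Fibrations

section Cells

variable {C : CatOver.{w, v} S} {D : CatOver.{w', v'} S}

/-- A morphism of bifibrations: a 1-cell between bifibrations that preserves prone and supine
arrows. -/
structure OneCell.IsMorphismOfBifibrations (F : OneCell C D) : Prop where
  source : C.IsBifibration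
  target : D.IsBifibration
  map_prone : ∀ {a b : S} {u : a ⟶ b} {x : C.Ob a} {y : C.Ob b} (f : C.Hom u x y),
    C.IsProne f → D.IsProne (F.map f)
  map_supine : ∀ {a b : S} {u : a ⟶ b} {x : C.Ob a} {y : C.Ob b} (f : C.Hom u x y),
    C.IsSupine f → D.IsSupine (F.map f)

/-- An equivalence over `S`: a 1-cell that is bijective on arrows over each arrow of the base and
hits every object of each fibre up to a vertical isomorphism. -/
structure OneCell.IsEquivalence (F : OneCell C D) : Prop where
  bijective : ∀ {a b : S} (u : a ⟶ b) (x : C.Ob a) (y : C.Ob b),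
    Function.Bijective (F.map : C.Hom u x y → D.Hom u (F.obj x) (F.obj y))
  surjective : ∀ {a : S} (y : D.Ob a), ∃ (x : C.Ob a) (f : D.Hom (𝟙 a) (F.obj x) y)
    (g : D.Hom (𝟙 a) y (F.obj x)), D.vcomp f g = D.id _ ∧ D.vcomp g f = D.id _

/-- `C` is an rc 0-cell: every category of 1-cells into `C` has reflexive coequalizers, and they
are preserved by preceding with a 1-cell. -/
def IsRC.{w₁, v₂} (C : CatOver.{w, v} S) : Prop :=
  ∀ X : CatOver.{w₁, v₂} S, HasReflexiveCoequalizers (OneCell X C) ∧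
    ∀ (Y : CatOver.{w₁, v₂} S) (G : OneCell Y X),
      PreservesColimitsOfShape WalkingReflexivePair (G.precomp C)

/-- An rc 1-cell: a 1-cell between rc 0-cells which preserves reflexive coequalizers. -/
def OneCell.IsRC.{w₁, v₂} (F : OneCell C D) : Prop :=
  CatOver.IsRC.{w, v, v₁, u₁, w₁, v₂} C ∧ CatOver.IsRC.{w', v', v₁, u₁, w₁, v₂} D ∧
    ∀ X : CatOver.{w₁, v₂} S, PreservesColimitsOfShape WalkingReflexivePair (F.postcomp X)

/-- An adjunction `F ⊣ G` between 1-cells. -/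
structure Adj (F : OneCell C D) (G : OneCell D C) where
  unit : OneCell.id C ⟶ F.comp G
  counit : G.comp F ⟶ OneCell.id D
  left_triangle : ∀ {a : S} (x : C.Ob a),
    D.vcomp (F.map (unit.app x)) (counit.app (F.obj x)) = D.id (F.obj x)
  right_triangle : ∀ {a : S} (y : D.Ob a),
    C.vcomp (unit.app (G.obj y)) (G.map (counit.app y)) = C.id (G.obj y)

end Cells

/-! ### Monoidal objects -/

section Monoidal

variable {C : CatOver.{w, v} S} (T : OneCell (C.prod C) C) (I : OneCell (one S) C)

/-- The 1-cell `(A, B, C) ↦ A ⊗ (B ⊗ C)`. -/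
def tensorRight : OneCell (C.prod (C.prod C)) C :=
  ((OneCell.id C).prodMap T).comp T

/-- The 1-cell `(A, B, C) ↦ (A ⊗ B) ⊗ C`. -/
def tensorLeft : OneCell (C.prod (C.prod C)) C where
  obj x := T.obj (T.obj (x.1, x.2.1), x.2.2)
  map f := T.map (pair (T.map (pair f.1 f.2.1)) f.2.2)
  map_id x := (congrArg (fun k => T.map (pair k (C.id x.2.2))) (T.map_id (x.1, x.2.1))).trans
      (T.map_id (T.obj (x.1, x.2.1), x.2.2))
  map_comp h f g := (congrArg (fun k => T.map (pair k (C.comp h f.2.2 g.2.2)))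
      (T.map_comp h (pair f.1 f.2.1) (pair g.1 g.2.1))).trans
      (T.map_comp h (pair (T.map (pair f.1 f.2.1)) f.2.2) (pair (T.map (pair g.1 g.2.1)) g.2.2))

/-- The 1-cell `A ↦ I ⊗ A`. -/
def unitTensor : OneCell C C where
  obj x := T.obj (I.obj ⟨⟩, x)
  map f := T.map (pair (I.map ⟨⟩) f)
  map_id x := (congrArg (fun k => T.map (pair k (C.id x))) (I.map_id ⟨⟩)).trans (T.map_id (_, x))
  map_comp h f g := (congrArg (fun k => T.map (pair k (C.comp h f g)))
      (I.map_comp (x := ⟨⟩) (y := ⟨⟩) (z := ⟨⟩) h ⟨⟩ ⟨⟩)).trans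
      (T.map_comp h (pair (I.map ⟨⟩) f) (pair (I.map ⟨⟩) g))

/-- The 1-cell `A ↦ A ⊗ I`. -/
def tensorUnit : OneCell C C where
  obj x := T.obj (x, I.obj ⟨⟩)
  map f := T.map (pair f (I.map ⟨⟩))
  map_id x := (congrArg (fun k => T.map (pair (C.id x) k)) (I.map_id ⟨⟩)).trans (T.map_id (x, _))
  map_comp h f g := (congrArg (fun k => T.map (pair (C.comp h f g) k))
      (I.map_comp (x := ⟨⟩) (y := ⟨⟩) (z := ⟨⟩) h ⟨⟩ ⟨⟩)).trans
      (T.map_comp h (pair f (I.map ⟨⟩)) (pair g (I.map ⟨⟩)))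

/-- The structure of a monoidal object on `C` with tensor product `T` and unit `I`. -/
structure MonoidalStr where
  /-- `A ⊗ (B ⊗ C) ≅ (A ⊗ B) ⊗ C` -/
  α : tensorRight T ≅ tensorLeft T
  /-- `I ⊗ A ≅ A` -/
  lam : unitTensor T I ≅ OneCell.id C
  /-- `A ⊗ I ≅ A` -/
  ρ : tensorUnit T I ≅ OneCell.id C
  pentagon : ∀ {a : S} (x y z t : C.Ob a),
    C.vcomp (C.vcomp (T.map (pair (C.id x) (α.hom.app (y, (z, t)))))
        (α.hom.app (x, (T.obj (y, z), t))))
      (T.map (pair (α.hom.app (x, (y, z))) (C.id t))) =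
    C.vcomp (α.hom.app (x, (y, T.obj (z, t)))) (α.hom.app (T.obj (x, y), (z, t)))
  triangle : ∀ {a : S} (x y : C.Ob a),
    C.vcomp (α.hom.app (x, (I.obj ⟨⟩, y))) (T.map (pair (ρ.hom.app x) (C.id y))) =
      T.map (pair (C.id x) (lam.hom.app y))

end Monoidal

section MonoidalCells

variable {C : CatOver.{w, v} S} {D : CatOver.{w', v'} S}
  {T : OneCell (C.prod C) C} {I : OneCell (one S) C}
  {T' : OneCell (D.prod D) D} {I' : OneCell (one S) D}

/-- The structure of a lax monoidal 1-cell on `F`. -/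
structure LaxMonoidalStr (m : MonoidalStr T I) (m' : MonoidalStr T' I') (F : OneCell C D) where
  /-- `F A ⊗ F B ⟶ F (A ⊗ B)` -/
  φ : (F.prodMap F).comp T' ⟶ T.comp F
  /-- `I ⟶ F I` -/
  φ₀ : I' ⟶ I.comp F
  associativity : ∀ {a : S} (x y z : C.Ob a),
    D.vcomp (D.vcomp (m'.α.hom.app (F.obj x, (F.obj y, F.obj z)))
        (T'.map (pair (φ.app (x, y)) (D.id (F.obj z)))))
      (φ.app (T.obj (x, y), z)) =
    D.vcomp (D.vcomp (T'.map (pair (D.id (F.obj x)) (φ.app (y, z))))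
        (φ.app (x, T.obj (y, z))))
      (F.map (m.α.hom.app (x, (y, z))))
  left_unitality : ∀ {a : S} (x : C.Ob a),
    D.vcomp (D.vcomp (T'.map (pair (φ₀.app ⟨⟩) (D.id (F.obj x))))
        (φ.app (I.obj ⟨⟩, x))) (F.map (m.lam.hom.app x)) = m'.lam.hom.app (F.obj x)
  right_unitality : ∀ {a : S} (x : C.Ob a),
    D.vcomp (D.vcomp (T'.map (pair (D.id (F.obj x)) (φ₀.app ⟨⟩)))
        (φ.app (x, I.obj ⟨⟩))) (F.map (m.ρ.hom.app x)) = m'.ρ.hom.app (F.obj x)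

/-- A lax monoidal 1-cell is strong if its structure 2-cells are invertible. -/
def LaxMonoidalStr.IsStrong {m : MonoidalStr T I} {m' : MonoidalStr T' I'} {F : OneCell C D}
    (s : LaxMonoidalStr m m' F) : Prop :=
  IsIso s.φ ∧ IsIso s.φ₀

end MonoidalCells

end CatOver

/-! ### The free strict monoidal category -/

/-- The objects of the free strict monoidal category on `O`: finite words of objects of `O`. -/
structure Word (O : Type u₁) where
  len : ℕ
  letter : Fin len → O

namespace Word

variable {O : Type u₁} [Category.{v₁} O] {Q : Type w} [Category.{v} Q]

/-- An arrow between words: the words have the same length, and there is an arrow from each letter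
of the first to the corresponding letter of the second. -/
structure Hom (p q : Word O) where
  len_eq : p.len = q.len
  app : ∀ i, p.letter i ⟶ q.letter (Fin.cast len_eq i)

theorem Hom.ext {p q : Word O} {f g : Hom p q} (h : ∀ i, f.app i = g.app i) : f = g := by
  cases f; cases g; congr; funext i; exact h i

instance : Category (Word O) where
  Hom := Hom
  id p := ⟨rfl, fun i => 𝟙 (p.letter i)⟩
  comp f g := ⟨f.len_eq.trans g.len_eq, fun i => f.app i ≫ g.app (Fin.cast f.len_eq i)⟩
  id_comp _ := Hom.ext fun _ => Category.id_comp _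
  comp_id _ := Hom.ext fun _ => Category.comp_id _
  assoc _ _ _ := Hom.ext fun _ => Category.assoc _ _ _

/-- The free strict monoidal category monad on functors: apply `F` to each letter. -/
def map (F : O ⥤ Q) : Word O ⥤ Word Q where
  obj p := ⟨p.len, fun i => F.obj (p.letter i)⟩
  map f := ⟨f.len_eq, fun i => F.map (f.app i)⟩
  map_id _ := Hom.ext fun _ => F.map_id _
  map_comp _ _ := Hom.ext fun _ => F.map_comp _ _

/-- The unit `η` of the monad: an object as a word of length one. -/
def unit (O : Type u₁) [Category.{v₁} O] : O ⥤ Word O where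
  obj o := ⟨1, fun _ => o⟩
  map f := ⟨rfl, fun _ => f⟩
  map_id _ := rfl
  map_comp _ _ := rfl

/-- A way to write a word of length `m` as a concatenation of `n` words, given by the places
`0 = c₀ ≤ c₁ ≤ ⋯ ≤ cₙ = m` where it is cut. -/
@[ext]
structure Cut (n m : ℕ) where
  pos : Fin (n + 1) → ℕ
  mono : Monotone pos
  pos_zero : pos 0 = 0
  pos_last : pos (Fin.last n) = m

/-- The place in the whole word of the `j`-th letter of the `i`-th part. -/
def Cut.index {n m : ℕ} (c : Cut n m) (i : Fin n) (j : Fin (c.pos i.succ - c.pos i.castSucc)) :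
    Fin m :=
  ⟨c.pos i.castSucc + j, by
    have h := c.mono (Fin.le_last i.succ)
    have := c.pos_last
    omega⟩

/-- The `i`-th of the words into which `w` is cut. -/
def block {n : ℕ} (w : Word O) (c : Cut n w.len) (i : Fin n) : Word O where
  len := c.pos i.succ - c.pos i.castSucc
  letter j := w.letter (c.index i j)

/-- The words into which `w` is cut have `w` as their concatenation. -/
theorem flatten_blocks {P : Type u₁} {n : ℕ} (w : Word P) (c : Cut n w.len) :
    (List.ofFn fun i => List.ofFn (w.block c i).letter).flatten = List.ofFn w.letter := by
  have key : ∀ i : Fin n, List.ofFn (w.block c i).letter =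
      ((List.ofFn w.letter).take (c.pos i.succ)).drop (c.pos i.castSucc) := fun i => by
    have h₁ := c.mono (Fin.le_last i.succ)
    have h₂ := c.pos_last
    refine List.ext_getElem ?_ fun k h h' => ?_
    · simp [block]
      omega
    · simp [block, Cut.index]
  have main : ∀ (k : ℕ) (hk : k ≤ n),
      (List.ofFn fun i : Fin k => List.ofFn (w.block c (Fin.castLE hk i)).letter).flatten =
        (List.ofFn w.letter).take (c.pos ⟨k, Nat.lt_succ_of_le hk⟩) := by
    intro k
    induction k with
    | zero => intro hk; simpa using Or.inl c.pos_zero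
    | succ k ih =>
      intro hk
      have hm : c.pos ⟨k, by omega⟩ ≤ c.pos ⟨k + 1, by omega⟩ := c.mono (by simp)
      rw [List.ofFn_succ', List.concat_eq_append, List.flatten_append]
      have := ih (by omega)
      simp only [Fin.castLE_castSucc] at *
      rw [this, List.flatten_singleton, key]
      change _ ++ ((List.ofFn w.letter).take (c.pos ⟨k + 1, _⟩)).drop (c.pos ⟨k, _⟩) = _
      conv_rhs => rw [← List.take_append_drop (c.pos ⟨k, by omega⟩)
        ((List.ofFn w.letter).take (c.pos ⟨k + 1, by omega⟩))]
      rw [List.take_take, min_eq_left hm]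
  have h := main n le_rfl
  simp only [Fin.castLE_rfl] at h
  have h' : c.pos ⟨n, Nat.lt_succ_of_le le_rfl⟩ = w.len := c.pos_last
  rw [h'] at h
  rw [List.take_of_length_le (by simp)] at h
  exact h

/-- The same cut, of a word of the same length, into the same number of words. -/
def Cut.cast {n n' m m' : ℕ} (c : Cut n m) (hn : n' = n) (hm : m = m') : Cut n' m' where
  pos i := c.pos (Fin.cast (congrArg (· + 1) hn) i)
  mono _ _ h := c.mono h
  pos_zero := c.pos_zero
  pos_last := by subst hn hm; exact c.pos_last

/-- An arrow between words restricts to the blocks. -/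
def blockMap {n : ℕ} {w w' : Word O} (g : w ⟶ w') (c : Cut n w.len) (i : Fin n) :
    w.block c i ⟶ w'.block (c.cast rfl g.len_eq) i :=
  ⟨rfl, fun _ => g.app _⟩

end Word

/-! ### Coends -/

section Coend

variable {J : Type u} [Category.{u} J] {K : Type u} [Category.{u} K]

/-- The bifunctor `(j', j) ↦ A j × P j'`. -/
def pairing (A : J ⥤ Type u) (P : Jᵒᵖ ⥤ Type u) : Jᵒᵖ ⥤ J ⥤ Type u where
  obj j' :=
    { obj := fun j => A.obj j × P.obj j'
      map := fun f => ↾fun x => (A.map f x.1, P.map (𝟙 j') x.2)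
      map_id := fun j => by ext x <;> simp
      map_comp := fun f g => by ext x <;> simp }
  map f := { app := fun j => ↾fun x => (x.1, P.map f x.2)
             naturality := fun j k g => by ext x <;> simp }
  map_id j := by ext k x <;> simp
  map_comp f g := by ext k x <;> simp

/-- The coend `∫^j A j × P j`. -/
abbrev Ten (A : J ⥤ Type u) (P : Jᵒᵖ ⥤ Type u) : Type u :=
  Types.coend.{u, u, u} (pairing A P)

namespace Ten

variable {A : J ⥤ Type u} {P : Jᵒᵖ ⥤ Type u} {B : K ⥤ Type u} {R : Kᵒᵖ ⥤ Type u}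

/-- The class `[a, x]` of a pair of elements `a ∈ A j` and `x ∈ P j`. -/
def mk {j : J} (a : A.obj j) (x : P.obj (op j)) : Ten A P :=
  Quot.mk _ ⟨j, (a, x)⟩

theorem sound {j k : J} (v : j ⟶ k) (a : A.obj j) (x : P.obj (op k)) :
    (mk a (P.map v.op x) : Ten A P) = mk (A.map v a) x := by
  have h := Quot.sound (Types.coendRel.mk.{u, u, u} (F := pairing A P) v (a, x))
  have h₁ : P.map (𝟙 (op k)) x = x := by simp
  change (mk a (P.map v.op x) : Ten A P) = mk (A.map v a) (P.map (𝟙 (op k)) x) at h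
  rwa [h₁] at h

theorem ind {p : Ten A P → Prop} (h : ∀ (j : J) (a : A.obj j) (x : P.obj (op j)), p (mk a x))
    (z : Ten A P) : p z := by
  obtain ⟨j, a, x⟩ := z
  exact h j a x

/-- Maps out of the coend. -/
def lift {Z : Type*} (f : ∀ (j : J), A.obj j → P.obj (op j) → Z)
    (hf : ∀ {j k : J} (v : j ⟶ k) (a : A.obj j) (x : P.obj (op k)),
      f j a (P.map v.op x) = f k (A.map v a) x) : Ten A P → Z :=
  Quot.lift (fun z => f z.1 z.2.1 z.2.2) (by
    rintro _ _ ⟨v, ⟨a, x⟩⟩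
    rename_i j k
    have h₁ : P.map (𝟙 (op k)) x = x := by simp
    exact (hf v a x).trans (congrArg (f k (A.map v a)) h₁.symm))

/-- The map of coends induced by a functor `F` and by transformations `A ⟶ B F`, `P ⟶ R F`. -/
def map (F : J ⥤ K) (σ : A ⟶ F ⋙ B) (τ : P ⟶ F.op ⋙ R) : Ten A P → Ten B R :=
  lift (fun j a x => mk (j := F.obj j) (σ.app j a) (τ.app (op j) x)) fun v a x => by
    have h₁ := NatTrans.naturality_apply σ v a
    have h₂ := NatTrans.naturality_apply τ v.op x
    dsimp only [Functor.comp_map, Functor.op_map] at h₁ h₂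
    rw [h₁, h₂]
    exact sound (F.map v) _ _

end Ten

end Coend

/-! ### The categories over `Cat` -/

/-- Presheaves on `O`, that is, discrete fibrations over `O`. -/
abbrev PSh (O : Type u) [Category.{u} O] := Oᵒᵖ ⥤ Type u

/-- Reindexing of presheaves along a functor. -/
abbrev reindex {O Q : Type u} [Category.{u} O] [Category.{u} Q] (F : O ⥤ Q) : PSh Q ⥤ PSh O :=
  (Functor.whiskeringLeft Oᵒᵖ Qᵒᵖ (Type u)).obj F.op

/-- `DFib → Cat`: over `O` the presheaves on `O`; an arrow from `X` to `Y` over `u` is a map from `X` to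
the reindexing of `Y` along `u`. -/
def DFib : CatOver.{u + 1, u} Cat.{u, u} where
  Ob O := PSh O
  Hom u X Y := X ⟶ (reindex u.toFunctor).obj Y
  id X := 𝟙 X
  comp {O Q R u v t X Y Z} h f g :=
    h ▸ (show X ⟶ (reindex (u ≫ v).toFunctor).obj Z from f ≫ (reindex u.toFunctor).map g)
  id_comp f := Category.id_comp (X := _) f
  comp_id f := Category.comp_id f
  assoc h₁ h₂ h₃ h₄ f g k := by
    subst h₁ h₂ h₃
    rfl

/-- `Gph_2fi(M) → Cat`: over `O` the profunctors `(o, w) ↦ A(o; w)` contravariant in `o ∈ O` and covariant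
in `w ∈ M(O)`; an arrow from `A` to `B` over `u` is a natural family of maps
`A(o; w) ⟶ B(u(o); M(u)(w))`. -/
def Gph : CatOver.{u + 1, u} Cat.{u, u} where
  Ob O := Profunctor.{u} (Word O) O
  Hom u A B := A ⟶ Word.map u.toFunctor ⋙ B ⋙ reindex u.toFunctor
  id A := 𝟙 A
  comp {O Q R u v t A B D} h f g :=
    h ▸ (show A ⟶ Word.map (u ≫ v).toFunctor ⋙ D ⋙ reindex (u ≫ v).toFunctor from
      f ≫ Functor.whiskerLeft (Word.map u.toFunctor) (Functor.whiskerRight g (reindex u.toFunctor)))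
  id_comp f := Category.id_comp (X := _) f
  comp_id f := Category.comp_id f
  assoc h₁ h₂ h₃ h₄ f g k := by
    subst h₁ h₂ h₃
    rfl

/-- `End(DFib) → Cat`, the exponential of `DFib` by itself: over `O` the endofunctors of the category of
presheaves on `O`; an arrow from `P` to `H` over `u` is a natural transformation
`P u^* ⟶ u^* H`. -/
def EndDFib : CatOver.{u + 1, u + 1} Cat.{u, u} where
  Ob O := PSh O ⥤ PSh O
  Hom u P H := reindex u.toFunctor ⋙ P ⟶ H ⋙ reindex u.toFunctor
  id P := 𝟙 P
  comp {O Q R u v t P H K} h f g :=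
    h ▸ (show reindex (u ≫ v).toFunctor ⋙ P ⟶ K ⋙ reindex (u ≫ v).toFunctor from
      Functor.whiskerLeft (reindex v.toFunctor) f ≫ Functor.whiskerRight g (reindex u.toFunctor))
  id_comp f := Category.id_comp (X := _) f
  comp_id f := Category.comp_id f
  assoc h₁ h₂ h₃ h₄ f g k := by
    subst h₁ h₂ h₃
    rfl

/-! ### The action of graphs on presheaves -/

section Action

variable {O Q : Type u} [Category.{u} O] [Category.{u} Q]

/-- The powers `w ↦ X^w = ∏ᵢ X(wᵢ)` of a presheaf `X`. -/
def pow (X : PSh O) : (Word O)ᵒᵖ ⥤ Type u where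
  obj w := ∀ i, X.obj (op (w.unop.letter i))
  map f := ↾fun x i => X.map (f.unop.app i).op (x (Fin.cast f.unop.len_eq i))
  map_id w := by
    ext x i
    exact ConcreteCategory.congr_hom (X.map_id (op (w.unop.letter i))) (x i)
  map_comp f g := by
    ext x i
    exact ConcreteCategory.congr_hom
      (X.map_comp (f.unop.app (Fin.cast g.unop.len_eq i)).op (g.unop.app i).op) (x _)

/-- The maps of powers given by a map from `X` to the reindexing of `Y` along `F`. -/
def powMap (F : O ⥤ Q) {X : PSh O} {Y : PSh Q} (g : X ⟶ (reindex F).obj Y) :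
    pow X ⟶ (Word.map F).op ⋙ pow Y where
  app w := ↾fun x i => g.app _ (x i)
  naturality w w' f := by
    ext x
    funext i
    exact ConcreteCategory.congr_hom (g.naturality (f.unop.app i).op) (x _)

/-- The presheaf `A ⋆ X`, with `(A ⋆ X)(o) = ∫^w A(o; w) × X^w`. -/
def act (A : Profunctor.{u} (Word O) O) (X : PSh O) : PSh O where
  obj o := Ten (A.flip.obj o) (pow X)
  map f := ↾(Ten.map (𝟭 _) (A.flip.map f) (𝟙 (pow X)))
  map_id o := by
    ext z
    induction z using Ten.ind with | h w a x => ?_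
    exact congrArg (fun b => (Ten.mk (A := A.flip.obj o) b x : Ten _ (pow X)))
      (ConcreteCategory.congr_hom ((A.obj w).map_id o) a)
  map_comp f g := by
    ext z
    induction z using Ten.ind with | h w a x => ?_
    exact congrArg (fun b => (Ten.mk (A := A.flip.obj _) b x : Ten _ (pow X)))
      (ConcreteCategory.congr_hom ((A.obj w).map_comp f g) a)

/-- The element `[a, x]` of `(A ⋆ X)(o)`, for `a ∈ A(o; w)` and `x ∈ X^w`. -/
def act.mk {A : Profunctor.{u} (Word O) O} {X : PSh O} {o : O} {w : Word O}
    (a : (A.obj w).obj (op o)) (x : ∀ i, X.obj (op (w.letter i))) : (act A X).obj (op o) :=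
  Ten.mk (A := A.flip.obj (op o)) (P := pow X) a x

/-- The action on arrows: `[a, x] ↦ [f a, g x]`. -/
def actMap (F : O ⥤ Q) {A : Profunctor.{u} (Word O) O} {B : Profunctor.{u} (Word Q) Q}
    {X : PSh O} {Y : PSh Q} (f : A ⟶ Word.map F ⋙ B ⋙ reindex F) (g : X ⟶ (reindex F).obj Y) :
    act A X ⟶ (reindex F).obj (act B Y) where
  app o := ↾(Ten.map (Word.map F) (B := B.flip.obj (F.op.obj o))
    { app := fun w => (f.app w).app o
      naturality := fun w w' h => congrArg (fun k => k.app o) (f.naturality h) } (powMap F g))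
  naturality o o' h := by
    ext z
    induction z using Ten.ind with | h w a x => ?_
    exact congrArg (fun b => (Ten.mk (A := B.flip.obj (F.op.obj o')) (P := pow Y) (j := (Word.map F).obj w)
        b ((powMap F g).app (op w) x)))
      (ConcreteCategory.congr_hom ((f.app w).naturality h) a)

end Action

/-- The action `⋆ : Gph_2fi(M) ×_Cat DFib → DFib`. -/
def star : CatOver.OneCell (Gph.{u}.prod DFib.{u}) DFib.{u} where
  obj x := act x.1 x.2
  map f := actMap _ f.1 f.2
  map_id x := by
    refine NatTrans.ext (funext fun o => ?_)
    ext z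
    induction z using Ten.ind with | h w a x => ?_
    rfl
  map_comp h f g := by
    subst h
    refine NatTrans.ext (funext fun o => ?_)
    ext z
    induction z using Ten.ind with | h w a x => ?_
    rfl

/-- The exponential adjoint `E → End(DFib)` of a 1-cell `E ×_Cat DFib → DFib`. -/
def curry {E : CatOver.{w, v} Cat.{u, u}} (F : CatOver.OneCell (E.prod DFib.{u}) DFib.{u}) :
    CatOver.OneCell E EndDFib.{u} where
  obj {O} e :=
    { obj := fun X => F.obj (e, X)
      map := fun {X Y} g => F.map (u := 𝟙 O) (x := (e, X)) (y := (e, Y)) (E.id e, g)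
      map_id := fun X => F.map_id (e, X)
      map_comp := fun {X Y Z} g h => by
        have := F.map_comp (u := 𝟙 O) (v := 𝟙 O) (x := (e, X)) (y := (e, Y)) (z := (e, Z))
          (Category.id_comp _) (E.id e, g) (E.id e, h)
        refine Eq.trans ?_ this
        refine congrArg (fun k => F.map (u := 𝟙 O) (x := (e, X)) (y := (e, Z)) (k, g ≫ h)) ?_
        exact (E.id_comp _).symm }
  map {O Q u e e'} f :=
    { app := fun Y => F.map (u := u) (x := (e, (reindex u.toFunctor).obj Y)) (y := (e', Y))
        (f, 𝟙 ((reindex u.toFunctor).obj Y))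
      naturality := fun Y Z g => by
        have h₁ := F.map_comp (u := 𝟙 O) (v := u) (x := (e, (reindex u.toFunctor).obj Y))
          (y := (e, (reindex u.toFunctor).obj Z)) (z := (e', Z)) (Category.id_comp u)
          (E.id e, (reindex u.toFunctor).map g) (f, 𝟙 ((reindex u.toFunctor).obj Z))
        have h₂ := F.map_comp (u := u) (v := 𝟙 Q) (x := (e, (reindex u.toFunctor).obj Y))
          (y := (e', Y)) (z := (e', Z)) (Category.comp_id u)
          (f, 𝟙 ((reindex u.toFunctor).obj Y)) (E.id e', g)
        refine h₁.symm.trans (Eq.trans ?_ h₂)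
        have k₁ : E.comp (Category.id_comp u) (E.id e) f = E.comp (Category.comp_id u) f (E.id e') := by
          rw [E.id_comp, E.comp_id]
        exact congrArg (fun k => F.map (u := u) (x := (e, (reindex u.toFunctor).obj Y)) (y := (e', Z))
          (k, (reindex u.toFunctor).map g)) k₁ }
  map_id e := by
    refine NatTrans.ext (funext fun X => ?_)
    exact F.map_id (e, X)
  map_comp {O Q R u v t e e' e''} h f g := by
    subst h
    refine NatTrans.ext (funext fun X => ?_)
    exact F.map_comp (u := u) (v := v) (x := (e, (reindex u.toFunctor).obj ((reindex v.toFunctor).obj X)))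
      (y := (e', (reindex v.toFunctor).obj X)) (z := (e'', X)) rfl
      (f, 𝟙 ((reindex u.toFunctor).obj ((reindex v.toFunctor).obj X))) (g, 𝟙 ((reindex v.toFunctor).obj X))

/-- The representation `r : Gph_2fi(M) → End(DFib)`. -/
def rep : CatOver.OneCell Gph.{u} EndDFib.{u} := curry star

/-! ### The tensor product of graphs -/

section Tensor

variable {O Q : Type u} [Category.{u} O] [Category.{u} Q]

/-- An element of `M(B)(p; w)`, for `p = (p₁, …, pₙ)`: a way to cut `w` into words `w₁, …, wₙ`,
and a word of elements `bᵢ ∈ B(pᵢ; wᵢ)`. -/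
structure WordElt (B : Profunctor.{u} (Word O) O) (p w : Word O) : Type u where
  cut : Word.Cut p.len w.len
  elt : ∀ i, (B.obj (w.block cut i)).obj (op (p.letter i))

theorem WordElt.congr {B : Profunctor.{u} (Word O) O} {p w : Word O} (c : Word.Cut p.len w.len)
    (b b' : ∀ i, (B.obj (w.block c i)).obj (op (p.letter i))) (h : ∀ i, b i = b' i) :
    (⟨c, b⟩ : WordElt B p w) = ⟨c, b'⟩ := by
  rw [funext h]

/-- The profunctor `M(B)`, for `B` a graph over `O`, that is the span `(M(γ), μ ∘ M(δ))`. -/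
def wordExt (B : Profunctor.{u} (Word O) O) : Profunctor.{u} (Word O) (Word O) where
  obj w :=
    { obj := fun p => WordElt B p.unop w
      map := fun v => ↾fun z => ⟨z.cut.cast v.unop.len_eq rfl,
        fun i => (B.obj (w.block z.cut (Fin.cast v.unop.len_eq i))).map (v.unop.app i).op
          (z.elt _)⟩
      map_id := fun p => by
        ext z
        exact WordElt.congr (B := B) z.cut _ _ fun i =>
          ConcreteCategory.congr_hom ((B.obj (w.block z.cut i)).map_id _) (z.elt i)
      map_comp := fun {p p' p''} f g => by
        ext z
        exact WordElt.congr (B := B) (z.cut.cast (g.unop.len_eq.trans f.unop.len_eq) rfl) _ _ fun i =>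
          ConcreteCategory.congr_hom ((B.obj (w.block z.cut _)).map_comp
            (f.unop.app (Fin.cast g.unop.len_eq i)).op (g.unop.app i).op) (z.elt _) }
  map {w w'} g :=
    { app := fun p => ↾fun z => ⟨z.cut.cast rfl g.len_eq,
        fun i => (B.map (Word.blockMap g z.cut i)).app _ (z.elt i)⟩
      naturality := fun p p' v => by
        ext z
        exact WordElt.congr (B := B) (p := p'.unop) (w := w') (z.cut.cast v.unop.len_eq g.len_eq) _ _
          fun i => ConcreteCategory.congr_hom
            ((B.map (Word.blockMap g z.cut _)).naturality (v.unop.app i).op) (z.elt _) }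
  map_id w := by
    refine NatTrans.ext (funext fun p => ?_)
    ext z
    exact WordElt.congr (B := B) z.cut _ _ fun i =>
      ConcreteCategory.congr_hom (NatTrans.congr_app (B.map_id (w.block z.cut i)) _) (z.elt i)
  map_comp {w w' w''} f g := by
    refine NatTrans.ext (funext fun p => ?_)
    ext z
    exact WordElt.congr (B := B) (z.cut.cast rfl (f.len_eq.trans g.len_eq)) _ _ fun i =>
      ConcreteCategory.congr_hom (NatTrans.congr_app
        (B.map_comp (Word.blockMap f z.cut i) (Word.blockMap g (z.cut.cast rfl f.len_eq) i)) _)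
        (z.elt i)

/-- The graph `A ⊗ B`, with `(A ⊗ B)(o; w) = ∫^p A(o; p) × M(B)(p; w)`. -/
def tens (A B : Profunctor.{u} (Word O) O) : Profunctor.{u} (Word O) O where
  obj w :=
    { obj := fun o => Ten (A.flip.obj o) ((wordExt B).obj w)
      map := fun f => ↾(Ten.map (𝟭 _) (A.flip.map f) (𝟙 ((wordExt B).obj w)))
      map_id := fun o => by
        ext z
        induction z using Ten.ind with | h p a b => ?_
        exact congrArg (fun a' => (Ten.mk (A := A.flip.obj o) a' b : Ten _ ((wordExt B).obj w)))
          (ConcreteCategory.congr_hom ((A.obj p).map_id o) a)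
      map_comp := fun f g => by
        ext z
        induction z using Ten.ind with | h p a b => ?_
        exact congrArg (fun a' => (Ten.mk (A := A.flip.obj _) a' b : Ten _ ((wordExt B).obj w)))
          (ConcreteCategory.congr_hom ((A.obj p).map_comp f g) a) }
  map g :=
    { app := fun o => ↾(Ten.map (𝟭 _) (𝟙 (A.flip.obj o)) ((wordExt B).map g))
      naturality := fun o o' f => by
        ext z
        induction z using Ten.ind with | h p a b => ?_
        rfl }
  map_id w := by
    ext o z
    induction z using Ten.ind with | h p a b => ?_
    exact congrArg (fun b' => (Ten.mk (A := A.flip.obj o) a b' : Ten _ ((wordExt B).obj w)))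
      (ConcreteCategory.congr_hom (NatTrans.congr_app ((wordExt B).map_id w) (op p)) b)
  map_comp f g := by
    ext o z
    induction z using Ten.ind with | h p a b => ?_
    exact congrArg (fun b' => (Ten.mk (A := A.flip.obj o) a b' : Ten _ ((wordExt B).obj _)))
      (ConcreteCategory.congr_hom (NatTrans.congr_app ((wordExt B).map_comp f g) (op p)) b)

/-- The element `[a, (b₁, …, bₙ)]` of `(A ⊗ B)(o; w)`, for `a ∈ A(o; p)` and `bᵢ ∈ B(pᵢ; wᵢ)`, where
`w` is cut into the words `wᵢ`. -/
def tens.mk {A B : Profunctor.{u} (Word O) O} {o : O} {p w : Word O}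
    (a : (A.obj p).obj (op o)) (c : Word.Cut p.len w.len)
    (b : ∀ i, (B.obj (w.block c i)).obj (op (p.letter i))) : ((tens A B).obj w).obj (op o) :=
  Ten.mk (A := A.flip.obj (op o)) (P := (wordExt B).obj w) a (⟨c, b⟩ : WordElt B p w)

/-- The maps `M(B)(p; w) ⟶ M(B')(M(F)(p); M(F)(w))` given by an arrow of graphs over `F`. -/
def wordExtMap (F : O ⥤ Q) {B : Profunctor.{u} (Word O) O} {B' : Profunctor.{u} (Word Q) Q}
    (f : B ⟶ Word.map F ⋙ B' ⋙ reindex F) (w : Word O) :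
    (wordExt B).obj w ⟶ (Word.map F).op ⋙ (wordExt B').obj ((Word.map F).obj w) where
  app p := ↾fun z => ⟨z.cut, fun i => (f.app (w.block z.cut i)).app _ (z.elt i)⟩
  naturality p p' v := by
    ext z
    exact WordElt.congr (B := B') (p := (Word.map F).obj p'.unop) (w := (Word.map F).obj w)
      (z.cut.cast v.unop.len_eq rfl) _ _ fun i =>
      ConcreteCategory.congr_hom ((f.app (w.block z.cut _)).naturality (v.unop.app i).op) (z.elt _)

/-- The tensor product on arrows: `[a, (b₁, …, bₙ)] ↦ [f a, (g b₁, …, g bₙ)]`. -/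
def tensMap (F : O ⥤ Q) {A B : Profunctor.{u} (Word O) O} {A' B' : Profunctor.{u} (Word Q) Q}
    (f : A ⟶ Word.map F ⋙ A' ⋙ reindex F) (g : B ⟶ Word.map F ⋙ B' ⋙ reindex F) :
    tens A B ⟶ Word.map F ⋙ tens A' B' ⋙ reindex F where
  app w :=
    { app := fun o => ↾(Ten.map (Word.map F) (B := A'.flip.obj (F.op.obj o))
        { app := fun p => (f.app p).app o
          naturality := fun p p' h => NatTrans.congr_app (f.naturality h) o }
        (wordExtMap F g w))
      naturality := fun o o' h => by
        ext z
        induction z using Ten.ind with | h p a b => ?_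
        exact congrArg (fun a' => (Ten.mk (A := A'.flip.obj (F.op.obj o'))
            (P := (wordExt B').obj ((Word.map F).obj w)) (j := (Word.map F).obj p)
            a' ((wordExtMap F g w).app (op p) b)))
          (ConcreteCategory.congr_hom ((f.app p).naturality h) a) }
  naturality w w' h := by
    ext o z
    induction z using Ten.ind with | h p a b => ?_
    refine congrArg (fun b' => (Ten.mk (A := A'.flip.obj (F.op.obj o))
      (P := (wordExt B').obj ((Word.map F).obj w')) (j := (Word.map F).obj p)
      ((f.app p).app o a) b')) ?_
    exact WordElt.congr (B := B') (p := (Word.map F).obj p) (w := (Word.map F).obj w')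
      (b.cut.cast rfl h.len_eq) _ _ fun i => ConcreteCategory.congr_hom
        (NatTrans.congr_app (g.naturality (Word.blockMap h b.cut i)) _) (b.elt i)

end Tensor

/-- The tensor product `⊗ : Gph_2fi(M) ×_Cat Gph_2fi(M) → Gph_2fi(M)`. -/
def gphTensor : CatOver.OneCell (Gph.{u}.prod Gph.{u}) Gph.{u} where
  obj x := tens x.1 x.2
  map f := tensMap _ f.1 f.2
  map_id x := by
    refine NatTrans.ext (funext fun w => NatTrans.ext (funext fun o => ?_))
    ext z
    induction z using Ten.ind with | h p a b => ?_
    rfl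
  map_comp h f g := by
    subst h
    refine NatTrans.ext (funext fun w => NatTrans.ext (funext fun o => ?_))
    ext z
    induction z using Ten.ind with | h p a b => ?_
    rfl

/-- The unit of the tensor product: over `O`, the profunctor `(o; w) ↦ M(O)(η(o), w)`. -/
def gphUnit : CatOver.OneCell (CatOver.one Cat.{u, u}) Gph.{u} where
  obj {O} _ := (Word.unit O).toProfunctorRev
  map {O Q u _ _} _ :=
    { app := fun w => { app := fun o => ↾fun f => (Word.map u.toFunctor).map f
                        naturality := fun o o' g => by
                          ext f
                          exact (Word.map u.toFunctor).map_comp ((Word.unit O).map g.unop) f }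
      naturality := fun w w' g => by
        refine NatTrans.ext (funext fun o => ?_)
        ext f
        exact (Word.map u.toFunctor).map_comp f g }
  map_id _ := rfl
  map_comp h _ _ := by subst h; rfl

/-! ### Composition of endofunctors -/

theorem square_aux {O Q : Type u} [Category.{u} O] [Category.{u} Q] (F : PSh Q ⥤ PSh O)
    {P : PSh O ⥤ PSh O} {H : PSh Q ⥤ PSh Q} (f : F ⋙ P ⟶ H ⋙ F) {A : PSh O} {X Y Z : PSh Q}
    (a : A ⟶ F.obj X) (b : X ⟶ Y) (c : H.obj Y ⟶ Z) :
    P.map (a ≫ F.map b) ≫ f.app Y ≫ F.map c = (P.map a ≫ f.app X) ≫ F.map (H.map b ≫ c) := by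
  have h := f.naturality b
  dsimp at h
  simp only [Functor.map_comp, Category.assoc]
  rw [reassoc_of% h]

/-- The composition `(P, H) ↦ P ∘ H` of endofunctors. -/
def endComp : CatOver.OneCell (EndDFib.{u}.prod EndDFib.{u}) EndDFib.{u} where
  obj x := x.2 ⋙ x.1
  map {O Q u x y} f :=
    (Functor.whiskerRight f.2 x.1 ≫ Functor.whiskerLeft y.2 f.1 :
      (reindex u.toFunctor ⋙ x.2) ⋙ x.1 ⟶ y.2 ⋙ y.1 ⋙ reindex u.toFunctor)
  map_id x := by
    refine NatTrans.ext (funext fun X => ?_)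
    exact (Category.comp_id _).trans (x.1.map_id _)
  map_comp {O Q R u v t x y z} h f g := by
    subst h
    exact NatTrans.ext (funext fun X => square_aux (reindex u.toFunctor) f.1
      (f.2.app ((reindex v.toFunctor).obj X)) (g.2.app X) (g.1.app (z.2.obj X)))

/-- The identity endofunctors. -/
def endUnit : CatOver.OneCell (CatOver.one Cat.{u, u}) EndDFib.{u} where
  obj {O} _ := 𝟭 (PSh O)
  map {O Q u _ _} _ := 𝟙 (reindex u.toFunctor)
  map_id _ := rfl
  map_comp h _ _ := by subst h; rfl

section EndMonoidal

variable {O Q : Type u} [Category.{u} O] [Category.{u} Q] (F : PSh Q ⥤ PSh O)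
  {P₁ P₂ P₃ : PSh O ⥤ PSh O} {H₁ H₂ H₃ : PSh Q ⥤ PSh Q}
  (f₁ : F ⋙ P₁ ⟶ H₁ ⋙ F) (f₂ : F ⋙ P₂ ⟶ H₂ ⋙ F) (f₃ : F ⋙ P₃ ⟶ H₃ ⋙ F) (X : PSh Q)

theorem endAssoc_aux :
    P₁.map (P₂.map (f₃.app X) ≫ f₂.app (H₃.obj X)) ≫ f₁.app (H₂.obj (H₃.obj X)) =
      P₁.map (P₂.map (f₃.app X)) ≫ P₁.map (f₂.app (H₃.obj X)) ≫ f₁.app (H₂.obj (H₃.obj X)) := by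
  rw [Functor.map_comp, Category.assoc]

theorem endUnit_aux : P₁.map (𝟙 (F.obj X)) ≫ f₁.app X = f₁.app X := by
  rw [P₁.map_id, Category.id_comp]

end EndMonoidal

/-- The strict monoidal structure on `End(DFib)` given by composition. -/
def endMonoidal : CatOver.MonoidalStr endComp.{u} endUnit.{u} where
  α :=
    { hom := ⟨fun x => EndDFib.id (x.2.2 ⋙ x.2.1 ⋙ x.1), fun {O Q u x y} f => by
        refine (EndDFib.comp_id ((CatOver.tensorRight endComp.{u}).map f)).trans ?_
        refine Eq.trans ?_ (EndDFib.id_comp ((CatOver.tensorLeft endComp.{u}).map f)).symm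
        exact NatTrans.ext (funext fun X => endAssoc_aux (reindex u.toFunctor) f.1 f.2.1 f.2.2 X)⟩
      inv := ⟨fun x => EndDFib.id (x.2.2 ⋙ x.2.1 ⋙ x.1), fun {O Q u x y} f => by
        refine (EndDFib.comp_id ((CatOver.tensorLeft endComp.{u}).map f)).trans ?_
        refine Eq.trans ?_ (EndDFib.id_comp ((CatOver.tensorRight endComp.{u}).map f)).symm
        exact NatTrans.ext (funext fun X => (endAssoc_aux (reindex u.toFunctor) f.1 f.2.1 f.2.2 X).symm)⟩
      hom_inv_id := CatOver.TwoCell.ext (funext fun _ => funext fun _ => EndDFib.id_comp _)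
      inv_hom_id := CatOver.TwoCell.ext (funext fun _ => funext fun _ => EndDFib.id_comp _) }
  lam :=
    { hom := ⟨fun x => EndDFib.id x, fun {O Q u x y} f => by
        refine (EndDFib.comp_id ((CatOver.unitTensor endComp.{u} endUnit.{u}).map f)).trans ?_
        refine Eq.trans ?_ (EndDFib.id_comp ((CatOver.OneCell.id EndDFib.{u}).map f)).symm
        exact NatTrans.ext (funext fun X => Category.comp_id (X := _) (f.app X))⟩
      inv := ⟨fun x => EndDFib.id x, fun {O Q u x y} f => by
        refine (EndDFib.comp_id ((CatOver.OneCell.id EndDFib.{u}).map f)).trans ?_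
        refine Eq.trans ?_ (EndDFib.id_comp ((CatOver.unitTensor endComp.{u} endUnit.{u}).map f)).symm
        exact NatTrans.ext (funext fun X => (Category.comp_id (X := _) (f.app X)).symm)⟩
      hom_inv_id := CatOver.TwoCell.ext (funext fun _ => funext fun _ => EndDFib.id_comp _)
      inv_hom_id := CatOver.TwoCell.ext (funext fun _ => funext fun _ => EndDFib.id_comp _) }
  ρ :=
    { hom := ⟨fun x => EndDFib.id x, fun {O Q u x y} f => by
        refine (EndDFib.comp_id ((CatOver.tensorUnit endComp.{u} endUnit.{u}).map f)).trans ?_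
        refine Eq.trans ?_ (EndDFib.id_comp ((CatOver.OneCell.id EndDFib.{u}).map f)).symm
        exact NatTrans.ext (funext fun X => endUnit_aux (reindex u.toFunctor) f X)⟩
      inv := ⟨fun x => EndDFib.id x, fun {O Q u x y} f => by
        refine (EndDFib.comp_id ((CatOver.OneCell.id EndDFib.{u}).map f)).trans ?_
        refine Eq.trans ?_ (EndDFib.id_comp ((CatOver.tensorUnit endComp.{u} endUnit.{u}).map f)).symm
        exact NatTrans.ext (funext fun X => (endUnit_aux (reindex u.toFunctor) f X).symm)⟩
      hom_inv_id := CatOver.TwoCell.ext (funext fun _ => funext fun _ => EndDFib.id_comp _)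
      inv_hom_id := CatOver.TwoCell.ext (funext fun _ => funext fun _ => EndDFib.id_comp _) }
  pentagon x y z t := by
    have h₁ := endComp.{u}.map_id (x, t ⋙ z ⋙ y)
    have h₂ := endComp.{u}.map_id (z ⋙ y ⋙ x, t)
    refine Eq.trans (congrArg₂ EndDFib.{u}.vcomp (congrArg₂ EndDFib.{u}.vcomp h₁ rfl) h₂) ?_
    exact (EndDFib.comp_id _).trans (EndDFib.comp_id _)
  triangle x y := EndDFib.id_comp _

/-! ### The right adjoint -/

section RightAdjoint

variable {O Q : Type u} [Category.{u} O] [Category.{u} Q]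

theorem iota_congr {w : Word O} {o : O} (i : Fin w.len) {f g : o ⟶ w.letter i} (h : f = g) :
    (⟨i, f⟩ : Σ i, (o ⟶ w.letter i)) = ⟨i, g⟩ := by
  rw [h]

/-- The embedding `ι` of `M(O)` in the presheaves on `O`, sending a word `(o₁, …, oₙ)` to the
coproduct `Y(o₁) + ⋯ + Y(oₙ)` of the representable presheaves. -/
def iota (O : Type u) [Category.{u} O] : Word O ⥤ PSh O where
  obj w :=
    { obj := fun o => Σ i, (o.unop ⟶ w.letter i)
      map := fun f => ↾fun z => ⟨z.1, f.unop ≫ z.2⟩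
      map_id := fun o => by
        refine ConcreteCategory.hom_ext _ _ fun z => ?_
        exact iota_congr (w := w) (o := o.unop) z.1 (Category.id_comp z.2)
      map_comp := fun f g => by
        refine ConcreteCategory.hom_ext _ _ fun z => ?_
        exact iota_congr (w := w) z.1 (Category.assoc g.unop f.unop z.2) }
  map {w w'} g :=
    { app := fun o => ↾fun z => ⟨Fin.cast g.len_eq z.1, z.2 ≫ g.app z.1⟩
      naturality := fun o o' f => by
        refine ConcreteCategory.hom_ext _ _ fun z => ?_
        exact iota_congr (w := w') (Fin.cast g.len_eq z.1) (Category.assoc f.unop z.2 (g.app z.1)) }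
  map_id w := by
    refine NatTrans.ext (funext fun o => ?_)
    refine ConcreteCategory.hom_ext _ _ fun z => ?_
    exact iota_congr (w := w) z.1 (Category.comp_id z.2)
  map_comp {w w' w''} f g := by
    refine NatTrans.ext (funext fun o => ?_)
    refine ConcreteCategory.hom_ext _ _ fun z => ?_
    exact iota_congr (w := w'') (Fin.cast (f.len_eq.trans g.len_eq) z.1)
      (Category.assoc z.2 (f.app z.1) (g.app (Fin.cast f.len_eq z.1))).symm

/-- The element of `ι(w)` over the `i`-th letter of `w` given by its identity. -/
def iotaGen (w : Word O) (i : Fin w.len) : ((iota O).obj w).obj (op (w.letter i)) :=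
  ⟨i, 𝟙 (w.letter i)⟩

/-- The map `ι(w) ⟶ X` corresponding to an element of `X^w`. -/
def iotaDesc {w : Word O} {X : PSh O} (x : ∀ i, X.obj (op (w.letter i))) : (iota O).obj w ⟶ X where
  app o := ↾fun z => X.map z.2.op (x z.1)
  naturality o o' f := by
    ext z
    exact ConcreteCategory.congr_hom (X.map_comp z.2.op f) (x z.1)

/-- The maps `ι(w) ⟶ F^*(ι(M(F)(w)))` sending an arrow `g` to a letter of `w` to `F(g)`. -/
def iotaMap (F : O ⥤ Q) : iota O ⟶ Word.map F ⋙ iota Q ⋙ reindex F where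
  app w :=
    { app := fun o => ↾fun z => ⟨z.1, F.map z.2⟩
      naturality := fun o o' f => by
        refine ConcreteCategory.hom_ext _ _ fun z => ?_
        exact iota_congr (w := (Word.map F).obj w) z.1 (F.map_comp f.unop z.2) }
  naturality w w' g := by
    refine NatTrans.ext (funext fun o => ?_)
    ext z
    exact iota_congr (w := (Word.map F).obj w') (Fin.cast g.len_eq z.1) (F.map_comp z.2 (g.app z.1))

end RightAdjoint

/-- The 1-cell `U : End(DFib) → Gph_2fi(M)`, with `U(H)(o; w) = H(ι(w))(o)`. -/
def repRight : CatOver.OneCell EndDFib.{u} Gph.{u} where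
  obj {O} H := iota O ⋙ H
  map {O Q u P H} τ :=
    (Functor.whiskerRight (iotaMap u.toFunctor) P ≫
      Functor.whiskerLeft (Word.map u.toFunctor ⋙ iota Q) τ :
        iota O ⋙ P ⟶ (Word.map u.toFunctor ⋙ iota Q) ⋙ H ⋙ reindex u.toFunctor)
  map_id {O} H := by
    refine NatTrans.ext (funext fun w => ?_)
    exact (Category.comp_id _).trans (H.map_id _)
  map_comp {O Q R u v t P H K} h f g := by
    subst h
    exact NatTrans.ext (funext fun w => square_aux (reindex u.toFunctor) f
      ((iotaMap u.toFunctor).app w) ((iotaMap v.toFunctor).app ((Word.map u.toFunctor).obj w))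
      (g.app ((iota R).obj ((Word.map (u ≫ v).toFunctor).obj w))))

/-! ### The presentation by fibrations -/

/-- A functor is a discrete fibration if every arrow to the image of an object has a unique lift
to an arrow to the object. -/
def IsDiscreteFib {X : Type w} [Category.{v} X] {O : Type u} [Category.{v'} O] (d : X ⥤ O) : Prop :=
  ∀ (x : X) {o : O} (f : o ⟶ d.obj x), ∃! l : Σ x' : X, (x' ⟶ x), d.IsHomLift f l.2

/-- A span `O ← A → Q` is a two-sided discrete fibration if every arrow to `γ(a)` has a unique lift
to an arrow to `a` over the identity of `δ(a)`, every arrow from `δ(a)` has a unique lift to an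
arrow from `a` over the identity of `γ(a)`, and every arrow of `A` is a composite of two lifts of
these kinds. -/
structure IsTwoSidedDiscreteFib {A : Type w} [Category.{v} A] {O : Type u} [Category.{v'} O]
    {Q : Type u₁} [Category.{v₁} Q] (γ : A ⥤ O) (δ : A ⥤ Q) : Prop where
  lift_left : ∀ (a : A) {o : O} (f : o ⟶ γ.obj a),
    ∃! l : Σ a' : A, (a' ⟶ a), γ.IsHomLift f l.2 ∧ δ.IsHomLift (𝟙 (δ.obj a)) l.2
  lift_right : ∀ (a : A) {q : Q} (g : δ.obj a ⟶ q),
    ∃! l : Σ a' : A, (a ⟶ a'), γ.IsHomLift (𝟙 (γ.obj a)) l.2 ∧ δ.IsHomLift g l.2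
  factor : ∀ {a b : A} (h : a ⟶ b), ∃ (c : A) (k : a ⟶ c) (l : c ⟶ b), k ≫ l = h ∧
    (γ.IsHomLift (𝟙 (γ.obj a)) k ∧ δ.IsHomLift (δ.map h) k) ∧
    (γ.IsHomLift (γ.map h) l ∧ δ.IsHomLift (𝟙 (δ.obj b)) l)

/-- A small discrete fibration over `O`. -/
structure DiscFib (O : Type u) [Category.{u} O] where
  tot : Type u
  [cat : Category.{u} tot]
  d : tot ⥤ O
  isFib : IsDiscreteFib d

/-- An `M`-graph over `O` that is a two-sided discrete fibration. -/
structure FibGraph (O : Type u) [Category.{u} O] where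
  tot : Type u
  [cat : Category.{u} tot]
  γ : tot ⥤ O
  δ : tot ⥤ Word O
  isFib : IsTwoSidedDiscreteFib γ δ

attribute [instance] DiscFib.cat FibGraph.cat

/-- The category over `Cat` of small discrete fibrations and commuting squares. -/
def DiscFibs : CatOver.{u + 1, u} Cat.{u, u} where
  Ob O := DiscFib O
  Hom u X Y := { f : X.tot ⥤ Y.tot // f ⋙ Y.d = X.d ⋙ u.toFunctor }
  id X := ⟨𝟭 _, rfl⟩
  comp {O Q R u v t X Y Z} h f g := ⟨f.1 ⋙ g.1, by
    subst h
    rw [Functor.assoc, g.2, ← Functor.assoc, f.2]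
    rfl⟩
  id_comp _ := rfl
  comp_id _ := rfl
  assoc _ _ _ _ _ _ _ := rfl

/-- The category over `Cat` of graphs that are two-sided discrete fibrations, and maps of spans. -/
def FibGraphs : CatOver.{u + 1, u} Cat.{u, u} where
  Ob O := FibGraph O
  Hom u A B := { f : A.tot ⥤ B.tot //
    f ⋙ B.γ = A.γ ⋙ u.toFunctor ∧ f ⋙ B.δ = A.δ ⋙ Word.map u.toFunctor }
  id A := ⟨𝟭 _, rfl, rfl⟩
  comp {O Q R u v t A B D} h f g := ⟨f.1 ⋙ g.1, by
    subst h
    rw [Functor.assoc, g.2.1, ← Functor.assoc, f.2.1]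
    rfl, by
    subst h
    rw [Functor.assoc, g.2.2, ← Functor.assoc, f.2.2]
    rfl⟩
  id_comp _ := rfl
  comp_id _ := rfl
  assoc _ _ _ _ _ _ _ := rfl

section Elements

variable {O Q : Type u} [Category.{u} O] [Category.{u} Q]

/-- The elements of a presheaf. -/
structure PElt (X : PSh O) : Type u where
  base : O
  elt : X.obj (op base)

/-- The elements of a profunctor. -/
structure GElt (A : Profunctor.{u} (Word O) O) : Type u where
  src : O
  tgt : Word O
  elt : (A.obj tgt).obj (op src)

/-- The category of elements of a presheaf. -/
instance (X : PSh O) : Category.{u} (PElt X) where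
  Hom x y := { f : x.base ⟶ y.base // X.map f.op y.elt = x.elt }
  id x := ⟨𝟙 x.base, ConcreteCategory.congr_hom (X.map_id _) x.elt⟩
  comp {x y z} f g := ⟨f.1 ≫ g.1, by
    have h := ConcreteCategory.congr_hom (X.map_comp g.1.op f.1.op) z.elt
    refine h.trans ((congrArg (X.map f.1.op) g.2).trans f.2)⟩
  id_comp f := Subtype.ext (Category.id_comp f.1)
  comp_id f := Subtype.ext (Category.comp_id f.1)
  assoc f g h := Subtype.ext (Category.assoc f.1 g.1 h.1)

/-- The category of elements of a profunctor: an arrow from `a ∈ A(o; w)` to `a' ∈ A(o'; w')` is a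
pair of arrows `o ⟶ o'` and `w ⟶ w'` which take `a'` and `a` to the same element of `A(o; w')`. -/
instance (A : Profunctor.{u} (Word O) O) : Category.{u} (GElt A) where
  Hom a b := { f : (a.src ⟶ b.src) × (a.tgt ⟶ b.tgt) //
    (A.map f.2).app (op a.src) a.elt = (A.obj b.tgt).map f.1.op b.elt }
  id a := ⟨(𝟙 a.src, 𝟙 a.tgt), (ConcreteCategory.congr_hom (NatTrans.congr_app (A.map_id _) _) _).trans
    (ConcreteCategory.congr_hom ((A.obj a.tgt).map_id _) a.elt).symm⟩
  comp {a b c} f g := ⟨(f.1.1 ≫ g.1.1, f.1.2 ≫ g.1.2), by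
    have h₁ := ConcreteCategory.congr_hom
      (NatTrans.congr_app (A.map_comp f.1.2 g.1.2) (op a.src)) a.elt
    have h₂ := ConcreteCategory.congr_hom ((A.obj c.tgt).map_comp g.1.1.op f.1.1.op) c.elt
    have h₃ := ConcreteCategory.congr_hom ((A.map g.1.2).naturality f.1.1.op) b.elt
    refine h₁.trans (Eq.trans ?_ h₂.symm)
    refine (congrArg ((A.map g.1.2).app (op a.src)) f.2).trans ?_
    exact h₃.trans (congrArg ((A.obj c.tgt).map f.1.1.op) g.2)⟩
  id_comp f := Subtype.ext (Prod.ext (Category.id_comp _) (Category.id_comp _))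
  comp_id f := Subtype.ext (Prod.ext (Category.comp_id _) (Category.comp_id _))
  assoc f g h := Subtype.ext (Prod.ext (Category.assoc _ _ _) (Category.assoc _ _ _))

/-- The projection from the elements of a presheaf on `O` to `O`. -/
def PElt.proj (X : PSh O) : PElt X ⥤ O where
  obj x := x.base
  map f := f.1

/-- The projection from the elements of a profunctor to `O`. -/
def GElt.fst (A : Profunctor.{u} (Word O) O) : GElt A ⥤ O where
  obj a := a.src
  map f := f.1.1

/-- The projection from the elements of a profunctor to `M(O)`. -/
def GElt.snd (A : Profunctor.{u} (Word O) O) : GElt A ⥤ Word O where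
  obj a := a.tgt
  map f := f.1.2

theorem lift_heq {B : Type w} [Category.{v} B] {X : Type w'} [Category.{v'} X] (d : X ⥤ B)
    {x y : X} {b b' : B} {f : b ⟶ b'} {g : x ⟶ y} (h : d.IsHomLift f g) :
    d.obj x = b ∧ d.obj y = b' ∧ HEq (d.map g) f := by
  cases h
  exact ⟨rfl, rfl, HEq.rfl⟩

theorem PElt.isFib (X : PSh O) : IsDiscreteFib (PElt.proj X) := by
  rintro ⟨o', x⟩ o f
  refine ⟨⟨⟨o, X.map f.op x⟩, ⟨f, rfl⟩⟩, ?_, ?_⟩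
  · exact Functor.IsHomLift.map (p := PElt.proj X)
      (⟨f, rfl⟩ : (⟨o, X.map f.op x⟩ : PElt X) ⟶ ⟨o', x⟩)
  · rintro ⟨⟨o'', y⟩, ⟨g, hg⟩⟩ h
    change o'' ⟶ o' at g
    obtain ⟨h₁, -, h₃⟩ := lift_heq _ h
    change o'' = o at h₁
    subst h₁
    obtain rfl : g = f := eq_of_heq h₃
    change X.map g.op x = y at hg
    subst hg
    rfl

theorem GElt.map_id_elt {A : Profunctor.{u} (Word O) O} (a : GElt A) :
    (A.map (𝟙 a.tgt)).app (op a.src) a.elt = a.elt :=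
  ConcreteCategory.congr_hom (NatTrans.congr_app (A.map_id _) _) _

theorem GElt.id_map_elt {A : Profunctor.{u} (Word O) O} (a : GElt A) :
    (A.obj a.tgt).map (𝟙 a.src).op a.elt = a.elt :=
  ConcreteCategory.congr_hom ((A.obj a.tgt).map_id _) _

theorem GElt.isFib (A : Profunctor.{u} (Word O) O) :
    IsTwoSidedDiscreteFib (GElt.fst A) (GElt.snd A) where
  lift_left := by
    rintro ⟨o', w, a⟩ o f
    let x : GElt A := ⟨o, w, (A.obj w).map f.op a⟩
    let k : x ⟶ ⟨o', w, a⟩ := ⟨(f, 𝟙 w), x.map_id_elt⟩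
    refine ⟨⟨x, k⟩, ⟨Functor.IsHomLift.map (p := GElt.fst A) k,
      Functor.IsHomLift.map (p := GElt.snd A) k⟩, ?_⟩
    rintro ⟨⟨o'', w'', b⟩, ⟨⟨g₁, g₂⟩, hg⟩⟩ ⟨h, h'⟩
    change o'' ⟶ o' at g₁
    change w'' ⟶ w at g₂
    obtain ⟨h₁, -, h₃⟩ := lift_heq _ h
    obtain ⟨h₁', -, h₃'⟩ := lift_heq _ h'
    change o'' = o at h₁
    change w'' = w at h₁'
    subst h₁ h₁'
    obtain rfl : g₁ = f := eq_of_heq h₃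
    obtain rfl : g₂ = 𝟙 w'' := eq_of_heq h₃'
    obtain rfl : b = (A.obj w'').map g₁.op a :=
      (GElt.map_id_elt (⟨o'', w'', b⟩ : GElt A)).symm.trans hg
    rfl
  lift_right := by
    rintro ⟨o, w, a⟩ w' f
    let x : GElt A := ⟨o, w', (A.map f).app (op o) a⟩
    let k : (⟨o, w, a⟩ : GElt A) ⟶ x := ⟨(𝟙 o, f), x.id_map_elt.symm⟩
    refine ⟨⟨x, k⟩, ⟨Functor.IsHomLift.map (p := GElt.fst A) k,
      Functor.IsHomLift.map (p := GElt.snd A) k⟩, ?_⟩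
    rintro ⟨⟨o'', w'', b⟩, ⟨⟨g₁, g₂⟩, hg⟩⟩ ⟨h, h'⟩
    change o ⟶ o'' at g₁
    change w ⟶ w'' at g₂
    obtain ⟨-, h₁, h₃⟩ := lift_heq _ h
    obtain ⟨-, h₁', h₃'⟩ := lift_heq _ h'
    change o'' = o at h₁
    change w'' = w' at h₁'
    subst h₁ h₁'
    obtain rfl : g₁ = 𝟙 o'' := eq_of_heq h₃
    obtain rfl : g₂ = f := eq_of_heq h₃'
    obtain rfl : b = (A.map g₂).app (op o'') a :=
      (GElt.id_map_elt (⟨o'', w'', b⟩ : GElt A)).symm.trans hg.symm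
    rfl
  factor := by
    rintro ⟨o, w, a⟩ ⟨o', w', b⟩ ⟨⟨f, g⟩, h⟩
    let x : GElt A := ⟨o, w', (A.map g).app (op o) a⟩
    let k : (⟨o, w, a⟩ : GElt A) ⟶ x := ⟨(𝟙 o, g), x.id_map_elt.symm⟩
    let l : x ⟶ (⟨o', w', b⟩ : GElt A) := ⟨(f, 𝟙 w'), x.map_id_elt.trans h⟩
    exact ⟨x, k, l, Subtype.ext (Prod.ext (Category.id_comp f) (Category.comp_id g)),
      ⟨Functor.IsHomLift.map (p := GElt.fst A) k, Functor.IsHomLift.map (p := GElt.snd A) k⟩,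
      ⟨Functor.IsHomLift.map (p := GElt.fst A) l, Functor.IsHomLift.map (p := GElt.snd A) l⟩⟩

/-- The discrete fibration of elements of a presheaf. -/
def DiscFib.ofPSh (X : PSh O) : DiscFib O :=
  ⟨PElt X, PElt.proj X, PElt.isFib X⟩

/-- The two-sided discrete fibration of elements of a profunctor. -/
def FibGraph.ofProfunctor (A : Profunctor.{u} (Word O) O) : FibGraph O :=
  ⟨GElt A, GElt.fst A, GElt.snd A, GElt.isFib A⟩

end Elements

/-- Presheaves as discrete fibrations. -/
def elDFib : CatOver.OneCell DFib.{u} DiscFibs.{u} where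
  obj X := DiscFib.ofPSh X
  map {O Q u X Y} g := ⟨
    { obj := fun x => ⟨u.toFunctor.obj x.base, g.app _ x.elt⟩
      map := fun {x y} f => ⟨u.toFunctor.map f.1, by
        have h := ConcreteCategory.congr_hom (g.naturality f.1.op) y.elt
        exact h.symm.trans (congrArg (g.app (op x.base)) f.2)⟩
      map_id := fun x => Subtype.ext (u.toFunctor.map_id _)
      map_comp := fun f g => Subtype.ext (u.toFunctor.map_comp _ _) }, rfl⟩
  map_id _ := rfl
  map_comp h _ _ := by subst h; rfl

/-- Profunctors as two-sided discrete fibrations. -/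
def elGph : CatOver.OneCell Gph.{u} FibGraphs.{u} where
  obj A := FibGraph.ofProfunctor A
  map {O Q u A B} g := ⟨
    { obj := fun x => ⟨u.toFunctor.obj x.src, (Word.map u.toFunctor).obj x.tgt, (g.app _).app _ x.elt⟩
      map := fun {x y} f => ⟨(u.toFunctor.map f.1.1, (Word.map u.toFunctor).map f.1.2), by
        have h₁ := ConcreteCategory.congr_hom
          (NatTrans.congr_app (g.naturality f.1.2) (op x.src)) x.elt
        have h₂ := ConcreteCategory.congr_hom ((g.app y.tgt).naturality f.1.1.op) y.elt
        exact h₁.symm.trans ((congrArg ((g.app y.tgt).app (op x.src)) f.2).trans h₂)⟩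
      map_id := fun x => Subtype.ext (Prod.ext (u.toFunctor.map_id _)
        ((Word.map u.toFunctor).map_id _))
      map_comp := fun f g => Subtype.ext (Prod.ext (u.toFunctor.map_comp _ _)
        ((Word.map u.toFunctor).map_comp _ _)) }, rfl, rfl⟩
  map_id _ := rfl
  map_comp h _ _ := by subst h; rfl

/-! ### Components -/

/-- The components `P(X)(o) → H(X)(o)` of a vertical arrow of `End(DFib)`. -/
def EndDFib.val {O : Cat.{u, u}} {P H : PSh O ⥤ PSh O} (σ : EndDFib.Hom (𝟙 O) P H) (X : PSh O)
    {o : O} (z : (P.obj X).obj (op o)) : (H.obj X).obj (op o) :=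
  (σ.app X).app (op o) z

/-- The components `A(o; w) → B(o; w)` of a vertical arrow of `Gph_2fi(M)`. -/
def Gph.val {O : Cat.{u, u}} {A B : Profunctor.{u} (Word O) O} (f : Gph.Hom (𝟙 O) A B)
    {o : O} {w : Word O} (a : (A.obj w).obj (op o)) : (B.obj w).obj (op o) :=
  (f.app w).app (op o) a

/-! By Yoneda an element of `X^w` is a map `ι(w) ⟶ X`, so `(A ⋆ X)(o)` is the coend over `w` of
`A(o; w) × Hom(ι(w), X)`. Thus `r(A)` is the left Kan extension of `A`, seen as a functor from words
to presheaves, along `ι`, and `U` is restriction along `ι`; this is the adjunction `repAdj`.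
Colimits of functors are pointwise, so coequalizers of endofunctors survive both restriction along
`ι` and precomposition with a reindexing functor. The latter makes them universal for arrows over
every arrow of the base (`CatOver.IsStableCoeq`), which is what turns fibrewise coequalizers into
coequalizers of 1-cells and gives `repRight_isRC`.

The one fact that is not formal is that finite products commute with the quotients defining coends
(`Ten.pi_eq`): a function of finitely many representatives that is invariant under the generating
relations depends only on the classes. It has two consequences. The map `(A ⊗ B) ⋆ X ⟶ A ⋆ (B ⋆ X)`
that cuts words into parts is bijective, the inverse concatenating chosen representatives
(`actTens_bijective`). And if `A` is the reindexing of `B` along `u`, then `A ⋆ X` is `u^*(B ⋆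
u_!(X))` (`actExt.bijective`); as the prone lift of an endofunctor `H` along `u` is `u^* H u_!`,
this says that `r` preserves prone arrows. Supine arrows are preserved by every left adjoint
(`CatOver.Adj.map_supine`).

The coherence of the tensor product is carried back from composition of functors, which is strictly
associative. A graph can be recovered from its action: `a ↦ [a, 1]` embeds `A(o; w)` in `(A ⋆
ι(w))(o)`, with a partial retraction natural in `A` (`actRetract`). Hence on each fibre `r` is
faithful and reflects isomorphisms (`hom_ext_of_actLeft`, `bijective_of_actLeft`). The associativity
and unit maps are written in the direction that needs no choices, and their actions on presheaves
are expressed through `actTens` and `actUnit` (`actLeft_tensAssocInv`, `actLeft_tensUnitLeftInv`,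
`actLeft_tensUnitRightInv`). Invertibility, pentagon, triangle and the coherence of `r` all follow
from these three equations.

The exponential law rests on factoring an arrow `(f, g)` of a product as `(1, g)` followed by `(f,
1)`. The presentations by fibrations are the correspondence between categories of elements and
fibres, with strict inverses. -/

namespace CatOver

variable {S : Type u₁} [Category.{v₁} S]

/-! ### Reflexive coequalizers of 1-cells -/

/-- A vertical coequalizer with the universal property for the arrows over every arrow of the
base. -/
structure IsStableCoeq (D : CatOver.{w, v} S) {a : S} {x y z : D.Ob a} (f g : D.Hom (𝟙 a) x y)
    (q : D.Hom (𝟙 a) y z) : Prop where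
  condition : D.vcomp f q = D.vcomp g q
  exists_desc : ∀ {b : S} (u : a ⟶ b) (z' : D.Ob b) (h : D.Hom u y z'),
    D.comp (Category.id_comp u) f h = D.comp (Category.id_comp u) g h →
      ∃ k : D.Hom u z z', D.comp (Category.id_comp u) q k = h
  hom_ext : ∀ {b : S} {u : a ⟶ b} {z' : D.Ob b} {k k' : D.Hom u z z'},
    D.comp (Category.id_comp u) q k = D.comp (Category.id_comp u) q k' → k = k'

section

variable {X : CatOver.{w', v'} S} {D : CatOver.{w, v} S}

theorem TwoCell.congr_app {F G : OneCell X D} {σ τ : F ⟶ G} (h : σ = τ) {a : S} (x : X.Ob a) :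
    σ.app x = τ.app x := by
  rw [h]

theorem TwoCell.hom_ext {F G : OneCell X D} {σ τ : F ⟶ G}
    (h : ∀ {a : S} (x : X.Ob a), σ.app x = τ.app x) : σ = τ :=
  TwoCell.ext (funext fun _ => funext fun x => h x)

/-- A cofork of 1-cells is a coequalizer if it is a stable coequalizer in each component. -/
theorem nonempty_isColimit_cofork {F G : OneCell X D} {σ τ : F ⟶ G} (c : Cofork σ τ)
    (hc : ∀ {a : S} (x : X.Ob a), D.IsStableCoeq (σ.app x) (τ.app x) (c.π.app x)) :
    Nonempty (IsColimit c) := by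
  refine ⟨Cofork.IsColimit.ofExistsUnique fun s => ?_⟩
  have key : ∀ {a : S} (x : X.Ob a), ∃ k : D.Hom (𝟙 a) (c.pt.obj x) (s.pt.obj x),
      D.comp (Category.id_comp (𝟙 a)) (c.π.app x) k = s.π.app x := fun x =>
    (hc x).exists_desc _ _ (s.π.app x) (TwoCell.congr_app s.condition x)
  choose k hk using @key
  refine ⟨⟨k, fun {a b u x y} f => (hc x).hom_ext ?_⟩, TwoCell.hom_ext fun x => hk x,
    fun m hm => TwoCell.hom_ext fun x => (hc x).hom_ext ?_⟩
  -- Naturality may be tested after composing with `c.π`, by uniqueness over the arrow `u` and not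
  -- only over identities; there it becomes the naturality of `c.π` and of `s.π`.
  · rw [← D.assoc (Category.id_comp u) (Category.comp_id u) (Category.comp_id u)
      (Category.id_comp u), ← c.π.naturality f, ← D.assoc (Category.id_comp (𝟙 a))
      (Category.id_comp u) (Category.id_comp u) (Category.id_comp u), hk,
      D.assoc (Category.comp_id u) (Category.comp_id u) (Category.comp_id (𝟙 b))
      (Category.comp_id u), hk, s.π.naturality f]
  · exact (TwoCell.congr_app hm x).trans (hk x).symm

/-- Stable coequalizers in the fibres give coequalizers of 1-cells. -/
theorem exists_cofork_stable {F G : OneCell X D} (σ τ : F ⟶ G)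
    (P : ∀ {a : S} {x y z : D.Ob a} (_ _ : D.Hom (𝟙 a) x y) (_ : D.Hom (𝟙 a) y z), Prop)
    (hP : ∀ {a : S} {x y z : D.Ob a} {f g : D.Hom (𝟙 a) x y} {q : D.Hom (𝟙 a) y z},
      P f g q → D.IsStableCoeq f g q)
    (H : ∀ {a : S} {x y : D.Ob a} (f g : D.Hom (𝟙 a) x y),
      ∃ (z : D.Ob a) (q : D.Hom (𝟙 a) y z), P f g q) :
    ∃ (Z : OneCell X D) (π : G ⟶ Z),
      ∀ {a : S} (x : X.Ob a), P (σ.app x) (τ.app x) (π.app x) := by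
  choose Z q hq' using fun (a : S) (x : X.Ob a) => H (σ.app x) (τ.app x)
  have hq := fun (a : S) (x : X.Ob a) => hP (hq' a x)
  -- The action of the quotient on an arrow over `u`: by naturality of `σ` and `τ`, the arrow `G.map
  -- f` followed by the quotient map coequalizes the pair, so it descends by the universal property
  -- over `u`.
  have key : ∀ {a b : S} {u : a ⟶ b} {x : X.Ob a} {y : X.Ob b} (f : X.Hom u x y),
      ∃ k : D.Hom u (Z a x) (Z b y), D.comp (Category.id_comp u) (q a x) k =
        D.comp (Category.comp_id u) (G.map f) (q b y) := fun {a b u x y} f => by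
    refine (hq a x).exists_desc _ _ _ ?_
    rw [← D.assoc (Category.id_comp u) (Category.comp_id u) (Category.comp_id u)
      (Category.id_comp u), ← D.assoc (Category.id_comp u) (Category.comp_id u)
      (Category.comp_id u) (Category.id_comp u), ← σ.naturality f, ← τ.naturality f,
      D.assoc (Category.comp_id u) (Category.comp_id u) (Category.comp_id (𝟙 b))
      (Category.comp_id u), D.assoc (Category.comp_id u) (Category.comp_id u)
      (Category.comp_id (𝟙 b)) (Category.comp_id u)]
    exact congrArg _ (hq b y).condition
  choose k hk using @key
  refine ⟨⟨fun {a} x => Z a x, k, fun {a} x => (hq a x).hom_ext ?_,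
    fun {a b c u v t x y z} h f g => (hq a x).hom_ext ?_⟩,
    ⟨fun x => q _ x, fun f => (hk f).symm⟩, fun {a} x => hq' a x⟩
  · rw [hk, G.map_id, D.id_comp, D.comp_id]
  · rw [hk, G.map_comp, ← D.assoc (Category.id_comp u) h h (Category.id_comp t), hk,
      D.assoc (Category.comp_id u) h (Category.id_comp v) h, hk,
      ← D.assoc h (Category.comp_id t) (Category.comp_id v) h]

/-- A cocone on a reflexive pair of 1-cells is a colimit if it is a stable coequalizer in each
component. -/
theorem nonempty_isColimit_reflexive {k : WalkingReflexivePair ⥤ OneCell X D} (c : Cocone k)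
    (hc : ∀ {a : S} (x : X.Ob a), D.IsStableCoeq ((k.map .left).app x) ((k.map .right).app x)
      ((c.ι.app .zero).app x)) :
    Nonempty (IsColimit c) :=
  ⟨(ReflexiveCofork.isColimitEquiv k c).1
    (nonempty_isColimit_cofork (ReflexiveCofork.toCofork c) hc).some⟩

/-- Carrying the predicate `P` along records that the colimit is built from a chosen class of
coequalizers, so that preservation need only be checked on that class. -/
theorem exists_cocone_reflexive (k : WalkingReflexivePair ⥤ OneCell X D)
    (P : ∀ {a : S} {x y z : D.Ob a} (_ _ : D.Hom (𝟙 a) x y) (_ : D.Hom (𝟙 a) y z), Prop)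
    (hP : ∀ {a : S} {x y z : D.Ob a} {f g : D.Hom (𝟙 a) x y} {q : D.Hom (𝟙 a) y z},
      P f g q → D.IsStableCoeq f g q)
    (H : ∀ {a : S} {x y : D.Ob a} (f g : D.Hom (𝟙 a) x y),
      ∃ (z : D.Ob a) (q : D.Hom (𝟙 a) y z), P f g q) :
    ∃ c : Cocone k, Nonempty (IsColimit c) ∧
      ∀ {a : S} (x : X.Ob a), P ((k.map .left).app x) ((k.map .right).app x)
        ((c.ι.app .zero).app x) := by
  obtain ⟨Z, π, h⟩ := exists_cofork_stable (k.map .left) (k.map .right) P hP H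
  have hc : k.map .left ≫ π = k.map .right ≫ π :=
    TwoCell.hom_ext fun x => (hP (h x)).condition
  exact ⟨ReflexiveCofork.mk π hc,
    nonempty_isColimit_reflexive (ReflexiveCofork.mk π hc) fun x => hP (h x), h⟩

/-- If the fibres of `D` have stable coequalizers then `D` is an rc 0-cell. -/
theorem isRC_of_exists_isStableCoeq
    (H : ∀ {a : S} {x y : D.Ob a} (f g : D.Hom (𝟙 a) x y),
      ∃ (z : D.Ob a) (q : D.Hom (𝟙 a) y z), D.IsStableCoeq f g q) :
    IsRC.{w, v, v₁, u₁, w', v'} D := by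
  intro X
  refine ⟨⟨fun {F G} σ τ _ => ?_⟩, fun Y K => ⟨fun {k} => ?_⟩⟩
  · obtain ⟨Z, π, h⟩ := exists_cofork_stable σ τ D.IsStableCoeq (fun h => h) H
    exact HasColimit.mk ⟨Cofork.ofπ π (TwoCell.hom_ext fun x => (h x).condition),
      (nonempty_isColimit_cofork _ h).some⟩
  · obtain ⟨c, ⟨hc⟩, h⟩ := exists_cocone_reflexive k D.IsStableCoeq (fun h => h) H
    exact preservesColimit_of_preserves_colimit_cocone hc
      (nonempty_isColimit_reflexive ((K.precomp D).mapCocone c) fun x => h (K.obj x)).some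

/-- A 1-cell is an rc 1-cell if it preserves a class of stable coequalizers that exist for all
parallel pairs. -/
theorem OneCell.isRC_of_isStableCoeq {E : CatOver.{w'', v''} S} (F : OneCell D E)
    (P : ∀ {a : S} {x y z : D.Ob a} (_ _ : D.Hom (𝟙 a) x y) (_ : D.Hom (𝟙 a) y z), Prop)
    (hP : ∀ {a : S} {x y z : D.Ob a} {f g : D.Hom (𝟙 a) x y} {q : D.Hom (𝟙 a) y z},
      P f g q → D.IsStableCoeq f g q)
    (hF : ∀ {a : S} {x y z : D.Ob a} {f g : D.Hom (𝟙 a) x y} {q : D.Hom (𝟙 a) y z},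
      P f g q → E.IsStableCoeq (F.map f) (F.map g) (F.map q))
    (H : ∀ {a : S} {x y : D.Ob a} (f g : D.Hom (𝟙 a) x y),
      ∃ (z : D.Ob a) (q : D.Hom (𝟙 a) y z), P f g q)
    (H' : ∀ {a : S} {x y : E.Ob a} (f g : E.Hom (𝟙 a) x y),
      ∃ (z : E.Ob a) (q : E.Hom (𝟙 a) y z), E.IsStableCoeq f g q) :
    OneCell.IsRC.{w, v, w'', v'', v₁, u₁, w₃, v₃} F := by
  refine ⟨isRC_of_exists_isStableCoeq fun f g => ?_, isRC_of_exists_isStableCoeq H',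
    fun X => ⟨fun {k} => ?_⟩⟩
  · obtain ⟨z, q, h⟩ := H f g
    exact ⟨z, q, hP h⟩
  · obtain ⟨c, ⟨hc⟩, h⟩ := exists_cocone_reflexive k P hP H
    exact preservesColimit_of_preserves_colimit_cocone hc
      (nonempty_isColimit_reflexive ((F.postcomp X).mapCocone c) fun x => hF (h x)).some

end

end CatOver

/-! ### Reflexive coequalizers of graphs and of endofunctors -/

section Coequalizers

/-- An arrow over `u` out of a profunctor is a map in the fibre into a reindexed profunctor, so the
universal property over every `u` is already contained in the one over the identity. -/
theorem Gph.isStableCoeq {O : Cat.{u, u}} {A B D : Profunctor.{u} (Word O) O} {f g : A ⟶ B}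
    {q : B ⟶ D} (w : f ≫ q = g ≫ q) (hq : IsColimit (Cofork.ofπ q w)) :
    Gph.{u}.IsStableCoeq (a := O) f g q where
  condition := w
  exists_desc _ _ h e := ⟨(Cofork.IsColimit.desc' hq h e).1, (Cofork.IsColimit.desc' hq h e).2⟩
  hom_ext e := Cofork.IsColimit.hom_ext hq e

/-- Here the source of an arrow over `u` is first composed with the reindexing functor, so the
coequalizer has to survive that precomposition. It does, because colimits of functors are pointwise.
-/
theorem EndDFib.isStableCoeq {O : Cat.{u, u}} {P H K : PSh O ⥤ PSh O} {f g : P ⟶ H}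
    {q : H ⟶ K} (w : f ≫ q = g ≫ q) (hq : IsColimit (Cofork.ofπ q w)) :
    EndDFib.{u}.IsStableCoeq (a := O) f g q where
  condition := w
  exists_desc {Q} u z' h e := by
    let W := (Functor.whiskeringLeft _ _ (PSh O)).obj (reindex u.toFunctor)
    have hW : IsColimit (Cofork.ofπ (W.map q) _) := isColimitCoforkMapOfIsColimit W w hq
    exact ⟨(Cofork.IsColimit.desc' hW h e).1, (Cofork.IsColimit.desc' hW h e).2⟩
  hom_ext {Q u _ _ _} e := by
    let W := (Functor.whiskeringLeft _ _ (PSh O)).obj (reindex u.toFunctor)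
    have hW : IsColimit (Cofork.ofπ (W.map q) _) := isColimitCoforkMapOfIsColimit W w hq
    exact Cofork.IsColimit.hom_ext hW e

/-- Over an identity the comparison `iotaMap` is the identity, and only the restriction along `ι`
remains. -/
theorem repRight_map_vertical {O : Cat.{u, u}} {P H : PSh O ⥤ PSh O} (f : P ⟶ H) :
    repRight.{u}.map (u := 𝟙 O) f = Functor.whiskerLeft (iota O) f :=
  NatTrans.ext (funext fun w => by
    refine Eq.trans ?_ (Category.id_comp _)
    exact congrArg (· ≫ f.app ((iota O).obj w)) (P.map_id _))

/-- A coequalizer in the category of endofunctors. -/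
def EndDFib.IsCoeq {O : Cat.{u, u}} {P H K : PSh O ⥤ PSh O} (f g : P ⟶ H) (q : H ⟶ K) : Prop :=
  ∃ w : f ≫ q = g ≫ q, Nonempty (IsColimit (Cofork.ofπ q w))

theorem Gph.exists_isStableCoeq {O : Cat.{u, u}} {A B : Profunctor.{u} (Word O) O} (f g : A ⟶ B) :
    ∃ (D : Profunctor.{u} (Word O) O) (q : B ⟶ D), Gph.{u}.IsStableCoeq (a := O) f g q :=
  ⟨coequalizer f g, coequalizer.π f g, Gph.isStableCoeq (coequalizer.condition f g)
    (coequalizerIsCoequalizer f g)⟩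

theorem EndDFib.exists_isCoeq {O : Cat.{u, u}} {P H : PSh O ⥤ PSh O} (f g : P ⟶ H) :
    ∃ (K : PSh O ⥤ PSh O) (q : H ⟶ K), EndDFib.IsCoeq f g q :=
  ⟨coequalizer f g, coequalizer.π f g, coequalizer.condition f g, ⟨coequalizerIsCoequalizer f g⟩⟩

/-- On vertical arrows `U` is precomposition with `ι`, which preserves pointwise colimits. -/
theorem EndDFib.IsCoeq.map_repRight {O : Cat.{u, u}} {P H K : PSh O ⥤ PSh O} {f g : P ⟶ H}
    {q : H ⟶ K} (h : EndDFib.IsCoeq f g q) :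
    Gph.{u}.IsStableCoeq (repRight.{u}.map (u := 𝟙 O) f) (repRight.{u}.map (u := 𝟙 O) g)
      (repRight.{u}.map (u := 𝟙 O) q) := by
  obtain ⟨w, ⟨hq⟩⟩ := h
  have key := Gph.isStableCoeq _ (isColimitCoforkMapOfIsColimit
    ((Functor.whiskeringLeft _ _ (PSh O)).obj (iota O)) w hq)
  have e := fun {P H : PSh O ⥤ PSh O} (f : P ⟶ H) => repRight_map_vertical f
  rw [e f, e g, e q]
  exact key

theorem repRight_isRC :
    CatOver.OneCell.IsRC.{u + 1, u + 1, u + 1, u, u, u + 1, w, v} repRight.{u} :=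
  CatOver.OneCell.isRC_of_isStableCoeq repRight.{u} (fun f g q => EndDFib.IsCoeq f g q)
    (fun ⟨w, ⟨hq⟩⟩ => EndDFib.isStableCoeq w hq) (fun h => h.map_repRight)
    (fun f g => EndDFib.exists_isCoeq f g) (fun f g => Gph.exists_isStableCoeq f g)

end Coequalizers

/-! ### The exponential -/

section Exponential

theorem CatOver.OneCell.ext_heq {S : Type u₁} [Category.{v₁} S] {C : CatOver.{w, v} S}
    {D : CatOver.{w', v'} S} {F G : CatOver.OneCell C D}
    (hobj : ∀ {a : S} (x : C.Ob a), F.obj x = G.obj x)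
    (hmap : ∀ {a b : S} {u : a ⟶ b} {x : C.Ob a} {y : C.Ob b} (f : C.Hom u x y),
      HEq (F.map f) (G.map f)) : F = G := by
  obtain ⟨o, m, _, _⟩ := F
  obtain ⟨o', m', _, _⟩ := G
  obtain rfl : @o = @o' := funext fun a => funext fun x => hobj x
  obtain rfl : @m = @m' := funext fun a => funext fun b => funext fun u => funext fun x =>
    funext fun y => funext fun f => eq_of_heq (hmap f)
  rfl

theorem EndDFib.hom_heq {O Q : Cat.{u, u}} {u : O ⟶ Q} {P P' : EndDFib.{u}.Ob O}
    {H H' : EndDFib.{u}.Ob Q} (hP : P = P') (hH : H = H') (σ : EndDFib.{u}.Hom u P H)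
    (τ : EndDFib.{u}.Hom u P' H') (h : ∀ X, HEq (σ.app X) (τ.app X)) : HEq σ τ := by
  subst hP hH
  exact heq_of_eq (NatTrans.ext (funext fun X => eq_of_heq (h X)))

/-- The 1-cell `E ×_Cat DFib → DFib` whose exponential adjoint is `F`. -/
def uncurry {E : CatOver.{w, v} Cat.{u, u}} (F : CatOver.OneCell E EndDFib.{u}) :
    CatOver.OneCell (E.prod DFib.{u}) DFib.{u} where
  obj {O} x := (show PSh O ⥤ PSh O from F.obj x.1).obj x.2
  map {O Q u x y} f := (show PSh O ⥤ PSh O from F.obj x.1).map f.2 ≫ (F.map f.1).app y.2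
  map_id {O} x := by
    have h := congrArg (fun σ => NatTrans.app (C := PSh O) σ x.2) (F.map_id x.1)
    exact (congrArg₂ (· ≫ ·) ((show PSh O ⥤ PSh O from F.obj x.1).map_id x.2) h).trans
      (Category.comp_id _)
  map_comp {O Q R u v t x y z} h f g := by
    subst h
    have h := congrArg (fun σ => NatTrans.app (C := PSh R) σ z.2) (F.map_comp rfl f.1 g.1)
    refine (congrArg ((show PSh O ⥤ PSh O from F.obj x.1).map
      (f.2 ≫ (reindex u.toFunctor).map g.2) ≫ ·) h).trans ?_
    exact square_aux (reindex u.toFunctor) (F.map f.1) f.2 g.2 ((F.map g.1).app z.2)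

/-- An arrow `(f₁, f₂)` of the product is `(1, f₂)` followed by `(f₁, 1)`, and `curry` records the
values of `F` on both kinds of factor. -/
theorem uncurry_curry {E : CatOver.{w, v} Cat.{u, u}}
    (F : CatOver.OneCell (E.prod DFib.{u}) DFib.{u}) : uncurry (curry F) = F :=
  CatOver.OneCell.ext_heq (fun _ => rfl) fun {O Q u x y} f => heq_of_eq <| by
    have h := F.map_comp (u := 𝟙 O) (v := u) (x := x) (y := (x.1, (reindex u.toFunctor).obj y.2))
      (z := y) (Category.id_comp u) (E.id x.1, f.2) (f.1, 𝟙 ((reindex u.toFunctor).obj y.2))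
    refine h.symm.trans ?_
    exact congrArg (fun k => F.map (u := u) (x := x) (y := y) k)
      (Prod.ext (E.id_comp f.1) (Category.comp_id (obj := PSh O) f.2))

theorem curry_uncurry {E : CatOver.{w, v} Cat.{u, u}} (F : CatOver.OneCell E EndDFib.{u}) :
    curry (uncurry F) = F := by
  -- The rebuilt endofunctor sends `g` to its image followed by a component of `F.map` of an
  -- identity, so it equals `F.obj e` only propositionally. This is why arrows are compared by
  -- heterogeneous equality.
  have hobj : ∀ {O : Cat.{u, u}} (e : E.Ob O), (curry (uncurry F)).obj e = F.obj e :=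
    fun {O} e => Functor.hext (fun _ => rfl) fun X Y g => heq_of_eq <| by
      have h := congrArg (fun σ => NatTrans.app σ Y) (F.map_id e)
      exact (congrArg ((show PSh O ⥤ PSh O from F.obj e).map g ≫ ·) h).trans (Category.comp_id _)
  refine CatOver.OneCell.ext_heq hobj fun {O Q u e e'} f =>
    EndDFib.hom_heq (hobj e) (hobj e') _ _ fun X => heq_of_eq ?_
  exact (congrArg (· ≫ (F.map f).app X) ((show PSh O ⥤ PSh O from F.obj e).map_id _)).trans
    (Category.id_comp _)

theorem curry_bijective (E : CatOver.{w, v} Cat.{u, u}) : Function.Bijective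
    (curry : CatOver.OneCell (E.prod DFib.{u}) DFib.{u} → CatOver.OneCell E EndDFib.{u}) :=
  Function.bijective_iff_has_inverse.2 ⟨uncurry, uncurry_curry, curry_uncurry⟩

end Exponential

/-! ### The adjunction -/

section Adjunction

variable {O Q : Type u} [Category.{u} O] [Category.{u} Q]

theorem act.ind {A : Profunctor.{u} (Word O) O} {X : PSh O} {o : O}
    {p : (act A X).obj (op o) → Prop}
    (h : ∀ (w : Word O) (a : (A.obj w).obj (op o)) (x : ∀ i, X.obj (op (w.letter i))),
      p (act.mk a x)) (z : (act A X).obj (op o)) : p z :=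
  Ten.ind (A := A.flip.obj (op o)) (P := pow X) h z

theorem act.hom_ext {A : Profunctor.{u} (Word O) O} {X Y : PSh O} {f g : act A X ⟶ Y}
    (h : ∀ (o : O) (w : Word O) (a : (A.obj w).obj (op o)) (x : ∀ i, X.obj (op (w.letter i))),
      f.app (op o) (act.mk a x) = g.app (op o) (act.mk a x)) : f = g :=
  NatTrans.ext (funext fun o => ConcreteCategory.hom_ext _ _ fun z =>
    act.ind (o := o.unop) (p := fun z => f.app o z = g.app o z) (h o.unop) z)

theorem act.sound {A : Profunctor.{u} (Word O) O} {X : PSh O} {o : O} {w w' : Word O}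
    (v : w ⟶ w') (a : (A.obj w).obj (op o)) (x : ∀ i, X.obj (op (w'.letter i))) :
    act.mk (A := A) (X := X) a
        (fun i => X.map (v.app i).op (x (Fin.cast v.len_eq i))) =
      act.mk (A := A) (X := X) ((A.map v).app (op o) a) x :=
  Ten.sound (A := A.flip.obj (op o)) (P := pow X) v a x

theorem psh_map_id {X : PSh O} {o : O} (x : X.obj (op o)) : X.map (𝟙 o).op x = x :=
  ConcreteCategory.congr_hom (X.map_id (op o)) x

theorem psh_map_comp {X : PSh O} {o o' o'' : O} (f : o ⟶ o') (g : o' ⟶ o'')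
    (x : X.obj (op o'')) : X.map (f ≫ g).op x = X.map f.op (X.map g.op x) :=
  ConcreteCategory.congr_hom (X.map_comp g.op f.op) x

/-- The Yoneda bijection between `X^w` and the maps `ι(w) ⟶ X` is natural in the word, which makes
the counit respect the coend relation. Its naturality in `X`, proved next, makes the counit natural.
-/
theorem iotaDesc_pow {w w' : Word O} {X : PSh O} (v : w ⟶ w')
    (x : ∀ i, X.obj (op (w'.letter i))) :
    iotaDesc (w := w) (X := X) (fun i => X.map (v.app i).op (x (Fin.cast v.len_eq i))) =
      (iota O).map v ≫ iotaDesc x :=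
  NatTrans.ext (funext fun _ => ConcreteCategory.hom_ext _ _ fun z =>
    (psh_map_comp z.2 (v.app z.1) (x (Fin.cast v.len_eq z.1))).symm)

theorem iotaDesc_comp {w : Word O} {X Y : PSh O} (x : ∀ i, X.obj (op (w.letter i))) (g : X ⟶ Y) :
    iotaDesc (fun i => g.app _ (x i)) = iotaDesc x ≫ g :=
  NatTrans.ext (funext fun _ => ConcreteCategory.hom_ext _ _ fun z =>
    (ConcreteCategory.congr_hom (g.naturality z.2.op) (x z.1)).symm)

theorem iotaDesc_gen (w : Word O) : iotaDesc (iotaGen w) = 𝟙 ((iota O).obj w) :=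
  NatTrans.ext (funext fun o => ConcreteCategory.hom_ext _ _ fun z =>
    iota_congr (w := w) (o := o.unop) z.1 (Category.comp_id z.2))

theorem iotaDesc_apply_gen {w : Word O} {X : PSh O} (x : ∀ i, X.obj (op (w.letter i)))
    (i : Fin w.len) : (iotaDesc x).app _ (iotaGen w i) = x i :=
  psh_map_id (x i)

theorem iotaMap_gen (F : O ⥤ Q) (w : Word O) (i : Fin w.len) :
    ((iotaMap F).app w).app _ (iotaGen w i) = iotaGen ((Word.map F).obj w) i :=
  iota_congr (w := (Word.map F).obj w) i (F.map_id _)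

/-- The endofunctor `X ↦ A ⋆ X`. -/
abbrev actFun (A : Profunctor.{u} (Word O) O) : PSh O ⥤ PSh O :=
  rep.{u}.obj (a := Cat.of O) A

/-- The unit `a ↦ [a, 1]` of the adjunction between `r` and `U`. -/
def repUnit (A : Profunctor.{u} (Word O) O) :
    A ⟶ iota O ⋙ actFun A where
  app w :=
    { app := fun o => ↾fun a => act.mk (A := A) (X := (iota O).obj w) (o := o.unop) a (iotaGen w)
      naturality := fun _ _ _ => rfl }
  naturality w w' g := by
    refine NatTrans.ext (funext fun o => ConcreteCategory.hom_ext _ _ fun a => ?_)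
    -- The coend relation moves `g` from `a` to the generators of `ι(w')`, where it gives the images
    -- under `ι(g)` of the generators of `ι(w)`.
    refine (act.sound (A := A) (X := (iota O).obj w') (o := o.unop) g a (iotaGen w')).symm.trans ?_
    refine congrArg (act.mk (A := A) (X := (iota O).obj w') (o := o.unop) a) (funext fun i => ?_)
    exact iota_congr (w := w') (Fin.cast g.len_eq i)
      ((Category.comp_id (g.app i)).trans (Category.id_comp (g.app i)).symm)

/-- The counit `[h, x] ↦ H(x)(h)` of the adjunction between `r` and `U`. -/
def repCounit (H : PSh O ⥤ PSh O) :
    actFun (iota O ⋙ H) ⟶ H where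
  app X :=
    { app := fun o => ↾(Ten.lift (A := (iota O ⋙ H).flip.obj o) (P := pow X)
        (fun w h x => (H.map (iotaDesc x)).app o h) fun {w w'} v a x => by
          have h : H.map (iotaDesc ((pow X).map v.op x)) = H.map ((iota O).map v) ≫ H.map (iotaDesc x) :=
            (congrArg H.map (iotaDesc_pow v x)).trans (H.map_comp _ _)
          exact ConcreteCategory.congr_hom (NatTrans.congr_app h o) a)
      naturality := fun o o' f => by
        ext z
        induction z using Ten.ind with | h w a x => ?_
        exact ConcreteCategory.congr_hom ((H.map (iotaDesc x)).naturality f) a }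
  naturality X Y g := act.hom_ext fun o w a x => by
    have h : H.map (iotaDesc fun i => g.app _ (x i)) = H.map (iotaDesc x) ≫ H.map g :=
      (congrArg H.map (iotaDesc_comp x g)).trans (H.map_comp _ _)
    exact ConcreteCategory.congr_hom (NatTrans.congr_app h (op o)) a

end Adjunction

/-- The adjunction between `r` and `U`. -/
def repAdj : CatOver.Adj rep.{u} repRight.{u} where
  unit :=
    { app := fun {O} A => repUnit A
      naturality := fun {O Q u A B} f => by
        refine NatTrans.ext (funext fun w => NatTrans.ext (funext fun o =>
          ConcreteCategory.hom_ext _ _ fun a => ?_))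
        refine congrArg (act.mk (A := B) (X := (iota Q).obj ((Word.map u.toFunctor).obj w))
          (o := u.toFunctor.obj o.unop) ((f.app w).app o a)) (funext fun i => ?_)
        exact (iotaMap_gen u.toFunctor w i).symm }
  counit :=
    { app := fun {O} H => repCounit H
      naturality := fun {O Q u P H} τ => by
        refine NatTrans.ext (funext fun X => act.hom_ext fun o w a x => ?_)
        -- The map from `ι(w)` to the reindexing of `X` named by `x` factors through the reindexing
        -- of `ι(M(u)(w))`. Functoriality of `P` separates the two factors, and naturality of `τ`
        -- carries the second one across.
        have h₁ := τ.naturality (iotaDesc (w := (Word.map u.toFunctor).obj w) x)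
        have h₂ := P.map_comp ((iotaMap u.toFunctor).app w)
          ((reindex u.toFunctor).map (iotaDesc (w := (Word.map u.toFunctor).obj w) x))
        refine Eq.trans ?_ (congrArg ((τ.app X).app (op o))
          (ConcreteCategory.congr_hom (NatTrans.congr_app h₂ (op o)) a)).symm
        exact (ConcreteCategory.congr_hom (NatTrans.congr_app h₁ (op o))
          ((P.map ((iotaMap u.toFunctor).app w)).app (op o) a)).symm }
  left_triangle {O} A := NatTrans.ext (funext fun X => act.hom_ext fun o w a x =>
    congrArg (act.mk (A := A) (X := X) (o := o) a) (funext fun i => iotaDesc_apply_gen x i))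
  right_triangle {O} H := NatTrans.ext (funext fun w => NatTrans.ext (funext fun o =>
    ConcreteCategory.hom_ext _ _ fun h => by
      have e : H.map (iotaDesc (iotaGen w)) = 𝟙 _ :=
        (congrArg H.map (iotaDesc_gen w)).trans (H.map_id _)
      exact ConcreteCategory.congr_hom (NatTrans.congr_app e o) h))

/-! ### Prone and supine arrows -/

namespace CatOver

variable {S : Type u₁} [Category.{v₁} S] {C : CatOver.{w, v} S} {D : CatOver.{w', v'} S}

/-- A left adjoint preserves supine arrows. -/
theorem Adj.map_supine {F : OneCell C D} {G : OneCell D C} (adj : Adj F G) {a b : S} {u : a ⟶ b}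
    {x : C.Ob a} {y : C.Ob b} {f : C.Hom u x y} (hf : C.IsSupine f) : D.IsSupine (F.map f) := by
  -- What is needed of the adjunction: `η` is natural over every arrow of the base, and an arrow `k`
  -- out of `F x` is recovered from its transpose `η ≫ G k` by applying `F` and following with the
  -- counit.
  obtain ⟨η, nη⟩ : ∃ η : ∀ {a : S} (x : C.Ob a), C.Hom (𝟙 a) x (G.obj (F.obj x)),
      (∀ {a b : S} {u : a ⟶ b} {x : C.Ob a} {y : C.Ob b} (f : C.Hom u x y),
        C.comp (Category.comp_id u) f (η y) = C.comp (Category.id_comp u) (η x) (G.map (F.map f))) ∧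
      (∀ {a b : S} {u : a ⟶ b} {x : C.Ob a} {z : D.Ob b} (k : D.Hom u (F.obj x) z),
        ∃ ε : D.Hom (𝟙 b) (F.obj (G.obj z)) z, ε = adj.counit.app z ∧
        D.comp (Category.comp_id u) (F.map (C.comp (Category.id_comp u) (η x) (G.map k))) ε = k) := by
    refine ⟨fun x => adj.unit.app x, adj.unit.naturality, fun {a b u x z} k =>
      ⟨adj.counit.app z, rfl, ?_⟩⟩
    have n : D.comp (Category.comp_id u) (F.map (G.map k)) (adj.counit.app z) =
      D.comp (Category.id_comp u) (adj.counit.app (F.obj x)) k := adj.counit.naturality k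
    have e := F.map_comp (Category.id_comp u) (adj.unit.app x) (G.map k)
    refine (congrArg (fun l => D.comp (Category.comp_id u) l (adj.counit.app z)) e).trans ?_
    refine (D.assoc _ _ (Category.comp_id u) (Category.id_comp u) _ _ _).trans ?_
    refine (congrArg (D.comp (Category.id_comp u) (F.map (adj.unit.app x))) n).trans ?_
    refine (D.assoc (Category.id_comp _) (Category.id_comp u) _ _ _ _ _).symm.trans ?_
    exact (congrArg (fun l => D.comp (Category.id_comp u) l k) (adj.left_triangle x)).trans
      (D.id_comp k)
  obtain ⟨nη, bwd⟩ := nη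
  intro c t ut h z g
  obtain ⟨ε, hε, eg⟩ := bwd g
  obtain ⟨k, hk, uniq⟩ := hf t h (G.obj z) (C.comp (Category.id_comp ut) (η x) (G.map g))
  -- The factorization through `F f` is obtained by transposing `g`, factoring through `f`, and
  -- transposing back.
  refine ⟨D.comp (Category.comp_id t) (F.map k) ε, ?_, fun l hl => ?_⟩
  · dsimp only
    rw [← D.assoc h (Category.comp_id ut) _ _, ← F.map_comp, hk, eg]
  · dsimp only at hl
    obtain ⟨ε', hε', el⟩ := bwd l
    rw [hε, ← hε', ← uniq (C.comp (Category.id_comp t) (η y) (G.map l)) ?_, el]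
    dsimp only
    rw [← C.assoc (Category.comp_id u) h _ _, nη, C.assoc _ _ h (Category.id_comp ut),
      ← G.map_comp, hl]

/-- A vertical isomorphism followed by a prone arrow is prone. -/
theorem IsProne.comp_iso {a b : S} {u : a ⟶ b} {x x' : C.Ob a} {y : C.Ob b} {f : C.Hom u x y}
    (hf : C.IsProne f) (k : C.Hom (𝟙 a) x' x) (k' : C.Hom (𝟙 a) x x')
    (h : C.vcomp k k' = C.id x') (h' : C.vcomp k' k = C.id x) :
    C.IsProne (C.comp (Category.id_comp u) k f) := by
  intro c t tu e z g
  obtain ⟨l, hl, uniq⟩ := hf t e z g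
  dsimp only [vcomp] at hl uniq h h'
  refine ⟨C.comp (Category.comp_id t) l k', ?_, fun m hm => ?_⟩
  · dsimp only
    rw [C.assoc (Category.comp_id t) e (Category.id_comp u) e,
      ← C.assoc (Category.id_comp _) (Category.id_comp u) (Category.id_comp u)
      (Category.id_comp u), h', C.id_comp, hl]
  · dsimp only at hm
    rw [← uniq (C.comp (Category.comp_id t) m k) (by rw [C.assoc _ _ (Category.id_comp u) e, hm]),
      C.assoc _ _ (Category.comp_id _) (Category.comp_id t), h, C.comp_id]

/-- A 1-cell preserves prone arrows if it preserves enough of them. -/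
theorem OneCell.map_prone_of_exists (F : OneCell C D)
    (H : ∀ {a b : S} (u : a ⟶ b) (y : C.Ob b),
      ∃ (x : C.Ob a) (f : C.Hom u x y), C.IsProne f ∧ D.IsProne (F.map f))
    {a b : S} {u : a ⟶ b} {x : C.Ob a} {y : C.Ob b} (f : C.Hom u x y) (hf : C.IsProne f) :
    D.IsProne (F.map f) := by
  obtain ⟨x₀, f₀, h₀, hF⟩ := H u y
  -- Two prone arrows over `u` into `y` differ by a vertical isomorphism, so `F f` is the image of
  -- an isomorphism followed by the prone arrow `F f₀`.
  obtain ⟨k, hk, -⟩ := h₀ (𝟙 a) (Category.id_comp u) x f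
  obtain ⟨k', hk', -⟩ := hf (𝟙 a) (Category.id_comp u) x₀ f₀
  have e : C.vcomp k k' = C.id x := (hf (𝟙 a) (Category.id_comp u) x f).unique
    (by rw [C.assoc _ _ (Category.id_comp u) (Category.id_comp u), hk', hk]) (C.id_comp f)
  have e' : C.vcomp k' k = C.id x₀ := (h₀ (𝟙 a) (Category.id_comp u) x₀ f₀).unique
    (by rw [C.assoc _ _ (Category.id_comp u) (Category.id_comp u), hk, hk']) (C.id_comp f₀)
  have : D.IsProne (D.comp (Category.id_comp u) (F.map k) (F.map f₀)) := hF.comp_iso (F.map k) (F.map k')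
    ((F.map_comp _ k k').symm.trans ((congrArg F.map e).trans (F.map_id x)))
    ((F.map_comp _ k' k).symm.trans ((congrArg F.map e').trans (F.map_id x₀)))
  rwa [← F.map_comp, hk] at this

end CatOver

/-! ### Finite products of coends -/

section Pi

/-- With finitely many coordinates, change one coordinate at a time; reflexivity of each `r i` lets
the other coordinates stand still during a step. This is the commutation of finite products with
quotients. -/
theorem eqvGen_pi {ι : Type*} [Finite ι] {α : ι → Type*} (r : ∀ i, α i → α i → Prop)
    (hr : ∀ i a, r i a a) {x y : ∀ i, α i} (h : ∀ i, Quot.mk (r i) (x i) = Quot.mk (r i) (y i)) :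
    Relation.EqvGen (fun x y => ∀ i, r i (x i) (y i)) x y := by
  classical
  have := Fintype.ofFinite ι
  have step : ∀ (i : ι) (a b : α i), Relation.EqvGen (r i) a b → ∀ z : ∀ i, α i,
      Relation.EqvGen (fun x y => ∀ i, r i (x i) (y i)) (Function.update z i a)
        (Function.update z i b) := by
    intro i a b hab z
    induction hab with
    | rel a b hab =>
      refine .rel _ _ fun j => ?_
      by_cases hj : j = i
      · subst hj; simpa using hab
      · simpa [hj] using hr j (z j)
    | refl a => exact .refl _
    | symm a b _ ih => exact .symm _ _ ih
    | trans a b c _ _ ih ih' => exact .trans _ _ _ ih ih'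
  -- The intermediate family agrees with `y` on `s` and with `x` elsewhere.
  have key : ∀ s : Finset ι, Relation.EqvGen (fun x y => ∀ i, r i (x i) (y i)) x
      (s.piecewise y x) := by
    intro s
    induction s using Finset.induction_on with
    | empty => simpa using Relation.EqvGen.refl x
    | insert i s hi ih =>
      refine .trans _ _ _ ih ?_
      rw [Finset.piecewise_insert]
      have := step i (x i) (y i) (Quot.eqvGen_exact (h i)) (s.piecewise y x)
      rwa [← Finset.piecewise_eq_of_notMem s y x hi, Function.update_eq_self] at this
  simpa using key Finset.univ

/-- A function of finite families of representatives of elements of coends which is invariant under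
the generating relations only depends on the elements. -/
theorem Ten.pi_eq {J : Type u} [Category.{u} J] {ι : Type*} [Finite ι] {A : ι → J ⥤ Type u}
    {P : ι → Jᵒᵖ ⥤ Type u} {Z : Type*}
    (Φ : ∀ (j : ι → J) (_ : ∀ i, (A i).obj (j i)) (_ : ∀ i, (P i).obj (op (j i))), Z)
    (hΦ : ∀ (j k : ι → J) (v : ∀ i, j i ⟶ k i) (a : ∀ i, (A i).obj (j i))
      (x : ∀ i, (P i).obj (op (k i))),
      Φ j a (fun i => (P i).map (v i).op (x i)) = Φ k (fun i => (A i).map (v i) (a i)) x)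
    {j k : ι → J} {a : ∀ i, (A i).obj (j i)} {x : ∀ i, (P i).obj (op (j i))}
    {b : ∀ i, (A i).obj (k i)} {y : ∀ i, (P i).obj (op (k i))}
    (h : ∀ i, (Ten.mk (a i) (x i) : Ten (A i) (P i)) = Ten.mk (b i) (y i)) : Φ j a x = Φ k b y := by
  let α : ι → Type u := fun i => Σ j, (A i).obj j × (P i).obj (op j)
  -- The generating relation of the coend in symmetric form; identity arrows of `J` make it
  -- reflexive, as `eqvGen_pi` requires.
  let r : ∀ i, α i → α i → Prop := fun i s t => ∃ (j k : J) (v : j ⟶ k) (a : (A i).obj j)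
    (x : (P i).obj (op k)), s = ⟨j, a, (P i).map v.op x⟩ ∧ t = ⟨k, (A i).map v a, x⟩
  let Ψ : (∀ i, α i) → Z := fun s => Φ (fun i => (s i).1) (fun i => (s i).2.1) (fun i => (s i).2.2)
  have hr : ∀ i a, r i a a := fun i ⟨j, a, x⟩ => ⟨j, j, 𝟙 j, a, x, by simp, by simp⟩
  have hq : ∀ i, Quot.mk (r i) ⟨j i, a i, x i⟩ = Quot.mk (r i) ⟨k i, b i, y i⟩ := fun i => by
    have := congrArg (Ten.lift (A := A i) (P := P i)
      (fun j a x => Quot.mk (r i) ⟨j, a, x⟩)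
      (fun {j k} v a x => Quot.sound ⟨j, k, v, a, x, rfl, rfl⟩)) (h i)
    exact this
  have main : ∀ s t : ∀ i, α i, Relation.EqvGen (fun x y => ∀ i, r i (x i) (y i)) s t →
      Ψ s = Ψ t := by
    intro s t hst
    induction hst with
    | rel s t hst =>
      choose j k v a x hs ht using hst
      obtain rfl : s = _ := funext hs
      obtain rfl : t = _ := funext ht
      exact hΦ j k v a x
    | refl s => rfl
    | symm s t _ ih => exact ih.symm
    | trans s t t' _ _ ih ih' => exact ih.trans ih'
  exact main _ _ (eqvGen_pi r hr hq)

end Pi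

/-! ### Extension of presheaves along a functor -/

section Extension

variable {O Q : Type u} [Category.{u} O] [Category.{u} Q] (F : O ⥤ Q)

/-- The extension `F_!(X)` of a presheaf along `F`, with `F_!(X)(q) = ∫^o Q(q, F(o)) × X(o)`. -/
def extObj (X : PSh O) : PSh Q where
  obj q := Ten (F ⋙ coyoneda.obj q) X
  map f := ↾(Ten.map (𝟭 _) (Functor.whiskerLeft F (coyoneda.map f)) (𝟙 X))
  map_id q := by
    ext z
    induction z using Ten.ind with | h o g x => ?_
    exact congrArg (fun g => (Ten.mk (A := F ⋙ coyoneda.obj q) g x : Ten _ X)) (Category.id_comp g)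
  map_comp {q q' q''} f f' := by
    ext z
    induction z using Ten.ind with | h o g x => ?_
    exact congrArg (fun g => (Ten.mk (A := F ⋙ coyoneda.obj q'') g x : Ten _ X))
      (Category.assoc f'.unop f.unop g)

variable {F}

/-- The element `[g, x]` of `F_!(X)(q)`, for `g : q ⟶ F(o)` and `x ∈ X(o)`. -/
def extObj.mk {X : PSh O} {q : Q} {o : O} (g : q ⟶ F.obj o) (x : X.obj (op o)) :
    (extObj F X).obj (op q) :=
  Ten.mk (A := F ⋙ coyoneda.obj (op q)) (P := X) g x

theorem extObj.sound {X : PSh O} {q : Q} {o o' : O} (g : q ⟶ F.obj o) (v : o ⟶ o')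
    (x : X.obj (op o')) :
    extObj.mk (F := F) g (X.map v.op x) = extObj.mk (g ≫ F.map v) x :=
  Ten.sound (A := F ⋙ coyoneda.obj (op q)) (P := X) v g x

theorem extObj.exists_rep {X : PSh O} {q : Q} (z : (extObj F X).obj (op q)) :
    ∃ (o : O) (g : q ⟶ F.obj o) (x : X.obj (op o)), z = extObj.mk g x :=
  Ten.ind (A := F ⋙ coyoneda.obj (op q)) (P := X)
    (p := fun z => ∃ (o : O) (g : q ⟶ F.obj o) (x : X.obj (op o)), z = extObj.mk g x)
    (fun o g x => ⟨o, g, x, rfl⟩) z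

/-- Maps out of `F_!(X)`. -/
def extObj.desc {X : PSh O} {Y : PSh Q} (k : X ⟶ (reindex F).obj Y) : extObj F X ⟶ Y where
  app q := ↾(Ten.lift (A := F ⋙ coyoneda.obj q) (P := X)
    (fun o (g : q.unop ⟶ F.obj o) x => Y.map g.op (k.app (op o) x)) fun {o o'} v g x => by
      refine (congrArg (Y.map (Quiver.Hom.op (X := q.unop) g))
        (ConcreteCategory.congr_hom (k.naturality v.op) x)).trans ?_
      exact (psh_map_comp (X := Y) (o := q.unop) g (F.map v) (k.app (op o') x)).symm)
  naturality q q' f := by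
    ext z
    induction z using Ten.ind with | h o g x => ?_
    exact psh_map_comp (X := Y) (o' := q.unop) f.unop g (k.app (op o) x)

variable (F)

/-- The unit `x ↦ [1, x]`. -/
def extUnit (X : PSh O) : X ⟶ (reindex F).obj (extObj F X) where
  app o := ↾fun x => extObj.mk (o := o.unop) (𝟙 (F.obj o.unop)) x
  naturality o o' f := by
    ext x
    refine (extObj.sound (X := X) (𝟙 (F.obj o'.unop)) f.unop x).trans ?_
    exact congrArg (fun g => extObj.mk (F := F) (X := X) (o := o.unop) g x)
      ((Category.id_comp (F.map f.unop)).trans (Category.comp_id (F.map f.unop)).symm)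

/-- The universal property of the extension. -/
def extEquiv (X : PSh O) (Y : PSh Q) : (extObj F X ⟶ Y) ≃ (X ⟶ (reindex F).obj Y) where
  toFun k := extUnit F X ≫ (reindex F).map k
  invFun := extObj.desc
  left_inv k := by
    refine NatTrans.ext (funext fun q => ConcreteCategory.hom_ext _ _ fun z => ?_)
    induction z using Ten.ind with | h o g x => ?_
    refine (ConcreteCategory.congr_hom (k.naturality (Quiver.Hom.op (X := q.unop) g))
      (extObj.mk (𝟙 (F.obj o)) x)).symm.trans ?_
    exact congrArg (fun g => k.app q (extObj.mk (F := F) (X := X) (q := q.unop) (o := o) g x))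
      (Category.comp_id (X := q.unop) g)
  right_inv k := by
    refine NatTrans.ext (funext fun o => ConcreteCategory.hom_ext _ _ fun x => ?_)
    exact psh_map_id (X := Y) (o := F.obj o.unop) (k.app o x)

/-- The left adjoint `F_!` of reindexing. -/
def extFunctor : PSh O ⥤ PSh Q :=
  Adjunction.leftAdjointOfEquiv (G := reindex F) (F_obj := extObj F) (fun X Y => extEquiv F X Y)
    fun _ _ _ _ _ => rfl

/-- The adjunction between extension and reindexing. -/
def extAdj : extFunctor F ⊣ reindex F :=
  Adjunction.adjunctionOfEquivLeft (G := reindex F) (F_obj := extObj F)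
    (fun X Y => extEquiv F X Y) fun _ _ _ _ _ => rfl

variable {F}

/-- The map `(A ⋆ X)(o) → (B ⋆ F_!(X))(F(o))`, for `A` the reindexing of `B`. -/
def actExt (B : Profunctor.{u} (Word Q) Q) (X : PSh O) :
    act (Word.map F ⋙ B ⋙ reindex F) X ⟶ (reindex F).obj (act B (extObj F X)) :=
  actMap F (𝟙 _) (extUnit F X)

/-- The arrow of words given by an arrow from each letter. -/
def Word.homMk {w : Word O} (l : Fin w.len → O) (g : ∀ i, w.letter i ⟶ l i) :
    w ⟶ (⟨w.len, l⟩ : Word O) :=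
  ⟨rfl, g⟩

/-- The element of `(A ⋆ X)(o)` given by `b ∈ B(F(o); w)` and a family of representatives
`(gᵢ : wᵢ ⟶ F(jᵢ), xᵢ)`. -/
def actExt.rep (B : Profunctor.{u} (Word Q) Q) (X : PSh O) {o : O} {w : Word Q}
    (b : (B.obj w).obj (op (F.obj o))) (j : Fin w.len → O) (g : ∀ i, w.letter i ⟶ F.obj (j i))
    (x : ∀ i, X.obj (op (j i))) : (act (Word.map F ⋙ B ⋙ reindex F) X).obj (op o) :=
  act.mk (A := Word.map F ⋙ B ⋙ reindex F) (w := ⟨w.len, j⟩)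
    ((B.map (Word.homMk (fun i => F.obj (j i)) g)).app (op (F.obj o)) b) x

theorem profunctor_map_comp {B : Profunctor.{u} (Word O) O} {o : O} {w w' w'' : Word O}
    (f : w ⟶ w') (g : w' ⟶ w'') (b : (B.obj w).obj (op o)) :
    (B.map (f ≫ g)).app (op o) b = (B.map g).app (op o) ((B.map f).app (op o) b) :=
  ConcreteCategory.congr_hom (NatTrans.congr_app (B.map_comp f g) (op o)) b

theorem profunctor_map_id {B : Profunctor.{u} (Word O) O} {o : O} {w : Word O}
    (b : (B.obj w).obj (op o)) : (B.map (𝟙 w)).app (op o) b = b :=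
  ConcreteCategory.congr_hom (NatTrans.congr_app (B.map_id w) (op o)) b

/-- By `Ten.pi_eq` only one relation has to be checked, with arrows of `O` moved across at all
letters at once. Such a family is an arrow of words, which the coend defining the action absorbs. -/
theorem actExt.rep_congr (B : Profunctor.{u} (Word Q) Q) (X : PSh O) {o : O} {w : Word Q}
    (b : (B.obj w).obj (op (F.obj o))) {j j' : Fin w.len → O} {g : ∀ i, w.letter i ⟶ F.obj (j i)}
    {x : ∀ i, X.obj (op (j i))} {g' : ∀ i, w.letter i ⟶ F.obj (j' i)} {x' : ∀ i, X.obj (op (j' i))}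
    (h : ∀ i, extObj.mk (g i) (x i) = extObj.mk (g' i) (x' i)) :
    actExt.rep B X b j g x = actExt.rep B X b j' g' x' := by
  refine Ten.pi_eq (A := fun i => F ⋙ coyoneda.obj (op (w.letter i))) (P := fun _ => X)
    (fun j g x => actExt.rep B X b j g x) (fun j k v g x => ?_) h
  refine (act.sound (A := Word.map F ⋙ B ⋙ reindex F) (X := X) (w := ⟨w.len, j⟩)
    (w' := ⟨w.len, k⟩) (Word.homMk (w := ⟨w.len, j⟩) k v) _ x).trans ?_
  exact congrArg (fun b => act.mk (A := Word.map F ⋙ B ⋙ reindex F) (w := ⟨w.len, k⟩) b x)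
    (profunctor_map_comp (B := B) (w' := (Word.map F).obj ⟨w.len, j⟩)
      (w'' := (Word.map F).obj ⟨w.len, k⟩) (Word.homMk (fun i => F.obj (j i)) g)
      ((Word.map F).map (Word.homMk (w := ⟨w.len, j⟩) k v)) b).symm

theorem actExt.app_rep (B : Profunctor.{u} (Word Q) Q) (X : PSh O) {o : O} {w : Word Q}
    (b : (B.obj w).obj (op (F.obj o))) (j : Fin w.len → O) (g : ∀ i, w.letter i ⟶ F.obj (j i))
    (x : ∀ i, X.obj (op (j i))) :
    (actExt B X).app (op o) (actExt.rep B X b j g x) =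
      act.mk (A := B) (X := extObj F X) b (fun i => extObj.mk (g i) (x i)) := by
  refine (act.sound (A := B) (X := extObj F X) (w' := (Word.map F).obj ⟨w.len, j⟩)
    (Word.homMk (fun i => F.obj (j i)) g) b
    (fun i => extObj.mk (𝟙 (F.obj (j i))) (x i))).symm.trans ?_
  exact congrArg (act.mk b) (funext fun i => congrArg (fun g => extObj.mk g (x i))
    (Category.comp_id (g i)))

/-- In an element `[b, y]` of the target, each `yᵢ` is a class `[gᵢ, xᵢ]`. Choosing representatives
and pushing `b` forward along the `gᵢ` gives the inverse, and `actExt.rep_congr` makes it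
independent of the choice. -/
theorem actExt.bijective (B : Profunctor.{u} (Word Q) Q) (X : PSh O) (o : O) :
    Function.Bijective ((actExt (F := F) B X).app (op o)) := by
  choose j g x hz using fun (q : Q) (z : (extObj F X).obj (op q)) => extObj.exists_rep z
  let r : ∀ (w : Word Q) (b : (B.obj w).obj (op (F.obj o)))
    (y : ∀ i, (extObj F X).obj (op (w.letter i))), (act (Word.map F ⋙ B ⋙ reindex F) X).obj (op o) :=
    fun w b y => actExt.rep B X b (fun i => j _ (y i)) (fun i => g _ (y i)) (fun i => x _ (y i))
  -- The candidate inverse respects the coend relation: the representatives chosen for a restricted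
  -- family may be traded for the restrictions of the chosen representatives.
  have hr : ∀ {w w' : Word Q} (v : w ⟶ w') (b : (B.obj w).obj (op (F.obj o)))
      (y : ∀ i, (extObj F X).obj (op (w'.letter i))),
      r w b (fun i => (extObj F X).map (v.app i).op (y (Fin.cast v.len_eq i))) =
        r w' ((B.map v).app _ b) y := by
    rintro ⟨n, l⟩ ⟨n', l'⟩ ⟨h, v⟩ b y
    dsimp only at h
    subst h
    refine (actExt.rep_congr B X b (j' := fun i => j _ (y i)) (g' := fun i => v i ≫ g _ (y i))
      (x' := fun i => x _ (y i)) fun i => ?_).trans ?_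
    · refine (hz _ _).symm.trans ?_
      exact congrArg ((extObj F X).map (v i).op) (hz _ (y i))
    · exact congrArg (fun b => act.mk (A := Word.map F ⋙ B ⋙ reindex F) (X := X)
        (w := ⟨n, fun i => j _ (y i)⟩) b (fun i => x _ (y i)))
        (profunctor_map_comp (B := B) (w := ⟨n, l⟩) (w' := ⟨n, l'⟩)
          (w'' := (Word.map F).obj ⟨n, fun i => j _ (y i)⟩) ⟨rfl, v⟩
          (Word.homMk (w := ⟨n, l'⟩) (fun i => F.obj (j _ (y i))) (fun i => g _ (y i))) b)
  refine Function.bijective_iff_has_inverse.2 ⟨Ten.lift (A := B.flip.obj (op (F.obj o)))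
    (P := pow (extObj F X)) r hr, fun z => ?_, fun z => ?_⟩
  · induction z using act.ind with | h w b y => ?_
    -- An element of the image has the evident representatives `(1, yᵢ)`, for which the construction
    -- returns the original element.
    refine (actExt.rep_congr B X b (j' := w.letter) (g' := fun i => 𝟙 _) (x' := y)
      fun i => (hz _ _).symm).trans ?_
    exact congrArg (fun b => act.mk (A := Word.map F ⋙ B ⋙ reindex F) b y)
      (profunctor_map_id (B := B) b)
  · induction z using act.ind with | h w b y => ?_
    refine (actExt.app_rep B X b (fun i => j _ (y i)) (fun i => g _ (y i)) (fun i => x _ (y i))).trans ?_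
    exact congrArg (act.mk b) (funext fun i => (hz _ (y i)).symm)

end Extension

/-! ### The bifibrations -/

section Bifibrations

/-- Arrows into `B` over a composite `t ≫ u` are by definition arrows over `t` into the reindexing
of `B`, so the identity map of the reindexed graph is a prone lift. -/
theorem Gph.isProne_id {O Q : Cat.{u, u}} (u : O ⟶ Q) (B : Profunctor.{u} (Word Q) Q) :
    Gph.{u}.IsProne (u := u) (x := Word.map u.toFunctor ⋙ B ⋙ reindex u.toFunctor) (y := B)
      (𝟙 (Word.map u.toFunctor ⋙ B ⋙ reindex u.toFunctor)) := by
  intro R t tu h z g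
  subst h
  exact ⟨g, Category.comp_id _, fun k hk => (Category.comp_id _).symm.trans hk⟩

/-- Extension of graphs is left adjoint to reindexing. -/
noncomputable def gphExtAdj {O Q : Type u} [Category.{u} O] [Category.{u} Q] (F : O ⥤ Q) :
    (Functor.whiskeringRight (Word O) _ _).obj (extFunctor F) ⋙ (Word.map F).lan ⊣
      (Functor.whiskeringLeft _ _ (PSh Q)).obj (Word.map F) ⋙
        (Functor.whiskeringRight (Word O) _ _).obj (reindex F) :=
  ((extAdj F).whiskerRight (Word O)).comp ((Word.map F).lanAdjunction (PSh Q))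

/-- An arrow out of `A` over `u ≫ t` is a map into a graph reindexed along `t` and then along `u`;
transposing across extension and reindexing along `u` is unique factorization through the unit. -/
theorem Gph.isSupine_unit {O Q : Cat.{u, u}} (u : O ⟶ Q) (A : Profunctor.{u} (Word O) O) :
    Gph.{u}.IsSupine (u := u) (x := A) ((gphExtAdj u.toFunctor).unit.app A) := by
  intro R t ut h z g
  subst h
  let e := (gphExtAdj u.toFunctor).homEquiv A (Word.map t.toFunctor ⋙ z ⋙ reindex t.toFunctor)
  refine ⟨e.symm g, ?_, fun k hk => ?_⟩
  · exact ((gphExtAdj u.toFunctor).homEquiv_unit ..).symm.trans (e.apply_symm_apply g)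
  · refine (e.symm_apply_eq.2 ?_).symm
    exact hk.symm.trans ((gphExtAdj u.toFunctor).homEquiv_unit ..).symm

theorem Gph.isBifibration : Gph.{u}.IsBifibration where
  exists_prone u B := ⟨_, _, Gph.isProne_id u B⟩
  exists_supine u A := ⟨_, _, Gph.isSupine_unit u A⟩

/-- As `u_!` is left adjoint to `u^*`, precomposition with `u^*` is left adjoint to precomposition
with `u_!`. Transposing across this second adjunction gives the factorization, with the prone lift
`u^* H u_!`. -/
theorem EndDFib.isProne_counit {O Q : Cat.{u, u}} (u : O ⟶ Q) (H : PSh Q ⥤ PSh Q) :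
    EndDFib.{u}.IsProne (u := u) (x := extFunctor u.toFunctor ⋙ H ⋙ reindex u.toFunctor) (y := H)
      (Functor.whiskerRight (extAdj u.toFunctor).counit (H ⋙ reindex u.toFunctor)) := by
  intro R t tu h z g
  subst h
  let adj := (extAdj u.toFunctor).whiskerLeft (PSh R)
  let e := adj.homEquiv (reindex t.toFunctor ⋙ z) (H ⋙ reindex u.toFunctor ⋙ reindex t.toFunctor)
  refine ⟨e g, ?_, fun k hk => ?_⟩
  · exact (adj.homEquiv_counit ..).symm.trans (e.symm_apply_apply g)
  · refine (e.symm_apply_eq.1 ?_)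
    exact (adj.homEquiv_counit ..).trans hk

/-- Dually to the prone case, this uses that postcomposition with `u_!` is left adjoint to
postcomposition with `u^*`; the supine lift is `u_! P u^*`. -/
theorem EndDFib.isSupine_unit {O Q : Cat.{u, u}} (u : O ⟶ Q) (P : PSh O ⥤ PSh O) :
    EndDFib.{u}.IsSupine (u := u) (x := P) (y := reindex u.toFunctor ⋙ P ⋙ extFunctor u.toFunctor)
      (Functor.whiskerLeft (reindex u.toFunctor ⋙ P) (extAdj u.toFunctor).unit) := by
  intro R t ut h z g
  subst h
  let adj := (extAdj u.toFunctor).whiskerRight (PSh R)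
  let e := adj.homEquiv (reindex t.toFunctor ⋙ reindex u.toFunctor ⋙ P) (z ⋙ reindex t.toFunctor)
  refine ⟨e.symm g, ?_, fun k hk => ?_⟩
  · exact (adj.homEquiv_unit ..).symm.trans (e.apply_symm_apply g)
  · refine (e.symm_apply_eq.2 ?_).symm
    exact hk.symm.trans (adj.homEquiv_unit ..).symm

theorem EndDFib.isBifibration : EndDFib.{u}.IsBifibration where
  exists_prone u H := ⟨_, _, EndDFib.isProne_counit u H⟩
  exists_supine u P := ⟨_, _, EndDFib.isSupine_unit u P⟩

/-- The comparison of `A ⋆ X` with `B ⋆ F_!(X)`, for `A` the reindexing of `B`. -/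
def actExtTrans {O Q : Cat.{u, u}} (u : O ⟶ Q) (B : Profunctor.{u} (Word Q) Q) :
    actFun (Word.map u.toFunctor ⋙ B ⋙ reindex u.toFunctor) ⟶
      extFunctor u.toFunctor ⋙ actFun B ⋙ reindex u.toFunctor where
  app X := actExt B X
  naturality _ Y g := act.hom_ext fun o w b x =>
    congrArg (act.mk (A := B) (X := extObj u.toFunctor Y) (o := u.toFunctor.obj o)
      (w := (Word.map u.toFunctor).obj w) b) (funext fun i => ConcreteCategory.congr_hom
        (NatTrans.congr_app ((extAdj u.toFunctor).unit.naturality g) (op (w.letter i))) (x i))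

instance {O Q : Cat.{u, u}} (u : O ⟶ Q) (B : Profunctor.{u} (Word Q) Q) :
    IsIso (actExtTrans u B) := by
  refine (NatTrans.isIso_iff_isIso_app _).2 fun X => (NatTrans.isIso_iff_isIso_app _).2 fun o => ?_
  exact (isIso_iff_bijective _).2 (actExt.bijective (F := u.toFunctor) B X o.unop)

theorem EndDFib.isProne_comp_iso {O Q : Cat.{u, u}} {u : O ⟶ Q} {P P' : PSh O ⥤ PSh O}
    {H : PSh Q ⥤ PSh Q} {f : EndDFib.{u}.Hom u P H} (hf : EndDFib.{u}.IsProne f) (k : P' ⟶ P)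
    [IsIso k] :
    EndDFib.{u}.IsProne (EndDFib.{u}.comp (x := P') (y := P) (z := H) (Category.id_comp u) k f) := by
  let k' : P ⟶ P' := inv k
  have h : k ≫ k' = 𝟙 P' := IsIso.hom_inv_id k
  have h' : k' ≫ k = 𝟙 P := IsIso.inv_hom_id k
  exact fun {_} => CatOver.IsProne.comp_iso (C := EndDFib.{u}) (x := P) (x' := P') hf k k' h h'

/-- The image factors as the comparison of `A ⋆ X` with `u^*(B ⋆ u_!(X))`, invertible by
`actExt.bijective`, followed by the prone arrow built from the counit. -/
theorem rep_map_prone_id {O Q : Cat.{u, u}} (u : O ⟶ Q) (B : Profunctor.{u} (Word Q) Q) :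
    EndDFib.{u}.IsProne (rep.{u}.map (u := u)
      (x := Word.map u.toFunctor ⋙ B ⋙ reindex u.toFunctor) (y := B)
      (𝟙 (Word.map u.toFunctor ⋙ B ⋙ reindex u.toFunctor))) := by
  have e : rep.{u}.map (u := u)
      (x := Word.map u.toFunctor ⋙ B ⋙ reindex u.toFunctor) (y := B)
      (𝟙 (Word.map u.toFunctor ⋙ B ⋙ reindex u.toFunctor)) =
    EndDFib.{u}.comp (x := actFun (Word.map u.toFunctor ⋙ B ⋙ reindex u.toFunctor))
      (y := extFunctor u.toFunctor ⋙ actFun B ⋙ reindex u.toFunctor) (z := actFun B)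
      (Category.id_comp u) (actExtTrans u B)
      (Functor.whiskerRight (extAdj u.toFunctor).counit (actFun B ⋙ reindex u.toFunctor)) := by
    refine NatTrans.ext (funext fun X => act.hom_ext fun o w b x => ?_)
    refine congrArg (act.mk (A := B) (X := X) (o := u.toFunctor.obj o)
      (w := (Word.map u.toFunctor).obj w) b) (funext fun i => ?_)
    -- The unit used in `actExt` cancels against the counit by the triangle identity of `u_!` and
    -- `u^*`.
    exact (ConcreteCategory.congr_hom (NatTrans.congr_app
      ((extAdj u.toFunctor).right_triangle_components X) (op (w.letter i))) (x i)).symm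
  rw [e]
  exact fun {_} => EndDFib.isProne_comp_iso (EndDFib.isProne_counit u (actFun B)) (actExtTrans u B)

theorem rep_isMorphismOfBifibrations : rep.{u}.IsMorphismOfBifibrations where
  source := Gph.isBifibration
  target := EndDFib.isBifibration
  map_prone f hf := rep.{u}.map_prone_of_exists
    (fun u B => ⟨_, _, Gph.isProne_id u B, rep_map_prone_id u B⟩) f hf
  map_supine _ hf := repAdj.map_supine hf

end Bifibrations

/-! ### The action of a tensor product -/

section TensorAction

variable {O Q : Type u} [Category.{u} O] [Category.{u} Q]

theorem tens.ind {A B : Profunctor.{u} (Word O) O} {o : O} {w : Word O}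
    {P : ((tens A B).obj w).obj (op o) → Prop}
    (h : ∀ (p : Word O) (a : (A.obj p).obj (op o)) (c : Word.Cut p.len w.len)
      (b : ∀ i, (B.obj (w.block c i)).obj (op (p.letter i))), P (tens.mk a c b))
    (z : ((tens A B).obj w).obj (op o)) : P z :=
  Ten.ind (A := A.flip.obj (op o)) (P := (wordExt B).obj w) (fun p a b => h p a b.cut b.elt) z

theorem tens.hom_ext {A B D : Profunctor.{u} (Word O) O} {f g : tens A B ⟶ D}
    (h : ∀ (o : O) (w p : Word O) (a : (A.obj p).obj (op o)) (c : Word.Cut p.len w.len)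
      (b : ∀ i, (B.obj (w.block c i)).obj (op (p.letter i))),
      (f.app w).app (op o) (tens.mk a c b) = (g.app w).app (op o) (tens.mk a c b)) : f = g :=
  NatTrans.ext (funext fun w => NatTrans.ext (funext fun o => ConcreteCategory.hom_ext _ _ fun z =>
    tens.ind (o := o.unop) (P := fun z => (f.app w).app o z = (g.app w).app o z) (h o.unop w) z))

/-- Induction on the elements of `(A ⊗ B) ⋆ X`. -/
theorem actTens.ind {A B : Profunctor.{u} (Word O) O} {X : PSh O} {o : O}
    {P : (act (tens A B) X).obj (op o) → Prop}
    (h : ∀ (w p : Word O) (a : (A.obj p).obj (op o)) (c : Word.Cut p.len w.len)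
      (b : ∀ i, (B.obj (w.block c i)).obj (op (p.letter i))) (x : ∀ i, X.obj (op (w.letter i))),
      P (act.mk (tens.mk a c b) x)) (z : (act (tens A B) X).obj (op o)) : P z :=
  act.ind (fun w t x => tens.ind (P := fun t => P (act.mk t x))
    (fun p a c b => h w p a c b x) t) z

theorem actTens.hom_ext {A B : Profunctor.{u} (Word O) O} {X Y : PSh O}
    {f g : act (tens A B) X ⟶ Y}
    (h : ∀ (o : O) (w p : Word O) (a : (A.obj p).obj (op o)) (c : Word.Cut p.len w.len)
      (b : ∀ i, (B.obj (w.block c i)).obj (op (p.letter i))) (x : ∀ i, X.obj (op (w.letter i))),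
      f.app (op o) (act.mk (tens.mk a c b) x) = g.app (op o) (act.mk (tens.mk a c b) x)) : f = g :=
  NatTrans.ext (funext fun o => ConcreteCategory.hom_ext _ _ fun z =>
    actTens.ind (o := o.unop) (P := fun z => f.app o z = g.app o z) (h o.unop) z)

/-- The element `[a, ([bᵢ, xᵢ])ᵢ]` of `A ⋆ (B ⋆ X)`. -/
def actTens.split {A B : Profunctor.{u} (Word O) O} {X : PSh O} {o : O} {w p : Word O}
    (a : (A.obj p).obj (op o)) (c : Word.Cut p.len w.len)
    (b : ∀ i, (B.obj (w.block c i)).obj (op (p.letter i)))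
    (x : ∀ i, X.obj (op (w.letter i))) : (act A (act B X)).obj (op o) :=
  act.mk (X := act B X) a fun i => act.mk (b i) fun j => x (c.index i j)

/-- The map `[[a, (bᵢ)ᵢ], x] ↦ [a, ([bᵢ, xᵢ])ᵢ]`. -/
def actTens (A B : Profunctor.{u} (Word O) O) (X : PSh O) :
    act (tens A B) X ⟶ act A (act B X) where
  app o := ↾(Ten.lift (A := (tens A B).flip.obj o) (P := pow X)
    (fun w z x => Ten.lift (A := A.flip.obj o) (P := (wordExt B).obj w)
      (fun p a b => actTens.split (o := o.unop) a b.cut b.elt x)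
      (fun {p p'} v a b => act.sound (A := A) (X := act B X) (o := o.unop) v a
        (fun i => act.mk (b.elt i) fun j => x (b.cut.index i j))) z)
    (fun {w w'} v z x => by
      induction z using Ten.ind with | h p a b => ?_
      refine congrArg (act.mk (A := A) (X := act B X) (o := o.unop) a) (funext fun i => ?_)
      exact act.sound (A := B) (X := X) (Word.blockMap v b.cut i) (b.elt i)
        (fun j => x ((b.cut.cast rfl v.len_eq).index i j))))
  naturality o o' f := by
    refine ConcreteCategory.hom_ext _ _ fun z => ?_
    induction z using actTens.ind with | h w p a c b x => ?_
    rfl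

/-! ### Concatenation of words -/

/-- The concatenation of a finite family of words. -/
def Word.concat {n : ℕ} (q : Fin n → Word O) : Word O where
  len := ∑ i, (q i).len
  letter k := (q (finSigmaFinEquiv.symm k).1).letter (finSigmaFinEquiv.symm k).2

/-- The places where a concatenation is cut into its parts. -/
def Word.concatCut {n : ℕ} (l : Fin n → ℕ) : Word.Cut n (∑ i, l i) where
  pos i := ∑ k : Fin i, l (Fin.castLE (Nat.le_of_lt_succ i.2) k)
  mono := Fin.monotone_iff_le_succ.2 fun i =>
    (Nat.le_add_right _ _).trans_eq
      (Fin.sum_univ_castSucc (fun k : Fin (i + 1) => l (Fin.castLE i.2 k))).symm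
  pos_zero := by simp
  pos_last := by simp

theorem Word.concatCut_pos_succ {n : ℕ} (l : Fin n → ℕ) (i : Fin n) :
    (Word.concatCut l).pos i.succ = (Word.concatCut l).pos i.castSucc + l i :=
  Fin.sum_univ_castSucc (fun k : Fin (i + 1) => l (Fin.castLE i.2 k))

/-- `finSigmaFinEquiv` enumerates part by part with partial sums as offsets, and these are the
positions of the cut. Places inside a part are compared as numbers, since the length of the part, a
difference of partial sums, equals `l i` only propositionally. -/
theorem Word.concatCut_index {n : ℕ} (l : Fin n → ℕ) (i : Fin n) (j : Fin (l i))
    (j' : Fin ((Word.concatCut l).pos i.succ - (Word.concatCut l).pos i.castSucc))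
    (h : (j' : ℕ) = j) :
    finSigmaFinEquiv.symm ((Word.concatCut l).index i j') = (⟨i, j⟩ : Σ i, Fin (l i)) := by
  rw [Equiv.symm_apply_eq]
  refine Fin.ext ?_
  rw [finSigmaFinEquiv_apply]
  simp [Word.Cut.index, h, Word.concatCut]

/-- A word as a part of a concatenation. -/
def Word.concatPart {n : ℕ} (q : Fin n → Word O) (i : Fin n) :
    q i ⟶ (Word.concat q).block (Word.concatCut fun i => (q i).len) i where
  len_eq := by
    have := Word.concatCut_pos_succ (fun i => (q i).len) i
    simp only [Word.block]
    omega
  app j := eqToHom (congrArg (fun s : Σ i, Fin (q i).len => (q s.1).letter s.2)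
    (Word.concatCut_index (fun i => (q i).len) i j _ rfl).symm)

/-- An arrow of words each of whose components is the identity of a letter. -/
def Word.IsCast {p q : Word O} (f : p ⟶ q) : Prop :=
  ∀ i, ∃ h : p.letter i = q.letter (Fin.cast f.len_eq i), f.app i = eqToHom h

/-- Between two words there is at most one arrow made of identities, so equations among the
rearrangements produced by cutting and concatenating need no computation. -/
theorem Word.IsCast.eq {p q : Word O} {f g : p ⟶ q} (hf : Word.IsCast f) (hg : Word.IsCast g) :
    f = g :=
  Word.Hom.ext fun i => (hf i).choose_spec.trans (hg i).choose_spec.symm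

theorem Word.isCast_eqToHom {p q : Word O} (h : p = q) : Word.IsCast (eqToHom h) := by
  subst h
  exact fun i => ⟨rfl, rfl⟩

theorem Word.isCast_concatPart {n : ℕ} (q : Fin n → Word O) (i : Fin n) :
    Word.IsCast (Word.concatPart q i) := fun j =>
  ⟨congrArg (fun s : Σ i, Fin (q i).len => (q s.1).letter s.2)
    (Word.concatCut_index (fun i => (q i).len) i j _ rfl).symm, rfl⟩

theorem Word.isCast_id (p : Word O) : Word.IsCast (𝟙 p) :=
  fun _ => ⟨rfl, rfl⟩

theorem Word.IsCast.comp {p q r : Word O} {f : p ⟶ q} {g : q ⟶ r} (hf : Word.IsCast f)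
    (hg : Word.IsCast g) : Word.IsCast (f ≫ g) := fun i => by
  obtain ⟨h, e⟩ := hf i
  obtain ⟨h', e'⟩ := hg (Fin.cast f.len_eq i)
  exact ⟨h.trans h', (congrArg₂ (· ≫ ·) e e').trans (eqToHom_trans h h')⟩

theorem Word.IsCast.blockMap {n : ℕ} {w w' : Word O} {g : w ⟶ w'} (hg : Word.IsCast g)
    (c : Word.Cut n w.len) (i : Fin n) : Word.IsCast (Word.blockMap g c i) :=
  fun j => hg (c.index i j)

theorem Word.IsCast.map {p q : Word O} {f : p ⟶ q} (hf : Word.IsCast f) (F : O ⥤ Q) :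
    Word.IsCast ((Word.map F).map f) := fun i => by
  obtain ⟨h, e⟩ := hf i
  exact ⟨congrArg F.obj h, (congrArg F.map e).trans (eqToHom_map F h)⟩

theorem psh_map_eqToHom {X : PSh O} {ι : Type*} (l : ι → O) (x : ∀ i, X.obj (op (l i))) {i j : ι}
    (h : i = j) (h' : l i = l j) : X.map (eqToHom h').op (x j) = x i := by
  subst h
  exact psh_map_id (x i)

/-- Equal cuts have propositionally equal blocks, so the components are compared after transport
along the induced arrows of words. -/
theorem WordElt.congr_cut {B : Profunctor.{u} (Word O) O} {p w : Word O}
    {c c' : Word.Cut p.len w.len} (h : c = c')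
    {b : ∀ i, (B.obj (w.block c i)).obj (op (p.letter i))}
    {b' : ∀ i, (B.obj (w.block c' i)).obj (op (p.letter i))}
    (hb : ∀ i, (B.map (eqToHom (congrArg (fun c => w.block c i) h))).app _ (b i) = b' i) :
    (⟨c, b⟩ : WordElt B p w) = ⟨c', b'⟩ := by
  subst h
  exact WordElt.congr c b b' fun i => (profunctor_map_id (b i)).symm.trans (hb i)

section

variable {A B : Profunctor.{u} (Word O) O} {X : PSh O} {o : O} {p : Word O}

/-- The element of `(A ⊗ B) ⋆ X` obtained from `a ∈ A(o; p)` and a family of representatives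
`bᵢ ∈ B(pᵢ; qᵢ)` and `xᵢ ∈ X^qᵢ` by concatenating the words `qᵢ`. -/
def actTens.join (a : (A.obj p).obj (op o)) (q : Fin p.len → Word O)
    (b : ∀ i, (B.obj (q i)).obj (op (p.letter i))) (x : ∀ i j, X.obj (op ((q i).letter j))) :
    (act (tens A B) X).obj (op o) :=
  act.mk (w := Word.concat q) (tens.mk (w := Word.concat q) a (Word.concatCut fun i => (q i).len)
    fun i => (B.map (Word.concatPart q i)).app _ (b i))
    fun k => x (finSigmaFinEquiv.symm k).1 (finSigmaFinEquiv.symm k).2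

theorem Word.concat_map_aux {n : ℕ} {l : Fin n → ℕ} {p q : ∀ i, Fin (l i) → O}
    (v : ∀ i, (⟨l i, p i⟩ : Word O) ⟶ ⟨l i, q i⟩) {s t : Σ i, Fin (l i)} (h : t = s) :
    eqToHom (congrArg (fun s : Σ i, Fin (l i) => p s.1 s.2) h) ≫ (v s.1).app s.2 =
      (v t.1).app t.2 ≫ eqToHom (congrArg (fun s : Σ i, Fin (l i) => q s.1 s.2) h) := by
  subst h
  simp

/-- The arrows `vᵢ` concatenate to a single arrow of words, which the coend relation moves across in
one step; on the blocks it restricts to the `vᵢ` again. -/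
theorem actTens.join_sound (a : (A.obj p).obj (op o)) {q r : Fin p.len → Word O}
    (v : ∀ i, q i ⟶ r i) (b : ∀ i, (B.obj (q i)).obj (op (p.letter i)))
    (x : ∀ i, (pow X).obj (op (r i))) :
    actTens.join a q b (fun i => (pow X).map (v i).op (x i)) =
      actTens.join a r (fun i => (B.map (v i)).app _ (b i)) x := by
  -- Separating lengths from letters allows the equalities of lengths contained in the `vᵢ` to be
  -- substituted.
  obtain ⟨l, q, rfl⟩ : ∃ (l : Fin p.len → ℕ) (k : ∀ i, Fin (l i) → O), q = fun i => ⟨l i, k i⟩ :=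
    ⟨fun i => (q i).len, fun i => (q i).letter, rfl⟩
  obtain ⟨l', r, rfl⟩ : ∃ (l : Fin p.len → ℕ) (k : ∀ i, Fin (l i) → O), r = fun i => ⟨l i, k i⟩ :=
    ⟨fun i => (r i).len, fun i => (r i).letter, rfl⟩
  obtain rfl : l = l' := funext fun i => (v i).len_eq
  let V : Word.concat (fun i => (⟨l i, q i⟩ : Word O)) ⟶ Word.concat (fun i => ⟨l i, r i⟩) :=
    ⟨rfl, fun k => (v (finSigmaFinEquiv.symm k).1).app (finSigmaFinEquiv.symm k).2⟩
  refine (act.sound V _ fun k => x (finSigmaFinEquiv.symm k).1 (finSigmaFinEquiv.symm k).2).trans ?_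
  refine congrArg (fun t => act.mk t _) (congrArg (Ten.mk (A := A.flip.obj (op o)) a)
    (WordElt.congr (B := B) (p := p) (w := Word.concat (fun i => (⟨l i, r i⟩ : Word O)))
      (Word.concatCut l) _ _ fun i => ?_))
  have e : Word.concatPart (fun i => (⟨l i, q i⟩ : Word O)) i ≫ Word.blockMap V (Word.concatCut l) i =
      v i ≫ Word.concatPart (fun i => (⟨l i, r i⟩ : Word O)) i :=
    Word.Hom.ext fun j => Word.concat_map_aux v (Word.concatCut_index l i j _ rfl).symm
  refine (profunctor_map_comp _ _ _).symm.trans (Eq.trans ?_ (profunctor_map_comp _ _ _))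
  exact congrArg (fun f => (B.map f).app (op (p.letter i)) (b i)) e

/-- Cutting a concatenation returns its parts up to `Word.concatPart`, whose components are
identities; the coend relation moves it onto the `xᵢ`, where it disappears. -/
theorem actTens.app_join (a : (A.obj p).obj (op o)) (q : Fin p.len → Word O)
    (b : ∀ i, (B.obj (q i)).obj (op (p.letter i))) (x : ∀ i j, X.obj (op ((q i).letter j))) :
    (actTens A B X).app (op o) (actTens.join a q b x) =
      act.mk (X := act B X) a fun i => act.mk (b i) (x i) := by
  refine congrArg (act.mk (A := A) (X := act B X) a) (funext fun i => ?_)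
  refine (act.sound (A := B) (X := X) (Word.concatPart q i) (b i) _).symm.trans ?_
  refine congrArg (act.mk (b i)) (funext fun j => ?_)
  have e := (Word.concatCut_index (fun i => (q i).len) i j
    (Fin.cast (Word.concatPart q i).len_eq j) rfl).symm
  exact psh_map_eqToHom (X := X) (fun s : Σ i, Fin (q i).len => (q s.1).letter s.2)
    (fun s => x s.1 s.2) e (congrArg (fun s : Σ i, Fin (q i).len => (q s.1).letter s.2) e)

/-- The partial sums of the differences of successive positions telescope. -/
theorem Word.concatCut_cut {n m : ℕ} (c : Word.Cut n m) (i : Fin (n + 1)) :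
    (Word.concatCut fun i => c.pos i.succ - c.pos i.castSucc).pos i = c.pos i := by
  induction i using Fin.induction with
  | zero => rw [c.pos_zero, Word.Cut.pos_zero]
  | succ i ih =>
    rw [Word.concatCut_pos_succ, ih]
    have := c.mono (Fin.castSucc_le_succ i)
    omega

theorem Word.concatCut_len {n m : ℕ} (c : Word.Cut n m) :
    ∑ i : Fin n, (c.pos i.succ - c.pos i.castSucc) = m :=
  (Word.Cut.pos_last _).symm.trans ((Word.concatCut_cut c (Fin.last n)).trans c.pos_last)

theorem Word.concatCut_index_cut {n m : ℕ} (c : Word.Cut n m)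
    (k : Fin (∑ i : Fin n, (c.pos i.succ - c.pos i.castSucc))) :
    c.index (finSigmaFinEquiv.symm k).1 (finSigmaFinEquiv.symm k).2 =
      Fin.cast (Word.concatCut_len c) k := by
  obtain ⟨s, rfl⟩ := finSigmaFinEquiv.surjective k
  refine Fin.ext ?_
  rw [Equiv.symm_apply_apply]
  have := Word.concatCut_cut c s.1.castSucc
  rw [Fin.val_cast, finSigmaFinEquiv_apply]
  exact congrArg (· + (s.2 : ℕ)) this.symm

/-- The concatenation of the parts of a word is the word. -/
def Word.concatBlocks {n : ℕ} (w : Word O) (c : Word.Cut n w.len) :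
    Word.concat (w.block c) ⟶ w :=
  ⟨Word.concatCut_len c, fun k => eqToHom (congrArg w.letter (Word.concatCut_index_cut c k))⟩

theorem Word.isCast_concatBlocks {n : ℕ} (w : Word O) (c : Word.Cut n w.len) :
    Word.IsCast (Word.concatBlocks w c) :=
  fun k => ⟨congrArg w.letter (Word.concatCut_index_cut c k), rfl⟩

/-- Concatenating the parts of a word returns it up to `Word.concatBlocks`. Once this arrow is moved
across the coend, every arrow involved is made of identities, and `Word.IsCast.eq` finishes. -/
theorem actTens.join_split (a : (A.obj p).obj (op o)) {w : Word O} (c : Word.Cut p.len w.len)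
    (b : ∀ i, (B.obj (w.block c i)).obj (op (p.letter i))) (x : ∀ i, X.obj (op (w.letter i))) :
    actTens.join a (w.block c) b (fun i j => x (c.index i j)) = act.mk (tens.mk a c b) x := by
  let l : Fin p.len → ℕ := fun i => c.pos i.succ - c.pos i.castSucc
  have h : (fun k : Fin (Word.concat (w.block c)).len => x (c.index
      ((finSigmaFinEquiv (n := l)).symm k).1 ((finSigmaFinEquiv (n := l)).symm k).2)) =
      fun k => X.map ((Word.concatBlocks w c).app k).op
        (x (Fin.cast (Word.concatBlocks w c).len_eq k)) :=
    funext fun k => (psh_map_eqToHom (X := X) w.letter x (Word.concatCut_index_cut c k)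
      (congrArg w.letter (Word.concatCut_index_cut c k))).symm
  refine (congrArg (act.mk (w := Word.concat (w.block c)) (tens.mk (w := Word.concat (w.block c)) a
    (Word.concatCut _) fun i => (B.map (Word.concatPart (w.block c) i)).app _ (b i))) h).trans ?_
  refine (act.sound (Word.concatBlocks w c) _ x).trans ?_
  refine congrArg (fun t => act.mk t x) (congrArg (Ten.mk (A := A.flip.obj (op o)) a) ?_)
  refine WordElt.congr_cut (B := B) (p := p) (w := w) (Word.Cut.ext (funext fun i =>
    Word.concatCut_cut c i)) fun i => ?_
  refine (profunctor_map_comp _ _ _).symm.trans ((profunctor_map_comp _ _ _).symm.trans ?_)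
  refine Eq.trans (congrArg (fun f => (B.map f).app (op (p.letter i)) (b i)) ?_)
    (profunctor_map_id (b i))
  exact ((Word.isCast_concatPart (w.block c) i).comp
    (((Word.isCast_concatBlocks w c).blockMap _ i).comp (Word.isCast_eqToHom _))).eq (Word.isCast_id _)

/-- `Ten.pi_eq` reduces independence of the representatives `[bᵢ, xᵢ]` to `actTens.join_sound`. -/
theorem actTens.join_congr (a : (A.obj p).obj (op o)) {q r : Fin p.len → Word O}
    {b : ∀ i, (B.obj (q i)).obj (op (p.letter i))} {x : ∀ i j, X.obj (op ((q i).letter j))}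
    {b' : ∀ i, (B.obj (r i)).obj (op (p.letter i))} {x' : ∀ i j, X.obj (op ((r i).letter j))}
    (h : ∀ i, act.mk (b i) (x i) = act.mk (b' i) (x' i)) :
    actTens.join a q b x = actTens.join a r b' x' :=
  Ten.pi_eq (A := fun i => B.flip.obj (op (p.letter i))) (P := fun _ => pow X)
    (fun q b x => actTens.join a q b x) (fun _ _ v b x => actTens.join_sound a v b x) h

end

theorem act.exists_rep {A : Profunctor.{u} (Word O) O} {X : PSh O} {o : O}
    (z : (act A X).obj (op o)) :
    ∃ (w : Word O) (a : (A.obj w).obj (op o)) (x : ∀ i, X.obj (op (w.letter i))),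
      z = act.mk a x :=
  act.ind (p := fun z => ∃ (w : Word O) (a : (A.obj w).obj (op o))
    (x : ∀ i, X.obj (op (w.letter i))), z = act.mk a x) (fun w a x => ⟨w, a, x, rfl⟩) z

theorem tens.sound {A B : Profunctor.{u} (Word O) O} {o : O} {p p' w : Word O} (v : p ⟶ p')
    (a : (A.obj p).obj (op o)) (c : Word.Cut p'.len w.len)
    (b : ∀ i, (B.obj (w.block c i)).obj (op (p'.letter i))) :
    tens.mk a (c.cast v.len_eq rfl)
        (fun i => (B.obj (w.block c (Fin.cast v.len_eq i))).map (v.app i).op (b _)) =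
      tens.mk (B := B) ((A.map v).app (op o) a) c b :=
  Ten.sound (A := A.flip.obj (op o)) (P := (wordExt B).obj w) v a (⟨c, b⟩ : WordElt B p' w)

theorem profunctor_map_map {B : Profunctor.{u} (Word O) O} {o o' : O} {w w' : Word O}
    (f : o ⟶ o') (g : w ⟶ w') (b : (B.obj w).obj (op o')) :
    (B.map g).app (op o) ((B.obj w).map f.op b) = (B.obj w').map f.op ((B.map g).app (op o') b) :=
  ConcreteCategory.congr_hom ((B.map g).naturality f.op) b

/-- The inverse chooses representatives of the entries of a family in `B ⋆ X` and joins them;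
`actTens.join_congr` makes the result independent of the choices. -/
theorem actTens_bijective (A B : Profunctor.{u} (Word O) O) (X : PSh O) (o : O) :
    Function.Bijective ((actTens A B X).app (op o)) := by
  choose q b x hz using fun (o : O) (z : (act B X).obj (op o)) => act.exists_rep z
  let r : ∀ (p : Word O) (a : (A.obj p).obj (op o)) (y : ∀ i, (act B X).obj (op (p.letter i))),
      (act (tens A B) X).obj (op o) := fun p a y =>
    actTens.join a (fun i => q _ (y i)) (fun i => b _ (y i)) (fun i => x _ (y i))
  -- Compatibility with the coend over `p`: representatives of a restricted entry are traded for
  -- restricted representatives, and `tens.sound` then moves `v` onto `a`.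
  have hr : ∀ {p p' : Word O} (v : p ⟶ p') (a : (A.obj p).obj (op o))
      (y : ∀ i, (act B X).obj (op (p'.letter i))),
      r p a (fun i => (act B X).map (v.app i).op (y (Fin.cast v.len_eq i))) =
        r p' ((A.map v).app _ a) y := by
    rintro ⟨n, l⟩ ⟨n', l'⟩ ⟨h, v⟩ a y
    dsimp only at h
    subst h
    refine (actTens.join_congr a (r := fun i => q _ (y i))
      (b' := fun i => (B.obj (q _ (y i))).map (v i).op (b _ (y i)))
      (x' := fun i => x _ (y i)) fun i => ?_).trans ?_
    · refine (hz _ _).symm.trans ?_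
      exact congrArg ((act B X).map (v i).op) (hz _ (y i))
    · refine congrArg (fun t => act.mk (A := tens A B) (X := X) t _) ?_
      refine Eq.trans ?_ (tens.sound (B := B) (p := ⟨n, l⟩) (p' := ⟨n, l'⟩) ⟨rfl, v⟩ a _ _)
      exact congrArg (tens.mk (B := B) (p := ⟨n, l⟩) a _) (funext fun i => profunctor_map_map ..)
  refine Function.bijective_iff_has_inverse.2 ⟨Ten.lift (A := A.flip.obj (op o))
    (P := pow (act B X)) r hr, fun z => ?_, fun z => ?_⟩
  · induction z using actTens.ind with | h w p a c b' x' => ?_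
    exact (actTens.join_congr a fun i => (hz _ _).symm).trans (actTens.join_split a c b' x')
  · induction z using act.ind with | h p a y => ?_
    exact (actTens.app_join a _ _ _).trans
      (congrArg (act.mk (X := act B X) a) (funext fun i => (hz _ (y i)).symm))

end TensorAction

/-! ### The associativity of the tensor product -/

namespace Word

theorem Cut.pos_lt {n m : ℕ} (c : Cut n m) (i : Fin (n + 1)) : c.pos i < m + 1 := by
  have := c.mono (Fin.le_last i)
  have := c.pos_last
  omega

/-- The coarser cut obtained by joining the parts of `d` as prescribed by `c`. -/
def Cut.comp {n m l : ℕ} (c : Cut n m) (d : Cut m l) : Cut n l where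
  pos i := d.pos ⟨c.pos i, c.pos_lt i⟩
  mono _ _ h := d.mono (c.mono h)
  pos_zero := (congrArg d.pos (Fin.ext c.pos_zero)).trans d.pos_zero
  pos_last := (congrArg d.pos (Fin.ext c.pos_last)).trans d.pos_last

theorem Cut.add_lt {n m : ℕ} (c : Cut n m) (i : Fin n)
    (j : Fin (c.pos i.succ - c.pos i.castSucc + 1)) : c.pos i.castSucc + j < m + 1 := by
  have := c.mono (Fin.castSucc_le_succ i)
  have := c.pos_lt i.succ
  omega

/-- The cut of the `i`-th part of `c.comp d` given by `d`. -/
def Cut.sub {n m l : ℕ} (c : Cut n m) (d : Cut m l) (i : Fin n) :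
    Cut (c.pos i.succ - c.pos i.castSucc)
      ((c.comp d).pos i.succ - (c.comp d).pos i.castSucc) where
  -- Positions are counted from the start of the `i`-th coarse part. The subtraction is never
  -- truncated, since these positions of `d` do not precede that start.
  pos j := d.pos ⟨c.pos i.castSucc + j, c.add_lt i j⟩ - (c.comp d).pos i.castSucc
  mono j j' h := Nat.sub_le_sub_right (d.mono (Nat.add_le_add_left h _)) _
  pos_zero := Nat.sub_self _
  pos_last := by
    have := c.mono (Fin.castSucc_le_succ i)
    exact congrArg (· - (c.comp d).pos i.castSucc) (congrArg d.pos (Fin.ext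
      (Nat.add_sub_of_le this)))

theorem Cut.comp_le {n m l : ℕ} (c : Cut n m) (d : Cut m l) (i : Fin n)
    (j : Fin (c.pos i.succ - c.pos i.castSucc)) :
    (c.comp d).pos i.castSucc ≤ d.pos (c.index i j).castSucc :=
  d.mono (Nat.le_add_right _ _)

/-- The start of the coarse part, subtracted in `Cut.sub`, is added back by the outer `index`; both
sides are the start of the fine part plus `k`. -/
theorem Cut.index_sub {n m l : ℕ} (c : Cut n m) (d : Cut m l) (i : Fin n)
    (j : Fin (c.pos i.succ - c.pos i.castSucc))
    (k : Fin (d.pos (c.index i j).succ - d.pos (c.index i j).castSucc))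
    (k' : Fin ((c.sub d i).pos j.succ - (c.sub d i).pos j.castSucc)) (h : (k' : ℕ) = k) :
    (c.comp d).index i ((c.sub d i).index j k') = d.index (c.index i j) k := by
  refine Fin.ext ?_
  have h₁ := c.comp_le d i j
  have h₂ : (((c.sub d i).index j k' : Fin _) : ℕ) =
    d.pos (c.index i j).castSucc - (c.comp d).pos i.castSucc + k' := rfl
  change (c.comp d).pos i.castSucc + (((c.sub d i).index j k' : Fin _) : ℕ) =
    d.pos (c.index i j).castSucc + k
  omega

variable {O : Type u} [Category.{u} O] {Q : Type u} [Category.{u} Q]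

/-- A part of a word is a part of a part. -/
def blockBlock {n m : ℕ} (w : Word O) (c : Cut n m) (d : Cut m w.len) (i : Fin n)
    (j : Fin (c.pos i.succ - c.pos i.castSucc)) :
    w.block d (c.index i j) ⟶ (w.block (c.comp d) i).block (c.sub d i) j where
  len_eq := by
    have h₁ := c.comp_le d i j
    have h₂ : (c.sub d i).pos j.succ - (c.sub d i).pos j.castSucc =
      (d.pos (c.index i j).succ - (c.comp d).pos i.castSucc) -
        (d.pos (c.index i j).castSucc - (c.comp d).pos i.castSucc) := rfl
    change d.pos (c.index i j).succ - d.pos (c.index i j).castSucc =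
      (c.sub d i).pos j.succ - (c.sub d i).pos j.castSucc
    omega
  app k := eqToHom (congrArg w.letter (c.index_sub d i j k _ rfl).symm)

theorem isCast_blockBlock {n m : ℕ} (w : Word O) (c : Cut n m) (d : Cut m w.len) (i : Fin n)
    (j : Fin (c.pos i.succ - c.pos i.castSucc)) : IsCast (blockBlock w c d i j) :=
  fun k => ⟨congrArg w.letter (c.index_sub d i j k _ rfl).symm, rfl⟩

theorem hom_app_eqToHom {w w' : Word O} (g : w ⟶ w') {k k' : Fin w.len} (h : k = k') :
    g.app k ≫ eqToHom (congrArg (fun k => w'.letter (Fin.cast g.len_eq k)) h) =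
      eqToHom (congrArg w.letter h) ≫ g.app k' := by
  subst h
  simp

theorem blockBlock_naturality {n m : ℕ} {w w' : Word O} (g : w ⟶ w') (c : Cut n m)
    (d : Cut m w.len) (i : Fin n) (j : Fin (c.pos i.succ - c.pos i.castSucc)) :
    blockMap g d (c.index i j) ≫ blockBlock w' c (d.cast rfl g.len_eq) i j =
      blockBlock w c d i j ≫ blockMap (blockMap g (c.comp d) i) (c.sub d i) j :=
  Hom.ext fun k => hom_app_eqToHom g (c.index_sub d i j k _ rfl).symm

theorem map_blockBlock {n m : ℕ} (F : O ⥤ Q) (w : Word O) (c : Cut n m) (d : Cut m w.len)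
    (i : Fin n) (j : Fin (c.pos i.succ - c.pos i.castSucc)) :
    (Word.map F).map (blockBlock w c d i j) = blockBlock ((Word.map F).obj w) c d i j :=
  ((isCast_blockBlock w c d i j).map F).eq (isCast_blockBlock ((Word.map F).obj w) c d i j)

end Word

section Associativity

variable {O Q : Type u} [Category.{u} O] [Category.{u} Q]

section

variable {A B D : Profunctor.{u} (Word O) O} {o : O}

/-- The element `[a, ([bᵢ, (dᵢⱼ)ⱼ])ᵢ]` of `A ⊗ (B ⊗ D)`. -/
def tensAssocInv.elt {p q w : Word O} (a : (A.obj p).obj (op o)) (c : Word.Cut p.len q.len)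
    (b : ∀ i, (B.obj (q.block c i)).obj (op (p.letter i))) (d : Word.Cut q.len w.len)
    (e : ∀ k, (D.obj (w.block d k)).obj (op (q.letter k))) :
    ((tens A (tens B D)).obj w).obj (op o) :=
  tens.mk (B := tens B D) a (c.comp d) fun i =>
    tens.mk (B := D) (w := w.block (c.comp d) i) (b i) (c.sub d i) fun j =>
      (D.map (Word.blockBlock w c d i j)).app _ (e (c.index i j))

end

/-- The map `[[a, (bᵢ)ᵢ], (dₖ)ₖ] ↦ [a, ([bᵢ, (dᵢⱼ)ⱼ])ᵢ]`. -/
def tensAssocInv (A B D : Profunctor.{u} (Word O) O) :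
    tens (tens A B) D ⟶ tens A (tens B D) where
  app w :=
    -- In this direction no choice is made: the two cuts determine all the parts. The inverse is
    -- obtained later, from the action on presheaves.
    { app := fun o => ↾(Ten.lift (A := (tens A B).flip.obj o) (P := (wordExt D).obj w)
        (fun q z e => Ten.lift (A := A.flip.obj o) (P := (wordExt B).obj q)
          (fun p a b => tensAssocInv.elt (o := o.unop) a b.cut b.elt e.cut e.elt)
          (fun {p p'} v a b => tens.sound (A := A) (B := tens B D) (o := o.unop) v a
            (b.cut.comp e.cut) fun i =>
              tens.mk (B := D) (w := w.block (b.cut.comp e.cut) i) (b.elt i) (b.cut.sub e.cut i)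
              fun j => (D.map (Word.blockBlock w b.cut e.cut i j)).app _
                (e.elt (b.cut.index i j))) z)
        (fun {q q'} v z e => by
          induction z using Ten.ind with | h p a b => ?_
          refine congrArg (tens.mk (A := A) (B := tens B D) (o := o.unop) (w := w) a
            (b.cut.comp (e.cut.cast v.len_eq rfl))) (funext fun i => ?_)
          refine Eq.trans ?_ (tens.sound (A := B) (B := D) (Word.blockMap v b.cut i) (b.elt i) _ _)
          exact congrArg (tens.mk (A := B) (B := D)
            (w := w.block (b.cut.comp (e.cut.cast v.len_eq rfl)) i) (b.elt i) _) (funext fun j =>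
              profunctor_map_map ..)))
      naturality := fun o o' f => by
        refine ConcreteCategory.hom_ext _ _ fun z => ?_
        induction z using Ten.ind with | h q z e => ?_
        induction z using Ten.ind with | h p a b => ?_
        rfl }
  naturality w w' g := by
    refine NatTrans.ext (funext fun o => ConcreteCategory.hom_ext _ _ fun z => ?_)
    induction z using Ten.ind with | h q z e => ?_
    induction z using Ten.ind with | h p a b => ?_
    refine congrArg (tens.mk (A := A) (B := tens B D) (o := o.unop) (w := w') a
      (b.cut.comp (e.cut.cast rfl g.len_eq))) (funext fun i => ?_)
    refine congrArg (tens.mk (A := B) (B := D)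
      (w := w'.block (b.cut.comp (e.cut.cast rfl g.len_eq)) i) (b.elt i) _) (funext fun j => ?_)
    refine (profunctor_map_comp (Word.blockMap g e.cut (b.cut.index i j))
      (Word.blockBlock w' b.cut (e.cut.cast rfl g.len_eq) i j) (e.elt (b.cut.index i j))).symm.trans ?_
    refine Eq.trans ?_ (profunctor_map_comp (Word.blockBlock w b.cut e.cut i j)
      (Word.blockMap (Word.blockMap g (b.cut.comp e.cut) i) (b.cut.sub e.cut i) j)
      (e.elt (b.cut.index i j)))
    exact congrArg (fun f => (D.map f).app _ (e.elt (b.cut.index i j)))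
      (Word.blockBlock_naturality g b.cut e.cut i j)

/-- Induction on the elements of `(A ⊗ B) ⊗ D`. -/
theorem tensTens.ind {A B D : Profunctor.{u} (Word O) O} {o : O} {w : Word O}
    {P : ((tens (tens A B) D).obj w).obj (op o) → Prop}
    (h : ∀ (p q : Word O) (a : (A.obj p).obj (op o)) (c : Word.Cut p.len q.len)
      (b : ∀ i, (B.obj (q.block c i)).obj (op (p.letter i))) (d : Word.Cut q.len w.len)
      (e : ∀ k, (D.obj (w.block d k)).obj (op (q.letter k))),
      P (tens.mk (A := tens A B) (tens.mk a c b) d e))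
    (z : ((tens (tens A B) D).obj w).obj (op o)) : P z :=
  tens.ind (A := tens A B) (fun q t d e => tens.ind
    (P := fun t => P (tens.mk (A := tens A B) (B := D) t d e)) (fun p a c b => h p q a c b d e) t) z

theorem tensAssocInv_naturality (F : O ⥤ Q) {A B D : Profunctor.{u} (Word O) O}
    {A' B' D' : Profunctor.{u} (Word Q) Q} (f : A ⟶ Word.map F ⋙ A' ⋙ reindex F)
    (g : B ⟶ Word.map F ⋙ B' ⋙ reindex F) (k : D ⟶ Word.map F ⋙ D' ⋙ reindex F) :
    tensMap F (tensMap F f g) k ≫ Functor.whiskerLeft (Word.map F)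
        (Functor.whiskerRight (tensAssocInv A' B' D') (reindex F)) =
      tensAssocInv A B D ≫ tensMap F f (tensMap F g k) := by
  refine NatTrans.ext (funext fun w => NatTrans.ext (funext fun o =>
    ConcreteCategory.hom_ext _ _ fun z => ?_))
  induction z using tensTens.ind with | h p q a c b d e => ?_
  refine congrArg (tens.mk (A := A') (B := tens B' D') (o := F.obj o.unop)
    (p := (Word.map F).obj p) (w := (Word.map F).obj w) ((f.app p).app o a) (c.comp d))
    (funext fun i => ?_)
  refine congrArg (tens.mk (A := B') (B := D') (o := F.obj (p.letter i))
    (p := (Word.map F).obj (q.block c i)) (w := (Word.map F).obj (w.block (c.comp d) i))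
    ((g.app (q.block c i)).app _ (b i)) (c.sub d i)) (funext fun j => ?_)
  refine Eq.trans ?_ (ConcreteCategory.congr_hom (NatTrans.congr_app
    (k.naturality (Word.blockBlock w c d i j)) _) (e (c.index i j))).symm
  exact congrArg (fun v => (D'.map v).app _ ((k.app _).app _ (e (c.index i j))))
    (Word.map_blockBlock F w c d i j).symm

/-! ### Vertical arrows -/

/-- The map `f ⋆ X`. -/
def actLeft {A A' : Profunctor.{u} (Word O) O} (f : A ⟶ A') (X : PSh O) : act A X ⟶ act A' X :=
  actMap (𝟭 O) f (𝟙 X)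

/-- The map `A ⋆ g`. -/
def actRight (A : Profunctor.{u} (Word O) O) {X Y : PSh O} (g : X ⟶ Y) : act A X ⟶ act A Y :=
  actMap (𝟭 O) (𝟙 A) g

/-- The map `f ⊗ g`. -/
def tensHom {A A' B B' : Profunctor.{u} (Word O) O} (f : A ⟶ A') (g : B ⟶ B') :
    tens A B ⟶ tens A' B' :=
  tensMap (𝟭 O) f g

section

variable {A A' A'' B B' D : Profunctor.{u} (Word O) O} {X Y Z : PSh O}

theorem actLeft_id : actLeft (𝟙 A) X = 𝟙 (act A X) :=
  act.hom_ext fun _ _ _ _ => rfl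

theorem actLeft_comp (f : A ⟶ A') (f' : A' ⟶ A'') :
    actLeft (f ≫ f') X = actLeft f X ≫ actLeft f' X :=
  act.hom_ext fun _ _ _ _ => rfl

theorem actRight_id : actRight A (𝟙 X) = 𝟙 (act A X) :=
  act.hom_ext fun _ _ _ _ => rfl

theorem actRight_comp (g : X ⟶ Y) (g' : Y ⟶ Z) :
    actRight A (g ≫ g') = actRight A g ≫ actRight A g' :=
  act.hom_ext fun _ _ _ _ => rfl

/-- On representatives both composites compute to the same element. With the next two lemmas this is
naturality of `actTens` in each variable, which moves coherence diagrams from graphs to presheaves.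
-/
theorem actLeft_actTens (f : A ⟶ A') :
    actLeft (tensHom f (𝟙 B)) X ≫ actTens A' B X = actTens A B X ≫ actLeft f (act B X) :=
  actTens.hom_ext fun _ _ _ _ _ _ _ => rfl

theorem actRight_actTens (g : B ⟶ B') :
    actLeft (tensHom (𝟙 A) g) X ≫ actTens A B' X = actTens A B X ≫ actRight A (actLeft g X) :=
  actTens.hom_ext fun _ _ _ _ _ _ _ => rfl

theorem actTens_actRight (g : X ⟶ Y) :
    actRight (tens A B) g ≫ actTens A B Y = actTens A B X ≫ actRight A (actRight B g) :=
  actTens.hom_ext fun _ _ _ _ _ _ _ => rfl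

/-- The coend relation moves `g` onto the family `x`; as `g` merely renumbers places of one word
`w`, it acts there by identities. -/
theorem act_mk_isCast {o : O} {w : Word O} {n m : ℕ} {k : Fin n → Fin w.len}
    {k' : Fin m → Fin w.len} {g : (⟨n, w.letter ∘ k⟩ : Word O) ⟶ ⟨m, w.letter ∘ k'⟩}
    (hg : Word.IsCast g) (h : ∀ j, k j = k' (Fin.cast g.len_eq j))
    (a : (A.obj ⟨n, w.letter ∘ k⟩).obj (op o)) (x : ∀ i, X.obj (op (w.letter i))) :
    act.mk (A := A) (X := X) (w := ⟨m, w.letter ∘ k'⟩) ((A.map g).app (op o) a) (fun j => x (k' j)) =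
      act.mk (A := A) (X := X) (w := ⟨n, w.letter ∘ k⟩) a fun j => x (k j) := by
  refine (act.sound (A := A) (X := X) g a fun j => x (k' j)).symm.trans ?_
  refine congrArg (act.mk (A := A) (X := X) (w := ⟨n, w.letter ∘ k⟩) a) (funext fun j => ?_)
  obtain ⟨e, he⟩ := hg j
  refine (congrArg (fun f => X.map (Quiver.Hom.op f) (x (k' (Fin.cast g.len_eq j)))) he).trans ?_
  exact psh_map_eqToHom (X := X) w.letter x (h j) _

/-- Once all tensor products are expanded into iterated actions, both composites cut the same family
into the same parts, up to the renumbering `Word.blockBlock`. So the associativity map corresponds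
to the identity of the composite `r(A) r(B) r(D)`. -/
theorem actLeft_tensAssocInv :
    actLeft (tensAssocInv A B D) X ≫ actTens A (tens B D) X ≫ actRight A (actTens B D X) =
      actTens (tens A B) D X ≫ actTens A B (act D X) := by
  refine NatTrans.ext (funext fun o => ConcreteCategory.hom_ext _ _ fun z => ?_)
  induction z using act.ind with | h w z x => ?_
  induction z using tensTens.ind with | h p q a c b d e => ?_
  refine congrArg (act.mk (A := A) (X := act B (act D X)) a) (funext fun i => ?_)
  refine congrArg (act.mk (A := B) (X := act D X) (b i)) (funext fun j => ?_)
  exact act_mk_isCast (A := D) (X := X) (Word.isCast_blockBlock w c d i j)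
    (fun l => (c.index_sub d i j l _ rfl).symm) (e (c.index i j)) x

end

end Associativity

/-! ### Graphs are determined by their actions -/

section Faithful

variable {O Q : Type u} [Category.{u} O] [Category.{u} Q]

open Classical in
/-- The partial inverse of `a ↦ [a, 1]`. -/
noncomputable def actRetract (A : Profunctor.{u} (Word O) O) (w : Word O) (o : O) :
    (act A ((iota O).obj w)).obj (op o) → Option ((A.obj w).obj (op o)) :=
  Ten.lift (A := A.flip.obj (op o)) (P := pow ((iota O).obj w))
    (fun p a (y : ∀ i, Σ k, (p.letter i ⟶ w.letter k)) =>
      -- The condition selects the families `y` that send the `i`-th letter to the `i`-th place of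
      -- `w`. Such a `y` is an arrow of words from `p` to `w`, along which `a` is pushed. Arrows of
      -- words preserve places, so the condition is invariant under the coend relation.
      if h : p.len = w.len ∧ ∀ i, ((y i).1 : ℕ) = i then
        some ((A.map (⟨h.1, fun i => (y i).2 ≫ eqToHom (congrArg w.letter (Fin.ext (h.2 i)))⟩ :
          Word.Hom p w)).app (op o) a)
      else none)
    (fun {p p'} v a (y : ∀ i, Σ k, (p'.letter i ⟶ w.letter k)) => by
      obtain ⟨n, l⟩ := p
      obtain ⟨n', l'⟩ := p'
      obtain ⟨e, v⟩ := v
      dsimp only at e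
      subst e
      by_cases h : n = w.len ∧ ∀ i, ((y i).1 : ℕ) = i
      · refine (dif_pos h).trans (Eq.trans ?_ (dif_pos h).symm)
        refine congrArg some (Eq.trans ?_ (profunctor_map_comp (w := ⟨n, l⟩) (w' := ⟨n, l'⟩)
          ⟨rfl, v⟩ ⟨h.1, fun i => (y i).2 ≫ eqToHom (congrArg w.letter (Fin.ext (h.2 i)))⟩ a))
        refine congrArg (fun f => (A.map f).app (op o) a) (Word.Hom.ext fun i => ?_)
        exact Category.assoc (v i) (y i).2 _
      · exact Eq.trans (b := none) (dif_neg h) (Eq.symm (dif_neg h)))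

theorem actRetract_gen (A : Profunctor.{u} (Word O) O) {w : Word O} {o : O}
    (a : (A.obj w).obj (op o)) :
    actRetract A w o (act.mk (X := (iota O).obj w) a (iotaGen w)) = some a := by
  refine (dif_pos (⟨rfl, fun _ => rfl⟩ : w.len = w.len ∧ ∀ i : Fin w.len, (i : ℕ) = i)).trans ?_
  refine congrArg some (Eq.trans ?_ (profunctor_map_id a))
  exact congrArg (fun f => (A.map f).app (op o) a) (Word.Hom.ext fun i => Category.comp_id _)

/-- A map of graphs changes `a` and leaves `y` alone, so it does not affect which branch is taken;
in the first branch naturality of `f` applies. -/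
theorem actRetract_actLeft {A B : Profunctor.{u} (Word O) O} (f : A ⟶ B) {w : Word O} {o : O}
    (z : (act A ((iota O).obj w)).obj (op o)) :
    actRetract B w o ((actLeft f ((iota O).obj w)).app (op o) z) =
      (actRetract A w o z).map ((f.app w).app (op o)) := by
  induction z using act.ind with | h p a y => ?_
  change ∀ i, Σ k, (p.letter i ⟶ w.letter k) at y
  by_cases h : p.len = w.len ∧ ∀ i, ((y i).1 : ℕ) = i
  · refine (dif_pos h).trans (Eq.trans ?_ (congrArg (Option.map _) (dif_pos h).symm))
    exact congrArg some (ConcreteCategory.congr_hom (NatTrans.congr_app (f.naturality _) _) a).symm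
  · have e : actRetract A w o (act.mk (X := (iota O).obj w) a y) = none := dif_neg h
    exact Eq.trans (b := none) (dif_neg h) (congrArg (Option.map _) e).symm

theorem act_gen_injective (A : Profunctor.{u} (Word O) O) (w : Word O) (o : O) :
    Function.Injective fun a : (A.obj w).obj (op o) =>
      act.mk (X := (iota O).obj w) a (iotaGen w) := fun a a' h =>
  Option.some_injective _
    ((actRetract_gen A a).symm.trans ((congrArg (actRetract A w o) h).trans (actRetract_gen A a')))

/-- Evaluating at `X = ι(w)` on the elements `[a, 1]` recovers the map, by `act_gen_injective`. This
is the faithfulness of `r` on fibres. -/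
theorem hom_ext_of_actLeft {A B : Profunctor.{u} (Word O) O} {f g : A ⟶ B}
    (h : ∀ X, actLeft f X = actLeft g X) : f = g :=
  NatTrans.ext (funext fun w => NatTrans.ext (funext fun o => ConcreteCategory.hom_ext _ _ fun a =>
    act_gen_injective B w o.unop (ConcreteCategory.congr_hom
      (NatTrans.congr_app (h ((iota O).obj w)) o)
      (act.mk (X := (iota O).obj w) (o := o.unop) a (iotaGen w)))))

theorem bijective_of_actLeft {A B : Profunctor.{u} (Word O) O} (f : A ⟶ B)
    (h : ∀ (X : PSh O) (o : O), Function.Bijective ((actLeft f X).app (op o))) (w : Word O) (o : O) :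
    Function.Bijective ((f.app w).app (op o)) := by
  constructor
  · intro a a' e
    refine act_gen_injective A w o ((h _ o).1 ?_)
    exact congrArg (fun b => act.mk (X := (iota O).obj w) b (iotaGen w)) e
  · intro b
    -- A preimage `z` of `[b, 1]` need not be of the form `[a, 1]`; but the retraction is natural
    -- and defined on `[b, 1]`, so it is defined on `z` and gives an `a` over `b`.
    obtain ⟨z, hz⟩ := (h ((iota O).obj w) o).2 (act.mk b (iotaGen w))
    have := actRetract_actLeft f z
    rw [hz, actRetract_gen] at this
    obtain ⟨a, -, ha⟩ := Option.map_eq_some_iff.1 this.symm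
    exact ⟨a, ha⟩

end Faithful

/-! ### The units of the tensor product -/

namespace Word

/-- The cut into one part. -/
def cutOne (m : ℕ) : Cut 1 m where
  pos i := i * m
  mono _ _ h := Nat.mul_le_mul_right m h
  pos_zero := Nat.zero_mul m
  pos_last := Nat.one_mul m

/-- The cut into parts of length one. -/
def cutId (n : ℕ) : Cut n n where
  pos i := i
  mono _ _ h := h
  pos_zero := rfl
  pos_last := rfl

theorem cutOne_index {m : ℕ} (i : Fin 1) (j : Fin ((cutOne m).pos i.succ - (cutOne m).pos i.castSucc))
    (j' : Fin m) (h : (j : ℕ) = j') : (cutOne m).index i j = j' := by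
  refine Fin.ext ?_
  obtain rfl : i = 0 := Subsingleton.elim _ _
  change 0 * m + (j : ℕ) = j'
  omega

theorem cutId_index {n : ℕ} (i : Fin n) (j : Fin ((cutId n).pos i.succ - (cutId n).pos i.castSucc)) :
    (cutId n).index i j = i := by
  refine Fin.ext ?_
  have h : (cutId n).pos i.succ - (cutId n).pos i.castSucc = 1 := Nat.add_sub_cancel_left (i : ℕ) 1
  have := j.2
  change (i : ℕ) + j = i
  omega

variable {O : Type u} [Category.{u} O] {Q : Type u} [Category.{u} Q]

/-- A word as its only part. -/
def whole (w : Word O) (i : Fin 1) : w ⟶ w.block (cutOne w.len) i where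
  len_eq := by
    obtain rfl : i = 0 := Subsingleton.elim _ _
    change w.len = 1 * w.len - 0 * w.len
    omega
  app j := eqToHom (congrArg w.letter (cutOne_index i _ j rfl).symm)

theorem isCast_whole (w : Word O) (i : Fin 1) : IsCast (whole w i) :=
  fun j => ⟨congrArg w.letter (cutOne_index i _ j rfl).symm, rfl⟩

/-- A letter of a word as a part of it. -/
def single (w : Word O) (i : Fin w.len) :
    (Word.unit O).obj (w.letter i) ⟶ w.block (cutId w.len) i where
  len_eq := (Nat.add_sub_cancel_left (i : ℕ) 1).symm
  app _ := eqToHom (congrArg w.letter (cutId_index i _).symm)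

theorem isCast_single (w : Word O) (i : Fin w.len) : IsCast (single w i) :=
  fun _ => ⟨congrArg w.letter (cutId_index i _).symm, rfl⟩

theorem single_naturality {w w' : Word O} (g : w ⟶ w') (i : Fin w.len) :
    (Word.unit O).map (g.app i) ≫ single w' (Fin.cast g.len_eq i) =
      single w i ≫ blockMap g (cutId w.len) i :=
  Hom.ext fun _ => hom_app_eqToHom g (cutId_index i _).symm

theorem whole_naturality {n : ℕ} {l l' : Fin n → O} (g : (⟨n, l⟩ : Word O) ⟶ ⟨n, l'⟩) (i : Fin 1) :
    g ≫ whole ⟨n, l'⟩ i = whole ⟨n, l⟩ i ≫ blockMap g (cutOne n) i :=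
  Hom.ext fun j => hom_app_eqToHom g (cutOne_index i _ j rfl).symm

end Word

section Units

variable {O Q : Type u} [Category.{u} O] [Category.{u} Q]

/-- The unit graph. -/
abbrev unitGraph (O : Type u) [Category.{u} O] : Profunctor.{u} (Word O) O :=
  (Word.unit O).toProfunctorRev

/-- The map `a ↦ [1, a]`. -/
def tensUnitLeftInv (A : Profunctor.{u} (Word O) O) : A ⟶ tens (unitGraph O) A where
  app w :=
    { app := fun o => ↾fun a => tens.mk (A := unitGraph O) (o := o.unop)
        (𝟙 ((Word.unit O).obj o.unop)) (Word.cutOne w.len)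
        fun i => (A.map (Word.whole w i)).app o a
      naturality := fun o o' f => by
        refine ConcreteCategory.hom_ext _ _ fun a => ?_
        -- The coend relation over one-letter words moves `f` from the family of restrictions of `a`
        -- to the identity in the unit graph.
        have h := tens.sound (A := unitGraph O) (B := A) (o := o'.unop)
          ((Word.unit O).map f.unop) (𝟙 ((Word.unit O).obj o'.unop)) (Word.cutOne w.len)
          fun i => (A.map (Word.whole w i)).app o a
        refine Eq.trans ?_ (h.trans ?_)
        · exact congrArg (tens.mk (A := unitGraph O) (B := A) (o := o'.unop)
            (𝟙 ((Word.unit O).obj o'.unop)) (Word.cutOne w.len)) (funext fun i =>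
              profunctor_map_map ..)
        · exact congrArg (fun e => tens.mk (A := unitGraph O) (B := A) (o := o'.unop)
            (p := (Word.unit O).obj o.unop) e (Word.cutOne w.len)
            fun i => (A.map (Word.whole w i)).app o a)
            ((Category.id_comp ((Word.unit O).map f.unop)).trans
              (Category.comp_id ((Word.unit O).map f.unop)).symm) }
  naturality w w' g := by
    refine NatTrans.ext (funext fun o => ConcreteCategory.hom_ext _ _ fun a => ?_)
    obtain ⟨n, l⟩ := w
    obtain ⟨n', l'⟩ := w'
    obtain ⟨h, g⟩ := g
    dsimp only at h
    subst h
    refine congrArg (tens.mk (A := unitGraph O) (B := A) (o := o.unop) (w := ⟨n, l'⟩)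
      (𝟙 ((Word.unit O).obj o.unop)) (Word.cutOne n)) (funext fun i => ?_)
    refine (profunctor_map_comp _ _ _).symm.trans (Eq.trans ?_ (profunctor_map_comp _ _ _))
    exact congrArg (fun f => (A.map f).app o a)
      (Word.whole_naturality (⟨rfl, g⟩ : (⟨n, l⟩ : Word O) ⟶ ⟨n, l'⟩) i)

/-- The map `a ↦ [a, (1, …, 1)]`. -/
def tensUnitRightInv (A : Profunctor.{u} (Word O) O) : A ⟶ tens A (unitGraph O) where
  app w :=
    { app := fun o => ↾fun a => tens.mk (B := unitGraph O) (o := o.unop) a (Word.cutId w.len)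
        fun i => Word.single w i
      naturality := fun _ _ _ => rfl }
  naturality w w' g := by
    refine NatTrans.ext (funext fun o => ConcreteCategory.hom_ext _ _ fun a => ?_)
    refine (tens.sound (A := A) (B := unitGraph O) (o := o.unop) g a (Word.cutId w'.len)
      fun i => Word.single w' i).symm.trans ?_
    obtain ⟨n, l⟩ := w
    obtain ⟨n', l'⟩ := w'
    obtain ⟨h, g⟩ := g
    dsimp only at h
    subst h
    exact congrArg (tens.mk (A := A) (B := unitGraph O) (o := o.unop) (w := ⟨n, l'⟩) a
      (Word.cutId n)) (funext fun i =>
        Word.single_naturality (⟨rfl, g⟩ : (⟨n, l⟩ : Word O) ⟶ ⟨n, l'⟩) i)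

/-- The map `x ↦ [1, x]`. -/
def actUnit (X : PSh O) : X ⟶ act (unitGraph O) X where
  app o := ↾fun x => act.mk (A := unitGraph O) (o := o.unop) (𝟙 ((Word.unit O).obj o.unop))
    fun _ => x
  naturality o o' f := by
    refine ConcreteCategory.hom_ext _ _ fun x => ?_
    refine (act.sound (A := unitGraph O) (X := X) (o := o'.unop) ((Word.unit O).map f.unop)
      (𝟙 ((Word.unit O).obj o'.unop)) fun _ => x).trans ?_
    exact congrArg (fun e => act.mk (A := unitGraph O) (X := X) (o := o'.unop)
      (w := (Word.unit O).obj o.unop) e fun _ => x)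
      ((Category.id_comp ((Word.unit O).map f.unop)).trans
        (Category.comp_id ((Word.unit O).map f.unop)).symm)

/-- An element of `I(o; w)` is an arrow `f` from the one-letter word, so `w` has a single letter and
`[f, x]` equals `[1, x']`, where `x'` is the restriction of `x` along `f`. -/
theorem actUnit_bijective (X : PSh O) (o : O) : Function.Bijective ((actUnit X).app (op o)) := by
  refine Function.bijective_iff_has_inverse.2 ⟨Ten.lift (A := (unitGraph O).flip.obj (op o))
    (P := pow X) (fun w f x => X.map (Word.Hom.app f (0 : Fin 1)).op (x (Fin.cast (Word.Hom.len_eq f) (0 : Fin 1))))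
    (fun v f x => ?_), fun x => psh_map_id x, fun z => ?_⟩
  · exact (psh_map_comp (X := X) (Word.Hom.app f (0 : Fin 1)) (v.app _) _).symm
  · induction z using act.ind with | h w f x => ?_
    refine Eq.trans ?_ ((act.sound (A := unitGraph O) (X := X) (o := o) f
      (𝟙 ((Word.unit O).obj o)) x).trans ?_)
    · refine congrArg (act.mk (A := unitGraph O) (X := X) (o := o) (𝟙 ((Word.unit O).obj o)))
        (funext fun i => ?_)
      obtain rfl : i = 0 := Subsingleton.elim (α := Fin 1) _ _
      rfl
    · exact congrArg (fun e => act.mk (A := unitGraph O) (X := X) (o := o) e x)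
        (Category.id_comp (X := (Word.unit O).obj o) f)

/-- Cutting into a single part and acting returns the same element up to `Word.whole`, made of
identities. This equation and the next determine the unit maps by their actions. -/
theorem actLeft_tensUnitLeftInv {A : Profunctor.{u} (Word O) O} {X : PSh O} :
    actLeft (tensUnitLeftInv A) X ≫ actTens (unitGraph O) A X = actUnit (act A X) := by
  refine act.hom_ext fun o w a x => ?_
  refine congrArg (act.mk (A := unitGraph O) (X := act A X) (o := o)
    (𝟙 ((Word.unit O).obj o))) (funext fun i => ?_)
  exact act_mk_isCast (A := A) (X := X) (k := id) (Word.isCast_whole w i)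
    (fun j => (Word.cutOne_index i _ j rfl).symm) a x

theorem actLeft_tensUnitRightInv {A : Profunctor.{u} (Word O) O} {X : PSh O} :
    actLeft (tensUnitRightInv A) X ≫ actTens A (unitGraph O) X = actRight A (actUnit X) := by
  refine act.hom_ext fun o w a x => ?_
  refine congrArg (act.mk (A := A) (X := act (unitGraph O) X) (o := o) a) (funext fun i => ?_)
  refine Eq.trans ?_ (act_mk_isCast (A := unitGraph O) (X := X) (k := fun _ : Fin 1 => i)
    (Word.isCast_single w i) (fun j => (Word.cutId_index i _).symm)
    (𝟙 ((Word.unit O).obj (w.letter i))) x)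
  exact congrArg (fun e => act.mk (A := unitGraph O) (X := X)
    (w := w.block (Word.cutId w.len) i) e fun j => x ((Word.cutId w.len).index i j))
    (Category.id_comp (Word.single w i)).symm

/-- The map of unit graphs given by a functor. -/
abbrev unitGraphMap (F : O ⥤ Q) : unitGraph O ⟶ Word.map F ⋙ unitGraph Q ⋙ reindex F :=
  gphUnit.{u}.map (u := (F.toCatHom : Cat.of O ⟶ Cat.of Q)) (x := ⟨⟩) (y := ⟨⟩) ⟨⟩

theorem tensUnitLeftInv_naturality (F : O ⥤ Q) {A : Profunctor.{u} (Word O) O}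
    {B : Profunctor.{u} (Word Q) Q} (f : A ⟶ Word.map F ⋙ B ⋙ reindex F) :
    f ≫ Functor.whiskerLeft (Word.map F)
        (Functor.whiskerRight (tensUnitLeftInv B) (reindex F)) =
      tensUnitLeftInv A ≫ tensMap F (unitGraphMap F) f := by
  refine NatTrans.ext (funext fun w => NatTrans.ext (funext fun o =>
    ConcreteCategory.hom_ext _ _ fun a => ?_))
  refine Eq.trans ?_ (congrArg (fun e => tens.mk (A := unitGraph Q) (B := B) (o := F.obj o.unop)
    (p := (Word.unit Q).obj (F.obj o.unop)) (w := (Word.map F).obj w) e (Word.cutOne w.len)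
    fun i => (f.app _).app o ((A.map (Word.whole w i)).app o a))
    ((Word.map F).map_id ((Word.unit O).obj o.unop)).symm)
  refine congrArg (tens.mk (A := unitGraph Q) (B := B) (o := F.obj o.unop)
    (p := (Word.unit Q).obj (F.obj o.unop)) (w := (Word.map F).obj w)
    (𝟙 ((Word.unit Q).obj (F.obj o.unop))) (Word.cutOne w.len)) (funext fun i => ?_)
  refine Eq.trans ?_ (ConcreteCategory.congr_hom (NatTrans.congr_app
    (f.naturality (Word.whole w i)) o) a).symm
  exact congrArg (fun v => (B.map v).app _ ((f.app w).app o a))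
    ((Word.isCast_whole ((Word.map F).obj w) i).eq ((Word.isCast_whole w i).map F))

theorem tensUnitRightInv_naturality (F : O ⥤ Q) {A : Profunctor.{u} (Word O) O}
    {B : Profunctor.{u} (Word Q) Q} (f : A ⟶ Word.map F ⋙ B ⋙ reindex F) :
    f ≫ Functor.whiskerLeft (Word.map F)
        (Functor.whiskerRight (tensUnitRightInv B) (reindex F)) =
      tensUnitRightInv A ≫ tensMap F f (unitGraphMap F) := by
  refine NatTrans.ext (funext fun w => NatTrans.ext (funext fun o =>
    ConcreteCategory.hom_ext _ _ fun a => ?_))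
  exact congrArg (tens.mk (A := B) (B := unitGraph Q) (o := F.obj o.unop)
    (p := (Word.map F).obj w) (w := (Word.map F).obj w) ((f.app w).app o a) (Word.cutId w.len))
    (funext fun i => (Word.isCast_single ((Word.map F).obj w) i).eq
      ((Word.isCast_single w i).map F))

theorem actUnit_naturality (F : O ⥤ Q) {X : PSh O} {Y : PSh Q} (f : X ⟶ (reindex F).obj Y) :
    f ≫ (reindex F).map (actUnit Y) = actUnit X ≫ actMap F (unitGraphMap F) f := by
  refine NatTrans.ext (funext fun o => ConcreteCategory.hom_ext _ _ fun x => ?_)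
  exact congrArg (fun e => act.mk (A := unitGraph Q) (X := Y) (o := F.obj o.unop)
    (w := (Word.unit Q).obj (F.obj o.unop)) e fun _ => f.app o x)
    ((Word.map F).map_id ((Word.unit O).obj o.unop)).symm

end Units

/-! ### Invertibility -/

section Invertibility

variable {O : Type u} [Category.{u} O]

theorem psh_isIso_of_bijective {X Y : PSh O} (f : X ⟶ Y)
    (h : ∀ o : O, Function.Bijective (f.app (op o))) : IsIso f :=
  (NatTrans.isIso_iff_isIso_app f).2 fun o => (isIso_iff_bijective (f.app o)).2 (h o.unop)

theorem psh_bijective_of_isIso {X Y : PSh O} (f : X ⟶ Y) [IsIso f] (o : O) :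
    Function.Bijective (f.app (op o)) :=
  (isIso_iff_bijective (f.app (op o))).1 inferInstance

theorem isIso_of_actLeft {A B : Profunctor.{u} (Word O) O} (f : A ⟶ B)
    (h : ∀ X : PSh O, IsIso (actLeft f X)) : IsIso f := by
  refine (NatTrans.isIso_iff_isIso_app f).2 fun w => psh_isIso_of_bijective _ fun o => ?_
  refine bijective_of_actLeft f (fun X o => ?_) w o
  have := h X
  exact psh_bijective_of_isIso _ o

variable (A B D E : Profunctor.{u} (Word O) O) (X : PSh O)

instance isIso_actTens : IsIso (actTens A B X) :=
  psh_isIso_of_bijective _ (actTens_bijective A B X)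

instance isIso_actUnit : IsIso (actUnit X) :=
  psh_isIso_of_bijective _ (actUnit_bijective X)

instance isIso_actRight {X Y : PSh O} (g : X ⟶ Y) [IsIso g] : IsIso (actRight A g) :=
  ⟨actRight A (inv g), by rw [← actRight_comp, IsIso.hom_inv_id, actRight_id],
    by rw [← actRight_comp, IsIso.inv_hom_id, actRight_id]⟩

instance isIso_actLeft {A B : Profunctor.{u} (Word O) O} (f : A ⟶ B) [IsIso f] :
    IsIso (actLeft f X) :=
  ⟨actLeft (inv f) X, by rw [← actLeft_comp, IsIso.hom_inv_id, actLeft_id],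
    by rw [← actLeft_comp, IsIso.inv_hom_id, actLeft_id]⟩

theorem inv_actRight {X Y : PSh O} (g : X ⟶ Y) [IsIso g] :
    inv (actRight A g) = actRight A (inv g) :=
  IsIso.inv_eq_of_hom_inv_id (by rw [← actRight_comp, IsIso.hom_inv_id, actRight_id])

theorem inv_actLeft {A B : Profunctor.{u} (Word O) O} (f : A ⟶ B) [IsIso f] :
    inv (actLeft f X) = actLeft (inv f) X :=
  IsIso.inv_eq_of_hom_inv_id (by rw [← actLeft_comp, IsIso.hom_inv_id, actLeft_id])

/-- For every `X` its action is a factor of an invertible composite whose other factor is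
invertible, and acting on all presheaves reflects isomorphisms. -/
instance isIso_tensAssocInv : IsIso (tensAssocInv A B D) :=
  isIso_of_actLeft _ fun X => by
    have : IsIso (actLeft (tensAssocInv A B D) X ≫
        actTens A (tens B D) X ≫ actRight A (actTens B D X)) := by
      rw [actLeft_tensAssocInv]
      infer_instance
    exact IsIso.of_isIso_comp_right _ (actTens A (tens B D) X ≫ actRight A (actTens B D X))

instance isIso_tensUnitLeftInv : IsIso (tensUnitLeftInv A) :=
  isIso_of_actLeft _ fun X => by
    have : IsIso (actLeft (tensUnitLeftInv A) X ≫ actTens (unitGraph O) A X) := by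
      rw [actLeft_tensUnitLeftInv]
      infer_instance
    exact IsIso.of_isIso_comp_right _ (actTens (unitGraph O) A X)

instance isIso_tensUnitRightInv : IsIso (tensUnitRightInv A) :=
  isIso_of_actLeft _ fun X => by
    have : IsIso (actLeft (tensUnitRightInv A) X ≫ actTens A (unitGraph O) X) := by
      rw [actLeft_tensUnitRightInv]
      infer_instance
    exact IsIso.of_isIso_comp_right _ (actTens A (unitGraph O) X)

/-! ### Coherence -/

theorem tensHom_id : tensHom (𝟙 A) (𝟙 B) = 𝟙 (tens A B) :=
  tens.hom_ext fun _ _ _ _ _ _ => rfl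

theorem tensHom_comp {A A' A'' B B' B'' : Profunctor.{u} (Word O) O} (f : A ⟶ A') (f' : A' ⟶ A'')
    (g : B ⟶ B') (g' : B' ⟶ B'') :
    tensHom (f ≫ f') (g ≫ g') = tensHom f g ≫ tensHom f' g' :=
  tens.hom_ext fun _ _ _ _ _ _ => rfl

/-- By faithfulness it suffices to compare the actions on `X`. After the isomorphism onto the
fourfold action on `X`, both sides become the direct expansion of `((A ⊗ B) ⊗ D) ⊗ E`. -/
theorem pentagonInv :
    tensHom (tensAssocInv A B D) (𝟙 E) ≫ tensAssocInv A (tens B D) E ≫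
        tensHom (𝟙 A) (tensAssocInv B D E) =
      tensAssocInv (tens A B) D E ≫ tensAssocInv A B (tens D E) := by
  refine hom_ext_of_actLeft fun X => ?_
  rw [← cancel_mono (actTens A (tens B (tens D E)) X ≫ actRight A (actTens B (tens D E) X) ≫
    actRight A (actRight B (actTens D E X)))]
  trans actTens (tens (tens A B) D) E X ≫ actTens (tens A B) D (act E X) ≫
    actTens A B (act D (act E X))
  · simp only [actLeft_comp, Category.assoc]
    rw [reassoc_of% (actRight_actTens (A := A) (X := X) (tensAssocInv B D E)),
      ← actRight_comp, ← actRight_comp, actLeft_tensAssocInv (A := B), actRight_comp,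
      reassoc_of% (actLeft_tensAssocInv (A := A) (B := tens B D) (D := E) (X := X)),
      reassoc_of% (actLeft_actTens (B := E) (X := X) (tensAssocInv A B D)),
      actLeft_tensAssocInv]
  · simp only [actLeft_comp, Category.assoc]
    rw [reassoc_of% (actLeft_tensAssocInv (A := A) (B := B) (D := tens D E) (X := X)),
      ← actTens_actRight, reassoc_of% (actLeft_tensAssocInv (A := tens A B) (B := D) (D := E)
        (X := X))]

/-- Again on actions: after expansion both sides insert `actUnit` between `A` and `B`. -/
theorem triangleInv :
    tensHom (tensUnitRightInv A) (𝟙 B) ≫ tensAssocInv A (unitGraph O) B =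
      tensHom (𝟙 A) (tensUnitLeftInv B) := by
  refine hom_ext_of_actLeft fun X => ?_
  rw [← cancel_mono (actTens A (tens (unitGraph O) B) X ≫ actRight A (actTens (unitGraph O) B X)),
    actLeft_comp, Category.assoc, actLeft_tensAssocInv,
    reassoc_of% (actLeft_actTens (B := B) (X := X) (tensUnitRightInv A)),
    actLeft_tensUnitRightInv,
    reassoc_of% (actRight_actTens (A := A) (X := X) (tensUnitLeftInv B)), ← actRight_comp,
    actLeft_tensUnitLeftInv]

/-- A monoidal object has its associativity in the direction opposite to `tensAssocInv`; this is
`pentagonInv` with every arrow inverted. -/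
theorem tens_pentagon :
    (tensHom (𝟙 A) (inv (tensAssocInv B D E)) ≫ inv (tensAssocInv A (tens B D) E)) ≫
        tensHom (inv (tensAssocInv A B D)) (𝟙 E) =
      inv (tensAssocInv A B (tens D E)) ≫ inv (tensAssocInv (tens A B) D E) := by
  rw [← cancel_mono (tensAssocInv (tens A B) D E ≫ tensAssocInv A B (tens D E)), ← pentagonInv,
    Category.assoc, Category.assoc, ← Category.assoc (tensHom (inv _) _), ← tensHom_comp,
    IsIso.inv_hom_id, Category.id_comp, tensHom_id, Category.id_comp, IsIso.inv_hom_id_assoc,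
    ← tensHom_comp, IsIso.inv_hom_id, Category.id_comp, tensHom_id, pentagonInv]
  simp

theorem tens_triangle :
    inv (tensAssocInv A (unitGraph O) B) ≫ tensHom (inv (tensUnitRightInv A)) (𝟙 B) =
      tensHom (𝟙 A) (inv (tensUnitLeftInv B)) := by
  rw [IsIso.inv_comp_eq]
  have h : tensHom (𝟙 A) (tensUnitLeftInv B) ≫ tensHom (𝟙 A) (inv (tensUnitLeftInv B)) =
      𝟙 (tens A B) := by
    rw [← tensHom_comp, IsIso.hom_inv_id, Category.id_comp, tensHom_id]
  rw [← triangleInv, Category.assoc] at h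
  have h' : tensHom (inv (tensUnitRightInv A)) (𝟙 B) ≫ tensHom (tensUnitRightInv A) (𝟙 B) =
      𝟙 (tens (tens A (unitGraph O)) B) := by
    rw [← tensHom_comp, IsIso.inv_hom_id, Category.id_comp, tensHom_id]
  have := congrArg (tensHom (inv (tensUnitRightInv A)) (𝟙 B) ≫ ·) h
  rw [reassoc_of% h', Category.comp_id] at this
  exact this.symm

end Invertibility

/-! ### The monoidal structure -/

/-- A 2-cell with invertible components is invertible. -/
def CatOver.TwoCell.isoOfApp {S : Type u₁} [Category.{v₁} S] {C : CatOver.{w, v} S}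
    {D : CatOver.{w', v'} S} {F G : CatOver.OneCell C D} (σ : F ⟶ G)
    (τ : ∀ {a : S} (x : C.Ob a), D.Hom (𝟙 a) (G.obj x) (F.obj x))
    (h : ∀ {a : S} (x : C.Ob a), D.vcomp (TwoCell.app σ x) (τ x) = D.id _)
    (h' : ∀ {a : S} (x : C.Ob a), D.vcomp (τ x) (TwoCell.app σ x) = D.id _) : F ≅ G where
  hom := σ
  inv := ⟨τ, fun {a b u x y} f => by
    have n := TwoCell.naturality σ f
    dsimp only [vcomp] at h h'
    -- Insert `τ x` followed by `σ x` in front, pass `σ` across the arrow by naturality, and cancel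
    -- it against `τ y`.
    calc D.comp (Category.comp_id u) (G.map f) (τ y)
        = D.comp (Category.comp_id u) (D.comp (Category.id_comp u) (D.comp (Category.id_comp _) (τ x)
            (TwoCell.app σ x)) (G.map f)) (τ y) := by rw [h', D.id_comp]
      _ = D.comp (Category.id_comp u) (τ x) (D.comp (Category.comp_id u)
            (D.comp (Category.comp_id u) (F.map f) (TwoCell.app σ y)) (τ y)) := by
          rw [n, D.assoc (Category.id_comp _) (Category.id_comp u) (Category.id_comp u)
            (Category.id_comp u), D.assoc]
      _ = D.comp (Category.id_comp u) (τ x) (F.map f) := by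
          rw [D.assoc (Category.comp_id u) (Category.comp_id u) (Category.comp_id _)
            (Category.comp_id u), h, D.comp_id]⟩
  hom_inv_id := TwoCell.ext (funext fun _ => funext fun x => h x)
  inv_hom_id := TwoCell.ext (funext fun _ => funext fun x => h' x)

section

variable {O : Type u} [Category.{u} O] (A B D : Profunctor.{u} (Word O) O) (X : PSh O)

/-- The isomorphism `(A ⊗ B) ⊗ D ≅ A ⊗ (B ⊗ D)`. -/
noncomputable def tensAssocIso : tens (tens A B) D ≅ tens A (tens B D) :=
  asIso (tensAssocInv A B D)

/-- The isomorphism `A ≅ I ⊗ A`. -/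
noncomputable def tensUnitLeftIso : A ≅ tens (unitGraph O) A :=
  asIso (tensUnitLeftInv A)

/-- The isomorphism `A ≅ A ⊗ I`. -/
noncomputable def tensUnitRightIso : A ≅ tens A (unitGraph O) :=
  asIso (tensUnitRightInv A)

/-- The isomorphism `(A ⊗ B) ⋆ X ≅ A ⋆ (B ⋆ X)`. -/
noncomputable def actTensIso : act (tens A B) X ≅ act A (act B X) :=
  asIso (actTens A B X)

/-- The isomorphism `X ≅ I ⋆ X`. -/
noncomputable def actUnitIso : X ≅ act (unitGraph O) X :=
  asIso (actUnit X)

end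

section

variable {O : Cat.{u, u}} {A B : Profunctor.{u} (Word O) O} (e : A ≅ B)

theorem gph_hom_inv_id :
    Gph.{u}.vcomp (a := O) (x := A) (y := B) (z := A) e.hom e.inv = Gph.{u}.id (a := O) A :=
  e.hom_inv_id

theorem gph_inv_hom_id :
    Gph.{u}.vcomp (a := O) (x := B) (y := A) (z := B) e.inv e.hom = Gph.{u}.id (a := O) B :=
  e.inv_hom_id

end

/-- The associativity of the tensor product of graphs. -/
noncomputable def gphAssoc :
    CatOver.tensorLeft gphTensor.{u} ≅ CatOver.tensorRight gphTensor.{u} :=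
  CatOver.TwoCell.isoOfApp
    ⟨fun x => (tensAssocIso x.1 x.2.1 x.2.2).hom, fun {_ _ u _ _} f =>
      tensAssocInv_naturality u.toFunctor f.1 f.2.1 f.2.2⟩
    (fun x => (tensAssocIso x.1 x.2.1 x.2.2).inv)
    (fun x => gph_hom_inv_id (tensAssocIso x.1 x.2.1 x.2.2))
    (fun x => gph_inv_hom_id (tensAssocIso x.1 x.2.1 x.2.2))

/-- The left unit of the tensor product of graphs. -/
noncomputable def gphLeftUnit :
    CatOver.OneCell.id Gph.{u} ≅ CatOver.unitTensor gphTensor.{u} gphUnit.{u} :=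
  CatOver.TwoCell.isoOfApp
    ⟨fun x => (tensUnitLeftIso x).hom, fun {_ _ u _ _} f => tensUnitLeftInv_naturality u.toFunctor f⟩
    (fun x => (tensUnitLeftIso x).inv) (fun x => gph_hom_inv_id (tensUnitLeftIso x))
    (fun x => gph_inv_hom_id (tensUnitLeftIso x))

/-- The right unit of the tensor product of graphs. -/
noncomputable def gphRightUnit :
    CatOver.OneCell.id Gph.{u} ≅ CatOver.tensorUnit gphTensor.{u} gphUnit.{u} :=
  CatOver.TwoCell.isoOfApp
    ⟨fun x => (tensUnitRightIso x).hom, fun {_ _ u _ _} f => tensUnitRightInv_naturality u.toFunctor f⟩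
    (fun x => (tensUnitRightIso x).inv) (fun x => gph_hom_inv_id (tensUnitRightIso x))
    (fun x => gph_inv_hom_id (tensUnitRightIso x))

section

variable {O : Cat.{u, u}} (A B D E : Profunctor.{u} (Word O) O)

/-- A map of graphs over `O` as a vertical arrow. -/
abbrev Gph.vert {O : Cat.{u, u}} {A B : Profunctor.{u} (Word O) O} (f : A ⟶ B) :
    Gph.{u}.Hom (𝟙 O) A B :=
  f

theorem gph_pentagon :
    Gph.{u}.vcomp (Gph.{u}.vcomp
        (gphTensor.{u}.map (CatOver.pair (Gph.id A) (Gph.vert (tensAssocIso B D E).inv)))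
        (Gph.vert (tensAssocIso A (tens B D) E).inv))
      (gphTensor.{u}.map (CatOver.pair (Gph.vert (tensAssocIso A B D).inv) (Gph.id E))) =
    Gph.{u}.vcomp (Gph.vert (tensAssocIso A B (tens D E)).inv)
      (Gph.vert (tensAssocIso (tens A B) D E).inv) :=
  tens_pentagon A B D E

theorem gph_triangle :
    Gph.{u}.vcomp (Gph.vert (tensAssocIso A (unitGraph O) B).inv)
      (gphTensor.{u}.map (CatOver.pair (Gph.vert (tensUnitRightIso A).inv) (Gph.id B))) =
    gphTensor.{u}.map (CatOver.pair (Gph.id A) (Gph.vert (tensUnitLeftIso B).inv)) :=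
  tens_triangle A B

end

/-- The monoidal structure on the graphs. -/
noncomputable def gphMonoidal : CatOver.MonoidalStr gphTensor.{u} gphUnit.{u} where
  α := gphAssoc.symm
  lam := gphLeftUnit.symm
  ρ := gphRightUnit.symm
  pentagon x y z t := gph_pentagon x y z t
  triangle x y := gph_triangle x y

/-! ### The representation is strong monoidal -/

section

variable {O : Type u} [Category.{u} O]

/-- The isomorphism `r(A ⊗ B) ≅ r(A) r(B)` in a fibre. -/
noncomputable def repTens (A B : Profunctor.{u} (Word O) O) :
    actFun (tens A B) ≅ actFun B ⋙ actFun A :=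
  NatIso.ofComponents (fun X => actTensIso A B X) fun g => actTens_actRight g

/-- The isomorphism `1 ≅ r(I)` in a fibre. -/
noncomputable def repUnitGraph (O : Type u) [Category.{u} O] : 𝟭 (PSh O) ≅ actFun (unitGraph O) :=
  NatIso.ofComponents (fun X => actUnitIso X) fun g =>
    (actUnit_naturality (𝟭 O) g).trans (congrArg (actUnit _ ≫ ·) (act.hom_ext fun _ _ _ _ => rfl))

end

/-- A map of endofunctors as a vertical arrow. -/
abbrev EndDFib.vert {O : Cat.{u, u}} {P H : PSh O ⥤ PSh O} (f : P ⟶ H) :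
    EndDFib.{u}.Hom (𝟙 O) P H :=
  f

section

variable {O : Cat.{u, u}} {P H : PSh O ⥤ PSh O} (e : P ≅ H)

theorem endDFib_hom_inv_id :
    EndDFib.{u}.vcomp (EndDFib.vert e.hom) (EndDFib.vert e.inv) = EndDFib.{u}.id (a := O) P :=
  e.hom_inv_id

theorem endDFib_inv_hom_id :
    EndDFib.{u}.vcomp (EndDFib.vert e.inv) (EndDFib.vert e.hom) = EndDFib.{u}.id (a := O) H :=
  e.inv_hom_id

end

section

variable {O Q : Type u} [Category.{u} O] [Category.{u} Q]

theorem repTens_naturality (F : O ⥤ Q) {A B : Profunctor.{u} (Word O) O}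
    {A' B' : Profunctor.{u} (Word Q) Q} (Y : PSh Q)
    (f : A ⟶ Word.map F ⋙ A' ⋙ reindex F) (g : B ⟶ Word.map F ⋙ B' ⋙ reindex F) :
    actMap F (tensMap F f g) (𝟙 ((reindex F).obj Y)) ≫ (reindex F).map (actTens A' B' Y) =
      actTens A B ((reindex F).obj Y) ≫
        actRight A (actMap F g (𝟙 ((reindex F).obj Y))) ≫ actMap F f (𝟙 ((reindex F).obj (act B' Y))) :=
  actTens.hom_ext fun _ _ _ _ _ _ _ => rfl

end

/-- The isomorphism `r(A ⊗ B) ≅ r(A) r(B)`. -/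
noncomputable def repTensor :
    gphTensor.{u}.comp rep.{u} ≅ (rep.{u}.prodMap rep.{u}).comp endComp.{u} :=
  CatOver.TwoCell.isoOfApp
    ⟨fun x => (repTens x.1 x.2).hom, fun {_ _ u _ _} f =>
      NatTrans.ext (funext fun Y => repTens_naturality u.toFunctor Y f.1 f.2)⟩
    (fun x => (repTens x.1 x.2).inv) (fun x => endDFib_hom_inv_id (repTens x.1 x.2))
    (fun x => endDFib_inv_hom_id (repTens x.1 x.2))

/-- The isomorphism `1 ≅ r(I)`. -/
noncomputable def repOne : endUnit.{u} ≅ gphUnit.{u}.comp rep.{u} :=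
  CatOver.TwoCell.isoOfApp
    ⟨fun {O} _ => (repUnitGraph O).hom, fun {_ _ u _ _} _ => by
      refine NatTrans.ext (funext fun Y => ?_)
      exact actUnit_naturality u.toFunctor (𝟙 ((reindex u.toFunctor).obj Y))⟩
    (fun {O} _ => (repUnitGraph O).inv) (fun {O} _ => endDFib_hom_inv_id (repUnitGraph O))
    (fun {O} _ => endDFib_inv_hom_id (repUnitGraph O))

/-! ### Coherence of the comparison isomorphisms of `r` -/

section

variable {O : Type u} [Category.{u} O] (A B D : Profunctor.{u} (Word O) O) (X : PSh O)

/-- The associativity of composition is an identity, so what remains is the inverse of the equation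
`actLeft_tensAssocInv`. The two unit laws below come in the same way from the actions of the unit
maps. -/
theorem rep_associativity :
    (𝟙 (act A (act B (act D X))) ≫ actRight A (actRight B (𝟙 (act D X))) ≫
        inv (actTens A B (act D X))) ≫ inv (actTens (tens A B) D X) =
      ((actRight A (inv (actTens B D X)) ≫ 𝟙 (act A (act (tens B D) X))) ≫
        inv (actTens A (tens B D) X)) ≫ actLeft (inv (tensAssocInv A B D)) X := by
  rw [actRight_id, actRight_id, Category.id_comp, Category.id_comp, Category.comp_id,
    ← IsIso.inv_comp]
  simp only [← actLeft_tensAssocInv, IsIso.inv_comp, inv_actRight, inv_actLeft]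

theorem rep_left_unitality :
    ((𝟙 (act A X) ≫ actUnit (act A X)) ≫ inv (actTens (unitGraph O) A X)) ≫
      actLeft (inv (tensUnitLeftInv A)) X = 𝟙 (act A X) := by
  rw [Category.id_comp, ← actLeft_tensUnitLeftInv, Category.assoc, Category.assoc,
    IsIso.hom_inv_id_assoc, ← actLeft_comp, IsIso.hom_inv_id, actLeft_id]

theorem rep_right_unitality :
    ((actRight A (actUnit X) ≫ 𝟙 (act A (act (unitGraph O) X))) ≫
        inv (actTens A (unitGraph O) X)) ≫ actLeft (inv (tensUnitRightInv A)) X =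
      𝟙 (act A X) := by
  rw [Category.comp_id, ← actLeft_tensUnitRightInv, Category.assoc, Category.assoc,
    IsIso.hom_inv_id_assoc, ← actLeft_comp, IsIso.hom_inv_id, actLeft_id]

end

theorem rep_associativity_cell {O : Cat.{u, u}} (A B D : Profunctor.{u} (Word O) O) :
    EndDFib.{u}.vcomp (EndDFib.{u}.vcomp (EndDFib.{u}.id (a := O) (actFun D ⋙ actFun B ⋙ actFun A))
        (endComp.{u}.map (CatOver.pair (EndDFib.vert (repTens A B).inv)
          (EndDFib.{u}.id (a := O) (actFun D)))))
      (EndDFib.vert (repTens (tens A B) D).inv) =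
    EndDFib.{u}.vcomp (EndDFib.{u}.vcomp
        (endComp.{u}.map (CatOver.pair (EndDFib.{u}.id (a := O) (actFun A))
          (EndDFib.vert (repTens B D).inv)))
        (EndDFib.vert (repTens A (tens B D)).inv))
      (rep.{u}.map (Gph.vert (tensAssocIso A B D).inv)) :=
  NatTrans.ext (funext fun X => rep_associativity A B D X)

/-- The strong monoidal structure on `r`. -/
noncomputable def repMonoidal :
    CatOver.LaxMonoidalStr gphMonoidal.{u} endMonoidal.{u} rep.{u} where
  φ := repTensor.inv
  φ₀ := repOne.hom
  associativity x y z := rep_associativity_cell x y z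
  left_unitality {O} x := NatTrans.ext (funext fun X => rep_left_unitality (O := O) x X)
  right_unitality {O} x := NatTrans.ext (funext fun X => rep_right_unitality (O := O) x X)

theorem repMonoidal_isStrong : repMonoidal.{u}.IsStrong :=
  ⟨inferInstanceAs (IsIso repTensor.inv), inferInstanceAs (IsIso repOne.hom)⟩

/-- The structure 2-cell is the inverse of `actTens`, and its argument here is by computation the
image under `actTens` of the right-hand side. -/
theorem repMonoidal_φ {O : Cat.{u, u}} (A B : Profunctor.{u} (Word O) O) (X : PSh O) (o : O)
    (p w : Word O) (a : (A.obj p).obj (op o)) (c : Word.Cut p.len w.len)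
    (b : ∀ i, (B.obj (w.block c i)).obj (op (p.letter i)))
    (x : ∀ j, X.obj (op (w.letter j))) :
    EndDFib.val (repMonoidal.{u}.φ.app (a := O) (A, B)) X
        (act.mk (A := A) (X := act B X) a fun i => act.mk (b i) fun j => x (c.index i j)) =
      act.mk (A := tens A B) (tens.mk a c b) x :=
  ConcreteCategory.congr_hom (NatTrans.congr_app (IsIso.hom_inv_id (actTens A B X)) (op o))
    (act.mk (tens.mk a c b) x)

/-! ### The presentation by fibrations is an equivalence -/

section Presentation

/-- Arrows of fibrations commute strictly with the projections, so a strict inverse is wanted; hence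
bijectivity on objects, with `eqToHom` correcting the ends of arrows. -/
theorem exists_inverse_functor {C : Type w} [Category.{v} C] {D : Type w'} [Category.{v'} D]
    (G : C ⥤ D) (hG : Function.Bijective G.obj)
    (hG' : ∀ a b : C, Function.Bijective (G.map : (a ⟶ b) → (G.obj a ⟶ G.obj b))) :
    ∃ H : D ⥤ C, G ⋙ H = 𝟭 C ∧ H ⋙ G = 𝟭 D := by
  obtain ⟨e, he, he'⟩ := Function.bijective_iff_has_inverse.1 hG
  choose p hp using fun a b => (hG' a b).2
  let H : D ⥤ C :=
    { obj := e
      map := fun {a b} f => p _ _ (eqToHom (he' a) ≫ f ≫ eqToHom (he' b).symm)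
      map_id := fun a => (hG' _ _).1 (by simp [hp])
      map_comp := fun f g => (hG' _ _).1 (by simp [hp]) }
  refine ⟨H, CategoryTheory.Functor.ext he fun a b f => (hG' _ _).1 ?_, CategoryTheory.Functor.ext he' fun a b f => hp _ _ _⟩
  refine (hp _ _ _).trans ?_
  simp [eqToHom_map]

theorem isHomLift_eq {B : Type w} [Category.{v} B] {X : Type w'} [Category.{v'} X] (d : X ⥤ B)
    {x y : X} {f : d.obj x ⟶ d.obj y} {g : x ⟶ y} (h : d.IsHomLift f g) : d.map g = f :=
  eq_of_heq (lift_heq d h).2.2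

theorem isHomLift_comp_of_eq {B : Type w} [Category.{v} B] {X : Type w'} [Category.{v'} X]
    (d : X ⥤ B) {x y z : X} {a b c : B} {f : a ⟶ b} {g : b ⟶ c} {t : a ⟶ c} (h : f ≫ g = t)
    {φ : x ⟶ y} {ψ : y ⟶ z} (hφ : d.IsHomLift f φ) (hψ : d.IsHomLift g ψ) :
    d.IsHomLift t (φ ≫ ψ) := by
  subst h
  infer_instance

variable {O Q : Type u} [Category.{u} O] [Category.{u} Q]

/-! #### Discrete fibrations -/

section DiscreteFibrations

/-- The ends of the image of an arrow under a functor have the displayed form only propositionally;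
leaving them variable permits substitution. -/
theorem PElt.hom_elt {Y : PSh O} {p q : PElt Y} (φ : p ⟶ q) {b b' : O} {k : b ⟶ b'}
    {y : Y.obj (op b)} {y' : Y.obj (op b')} (hp : p = ⟨b, y⟩) (hq : q = ⟨b', y'⟩)
    (h : HEq φ.1 k) : Y.map k.op y' = y := by
  subst hp hq
  obtain rfl := eq_of_heq h
  exact φ.2

theorem PElt.hom_heq {Y : PSh O} {p p' q q' : PElt Y} {φ : p ⟶ q} {φ' : p' ⟶ q'} (hp : p = p')
    (hq : q = q') (h : HEq φ.1 φ'.1) : HEq φ φ' := by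
  subst hp hq
  exact heq_of_eq (Subtype.ext (eq_of_heq h))

theorem PElt.exists_elt {Y : PSh O} (p : PElt Y) {b : O} (h : p.base = b) :
    ∃ y : Y.obj (op b), p = ⟨b, y⟩ := by
  subst h
  exact ⟨p.elt, rfl⟩

theorem PElt.mk_injective {Y : PSh O} {b : O} {y y' : Y.obj (op b)}
    (h : (⟨b, y⟩ : PElt Y) = ⟨b, y'⟩) : y = y' := by
  cases h
  rfl

/-- Arrows of elements are determined by their images in the base, so a functor over `u` is
determined by its values on objects. That it acts on the canonical lifts `X.map k x ⟶ x` is exactly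
naturality of these values. -/
theorem elDFib_bijective {O Q : Cat.{u, u}} (u : O ⟶ Q) (X : PSh O) (Y : PSh Q) :
    Function.Bijective
      (elDFib.{u}.map : DFib.{u}.Hom u X Y → DiscFibs.Hom u (elDFib.obj X) (elDFib.obj Y)) := by
  constructor
  · intro g g' h
    replace h := congrArg (fun F : { f : PElt X ⥤ PElt Y //
      f ⋙ PElt.proj Y = PElt.proj X ⋙ u.toFunctor } => F.1) h
    refine NatTrans.ext (funext fun o => ConcreteCategory.hom_ext _ _ fun x => ?_)
    exact PElt.mk_injective (Y := Y) (Functor.congr_obj h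
      (⟨o.unop, x⟩ : PElt X))
  · rintro ⟨f, h⟩
    change PElt X ⥤ PElt Y at f
    change f ⋙ PElt.proj Y = PElt.proj X ⋙ u.toFunctor at h
    choose g hg using fun z : PElt X => (f.obj z).exists_elt (Functor.congr_obj h z)
    have hm : ∀ {z z' : PElt X} (k : z ⟶ z'), HEq (f.map k).1 (u.toFunctor.map k.1) :=
      fun k => Functor.hcongr_hom h k
    refine ⟨({ app := fun o => ↾fun x => g ⟨o.unop, x⟩
               naturality := fun o o' k => ConcreteCategory.hom_ext _ _ fun x => ?_ } :
      X ⟶ (reindex u.toFunctor).obj Y),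
      Subtype.ext (p := fun f : PElt X ⥤ PElt Y =>
        f ⋙ PElt.proj Y = PElt.proj X ⋙ u.toFunctor) ?_⟩
    · let κ : (⟨o'.unop, X.map k x⟩ : PElt X) ⟶ ⟨o.unop, x⟩ := ⟨k.unop, rfl⟩
      exact (PElt.hom_elt (f.map κ) (hg _) (hg _) (hm κ)).symm
    · exact Functor.hext (fun z => (hg z).symm) fun z z' k =>
        PElt.hom_heq (hg z).symm (hg z').symm (hm k).symm

variable {T : Type u} [Category.{u} T] {d : T ⥤ O} (hd : IsDiscreteFib d)

/-- An object of the fibre over `o` has image only propositionally equal to `o`; this form of unique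
lifting applies to it directly. -/
theorem IsDiscreteFib.existsUnique_lift (hd : IsDiscreteFib d) (t : T) {o o' : O} (k : o' ⟶ o) (ht : d.obj t = o) :
    ∃! l : Σ t' : T, (t' ⟶ t), d.IsHomLift k l.2 := by
  subst ht
  exact hd t k

/-- The presheaf of fibres of a discrete fibration. -/
noncomputable def IsDiscreteFib.fibres : PSh O where
  obj o := { t : T // d.obj t = o.unop }
  map {o o'} k := ↾fun t => ⟨(hd.existsUnique_lift t.1 k.unop t.2).choose.1,
    (lift_heq d (hd.existsUnique_lift t.1 k.unop t.2).choose_spec.1).1⟩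
  map_id o := by
    refine ConcreteCategory.hom_ext _ _ fun t => Subtype.ext ?_
    obtain ⟨t, ht⟩ := t
    have h := hd.existsUnique_lift t (𝟙 o.unop) ht
    exact congrArg Sigma.fst (h.choose_spec.2 ⟨t, 𝟙 t⟩ (IsHomLift.id ht)).symm
  map_comp {o o' o''} k k' := by
    refine ConcreteCategory.hom_ext _ _ fun t => Subtype.ext ?_
    have h := hd.existsUnique_lift t.1 k.unop t.2
    have e := (lift_heq d h.choose_spec.1).1
    have h' := hd.existsUnique_lift h.choose.1 k'.unop e
    have h'' := hd.existsUnique_lift t.1 (k ≫ k').unop t.2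
    -- The composite of the two chosen lifts lifts the composite arrow, so by uniqueness it is the
    -- chosen lift of it.
    exact congrArg Sigma.fst (h''.choose_spec.2 ⟨h'.choose.1, h'.choose.2 ≫ h.choose.2⟩
      (isHomLift_comp_of_eq d rfl h'.choose_spec.1 h.choose_spec.1)).symm

theorem IsDiscreteFib.fibres_map_eq {o o' : O} (k : o' ⟶ o) {t t' : T} (φ : t' ⟶ t)
    (h : d.IsHomLift k φ) (ht : d.obj t = o) (ht' : d.obj t' = o') :
    hd.fibres.map k.op (⟨t, ht⟩ : { t : T // d.obj t = o }) =
      (⟨t', ht'⟩ : { t : T // d.obj t = o' }) :=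
  Subtype.ext (congrArg Sigma.fst
    ((hd.existsUnique_lift t k ht).choose_spec.2 ⟨t', φ⟩ h)).symm

theorem IsDiscreteFib.exists_of_fibres_map_eq {o o' : O} (k : o' ⟶ o) {t t' : T}
    {ht : d.obj t = o} {ht' : d.obj t' = o'}
    (h : hd.fibres.map k.op (⟨t, ht⟩ : { t : T // d.obj t = o }) =
      (⟨t', ht'⟩ : { t : T // d.obj t = o' })) : ∃ φ : t' ⟶ t, d.IsHomLift k φ := by
  obtain rfl := congrArg Subtype.val h
  exact ⟨_, (hd.existsUnique_lift t k ht).choose_spec.1⟩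

/-- A discrete fibration is isomorphic to the elements of its presheaf of fibres. -/
noncomputable def IsDiscreteFib.toElements : T ⥤ PElt hd.fibres where
  obj t := ⟨d.obj t, (⟨t, rfl⟩ : { t' : T // d.obj t' = d.obj t })⟩
  map φ := ⟨d.map φ, hd.fibres_map_eq (d.map φ) φ inferInstance rfl rfl⟩
  map_id t := Subtype.ext (d.map_id t)
  map_comp φ ψ := Subtype.ext (d.map_comp φ ψ)

theorem IsDiscreteFib.exists_inverse :
    ∃ H : PElt hd.fibres ⥤ T, hd.toElements ⋙ H = 𝟭 T ∧ H ⋙ hd.toElements = 𝟭 _ := by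
  refine exists_inverse_functor hd.toElements ⟨fun t t' h => ?_, ?_⟩ fun t t' => ⟨fun φ ψ h => ?_, ?_⟩
  · exact congrArg (fun z : PElt hd.fibres => (show { t : T // d.obj t = z.base } from z.elt).1) h
  · rintro ⟨o, t⟩
    obtain ⟨t, ht⟩ : { t : T // d.obj t = o } := t
    subst ht
    exact ⟨t, rfl⟩
  -- Both arrows lift the same arrow to the same target, so they coincide by uniqueness of lifts.
  · have e : d.map φ = d.map ψ := congrArg Subtype.val h
    have := (hd t' (d.map φ)).unique (y₁ := ⟨t, φ⟩) (y₂ := ⟨t, ψ⟩) (Functor.IsHomLift.map φ)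
      (e ▸ Functor.IsHomLift.map ψ)
    exact eq_of_heq (Sigma.mk.inj this).2
  · rintro ⟨k, hk⟩
    obtain ⟨φ, hφ⟩ := hd.exists_of_fibres_map_eq k hk
    exact ⟨φ, Subtype.ext (isHomLift_eq d hφ)⟩

end DiscreteFibrations

end Presentation

theorem DiscFib.exists_iso_ofPSh {O : Cat.{u, u}} (Y : DiscFib O) :
    ∃ (X : PSh O) (f : DiscFibs.{u}.Hom (𝟙 O) (DiscFib.ofPSh X) Y)
      (g : DiscFibs.{u}.Hom (𝟙 O) Y (DiscFib.ofPSh X)),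
      DiscFibs.{u}.vcomp f g = DiscFibs.{u}.id (DiscFib.ofPSh X) ∧
        DiscFibs.{u}.vcomp g f = DiscFibs.{u}.id Y := by
  obtain ⟨H, h, h'⟩ := Y.isFib.exists_inverse
  refine ⟨Y.isFib.fibres, ⟨H, ?_⟩, ⟨Y.isFib.toElements, rfl⟩, Subtype.ext h', Subtype.ext h⟩
  exact congrArg (· ⋙ PElt.proj Y.isFib.fibres) h'

theorem elDFib_isEquivalence : elDFib.{u}.IsEquivalence where
  bijective u X Y := elDFib_bijective u X Y
  surjective Y := DiscFib.exists_iso_ofPSh Y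

/-! #### Two-sided discrete fibrations -/

section TwoSidedDiscreteFibrations

variable {O Q : Type u} [Category.{u} O] [Category.{u} Q]

theorem GElt.hom_elt {B : Profunctor.{u} (Word O) O} {p q : GElt B} (φ : p ⟶ q) {s s' : O}
    {t t' : Word O} {k : s ⟶ s'} {v : t ⟶ t'} {b : (B.obj t).obj (op s)}
    {b' : (B.obj t').obj (op s')} (hp : p = ⟨s, t, b⟩) (hq : q = ⟨s', t', b'⟩)
    (hk : HEq φ.1.1 k) (hv : HEq φ.1.2 v) :
    (B.map v).app (op s) b = (B.obj t').map k.op b' := by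
  subst hp hq
  obtain rfl := eq_of_heq hk
  obtain rfl := eq_of_heq hv
  exact φ.2

theorem GElt.hom_heq {B : Profunctor.{u} (Word O) O} {p p' q q' : GElt B} {φ : p ⟶ q}
    {φ' : p' ⟶ q'} (hp : p = p') (hq : q = q') (h₁ : HEq φ.1.1 φ'.1.1) (h₂ : HEq φ.1.2 φ'.1.2) :
    HEq φ φ' := by
  subst hp hq
  exact heq_of_eq (Subtype.ext (Prod.ext (eq_of_heq h₁) (eq_of_heq h₂)))

theorem GElt.exists_elt {B : Profunctor.{u} (Word O) O} (p : GElt B) {s : O} {t : Word O}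
    (hs : p.src = s) (ht : p.tgt = t) : ∃ b : (B.obj t).obj (op s), p = ⟨s, t, b⟩ := by
  subst hs ht
  exact ⟨p.elt, rfl⟩

theorem GElt.mk_injective {B : Profunctor.{u} (Word O) O} {s : O} {t : Word O}
    {b b' : (B.obj t).obj (op s)} (h : (⟨s, t, b⟩ : GElt B) = ⟨s, t, b'⟩) : b = b' := by
  cases h
  rfl

/-- As for presheaves, a map of spans is determined by its values on objects. Its action on arrows
of elements of the form `(k, 1)` and `(1, v)` is naturality of these values in the object and in the
word. -/
theorem elGph_bijective {O Q : Cat.{u, u}} (u : O ⟶ Q) (A : Profunctor.{u} (Word O) O)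
    (B : Profunctor.{u} (Word Q) Q) :
    Function.Bijective
      (elGph.{u}.map : Gph.{u}.Hom u A B → FibGraphs.Hom u (elGph.obj A) (elGph.obj B)) := by
  constructor
  · intro g g' h
    replace h := congrArg (fun F : { f : GElt A ⥤ GElt B //
      f ⋙ GElt.fst B = GElt.fst A ⋙ u.toFunctor ∧
        f ⋙ GElt.snd B = GElt.snd A ⋙ Word.map u.toFunctor } => F.1) h
    refine NatTrans.ext (funext fun w => NatTrans.ext (funext fun o =>
      ConcreteCategory.hom_ext _ _ fun a => ?_))
    exact GElt.mk_injective (B := B) (Functor.congr_obj h (⟨o.unop, w, a⟩ : GElt A))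
  · rintro ⟨f, h₁, h₂⟩
    change GElt A ⥤ GElt B at f
    change f ⋙ GElt.fst B = GElt.fst A ⋙ u.toFunctor at h₁
    change f ⋙ GElt.snd B = GElt.snd A ⋙ Word.map u.toFunctor at h₂
    choose g hg using fun z : GElt A =>
      (f.obj z).exists_elt (Functor.congr_obj h₁ z) (Functor.congr_obj h₂ z)
    have hm₁ : ∀ {z z' : GElt A} (k : z ⟶ z'), HEq (f.map k).1.1 (u.toFunctor.map k.1.1) :=
      fun k => Functor.hcongr_hom h₁ k
    have hm₂ : ∀ {z z' : GElt A} (k : z ⟶ z'),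
        HEq (f.map k).1.2 ((Word.map u.toFunctor).map k.1.2) :=
      fun k => Functor.hcongr_hom h₂ k
    have key : ∀ {z z' : GElt A} (k : z ⟶ z'),
        (B.map ((Word.map u.toFunctor).map k.1.2)).app _ (g z) =
          (B.obj _).map (u.toFunctor.map k.1.1).op (g z') :=
      fun k => GElt.hom_elt (f.map k) (hg _) (hg _) (hm₁ k) (hm₂ k)
    refine ⟨({ app := fun w =>
        { app := fun o => ↾fun a => g ⟨o.unop, w, a⟩
          naturality := fun o o' k => ConcreteCategory.hom_ext _ _ fun a => ?_ }
               naturality := fun w w' v => NatTrans.ext (funext fun o =>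
          ConcreteCategory.hom_ext _ _ fun a => ?_) } :
      A ⟶ Word.map u.toFunctor ⋙ B ⋙ reindex u.toFunctor),
      Subtype.ext (p := fun f : GElt A ⥤ GElt B => f ⋙ GElt.fst B = GElt.fst A ⋙ u.toFunctor ∧
        f ⋙ GElt.snd B = GElt.snd A ⋙ Word.map u.toFunctor) ?_⟩
    · let z : GElt A := ⟨o'.unop, w, (A.obj w).map k a⟩
      let κ : z ⟶ ⟨o.unop, w, a⟩ := ⟨(k.unop, 𝟙 w), z.map_id_elt⟩
      refine Eq.trans ?_ (key κ)
      refine (profunctor_map_id (g z)).symm.trans ?_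
      exact congrArg (fun v => (B.map v).app _ (g z)) ((Word.map u.toFunctor).map_id w).symm
    · let z : GElt A := ⟨o.unop, w', (A.map v).app o a⟩
      let κ : (⟨o.unop, w, a⟩ : GElt A) ⟶ z := ⟨(𝟙 o.unop, v), z.id_map_elt.symm⟩
      refine Eq.trans ?_ (key κ).symm
      refine (psh_map_id (g z)).symm.trans ?_
      exact congrArg (fun k => (B.obj _).map (Quiver.Hom.op k) (g z)) (u.toFunctor.map_id o.unop).symm
    · exact Functor.hext (fun z => (hg z).symm) fun z z' k =>
        GElt.hom_heq (hg z).symm (hg z').symm (hm₁ k).symm (hm₂ k).symm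

namespace IsTwoSidedDiscreteFib

variable {T : Type u} [Category.{u} T] {γ : T ⥤ O} {δ : T ⥤ Word O}
  (hd : IsTwoSidedDiscreteFib γ δ)

theorem existsUnique_left (hd : IsTwoSidedDiscreteFib γ δ) (t : T) {o o' : O} {w : Word O}
    (k : o' ⟶ o) (ht : γ.obj t = o ∧ δ.obj t = w) :
    ∃! l : Σ t' : T, (t' ⟶ t), γ.IsHomLift k l.2 ∧ δ.IsHomLift (𝟙 w) l.2 := by
  obtain ⟨rfl, rfl⟩ := ht
  exact hd.lift_left t k

theorem existsUnique_right (hd : IsTwoSidedDiscreteFib γ δ) (t : T) {o : O} {w w' : Word O}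
    (g : w ⟶ w') (ht : γ.obj t = o ∧ δ.obj t = w) :
    ∃! l : Σ t' : T, (t ⟶ t'), γ.IsHomLift (𝟙 o) l.2 ∧ δ.IsHomLift g l.2 := by
  obtain ⟨rfl, rfl⟩ := ht
  exact hd.lift_right t g

theorem exists_factor (hd : IsTwoSidedDiscreteFib γ δ) {a b : T} (h : a ⟶ b) {o o' : O}
    {w w' : Word O} {k : o ⟶ o'} {g : w ⟶ w'} (hk : γ.IsHomLift k h) (hg : δ.IsHomLift g h) :
    ∃ (c : T) (φ : a ⟶ c) (ψ : c ⟶ b), φ ≫ ψ = h ∧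
      (γ.IsHomLift (𝟙 o) φ ∧ δ.IsHomLift g φ) ∧ (γ.IsHomLift k ψ ∧ δ.IsHomLift (𝟙 w') ψ) := by
  obtain ⟨rfl, rfl, e⟩ := lift_heq γ hk
  obtain rfl := eq_of_heq e
  obtain ⟨rfl, rfl, e⟩ := lift_heq δ hg
  obtain rfl := eq_of_heq e
  exact hd.factor h

/-- The elements of the fibre over `o` and `w`. -/
abbrev Fibre (γ : T ⥤ O) (δ : T ⥤ Word O) (o : O) (w : Word O) : Type u :=
  { t : T // γ.obj t = o ∧ δ.obj t = w }

/-- The action of an arrow of `O` on the fibres. -/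
noncomputable def left {o o' : O} {w : Word O} (k : o' ⟶ o) (t : Fibre γ δ o w) :
    Fibre γ δ o' w :=
  ⟨(hd.existsUnique_left t.1 k t.2).choose.1,
    (lift_heq γ (hd.existsUnique_left t.1 k t.2).choose_spec.1.1).1,
    (lift_heq δ (hd.existsUnique_left t.1 k t.2).choose_spec.1.2).1⟩

/-- The action of an arrow of words on the fibres. -/
noncomputable def right {o : O} {w w' : Word O} (g : w ⟶ w') (t : Fibre γ δ o w) :
    Fibre γ δ o w' :=
  ⟨(hd.existsUnique_right t.1 g t.2).choose.1,
    (lift_heq γ (hd.existsUnique_right t.1 g t.2).choose_spec.1.1).2.1,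
    (lift_heq δ (hd.existsUnique_right t.1 g t.2).choose_spec.1.2).2.1⟩

theorem exists_left {o o' : O} {w : Word O} (k : o' ⟶ o) (t : Fibre γ δ o w) :
    ∃ φ : (hd.left k t).1 ⟶ t.1, γ.IsHomLift k φ ∧ δ.IsHomLift (𝟙 w) φ :=
  ⟨_, (hd.existsUnique_left t.1 k t.2).choose_spec.1⟩

theorem exists_right {o : O} {w w' : Word O} (g : w ⟶ w') (t : Fibre γ δ o w) :
    ∃ φ : t.1 ⟶ (hd.right g t).1, γ.IsHomLift (𝟙 o) φ ∧ δ.IsHomLift g φ :=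
  ⟨_, (hd.existsUnique_right t.1 g t.2).choose_spec.1⟩

theorem left_eq {o o' : O} {w : Word O} (k : o' ⟶ o) (t : Fibre γ δ o w) (t' : Fibre γ δ o' w)
    (φ : t'.1 ⟶ t.1) (h : γ.IsHomLift k φ) (h' : δ.IsHomLift (𝟙 w) φ) : hd.left k t = t' :=
  Subtype.ext (congrArg Sigma.fst
    ((hd.existsUnique_left t.1 k t.2).choose_spec.2 ⟨t'.1, φ⟩ ⟨h, h'⟩)).symm

theorem right_eq {o : O} {w w' : Word O} (g : w ⟶ w') (t : Fibre γ δ o w) (t' : Fibre γ δ o w')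
    (φ : t.1 ⟶ t'.1) (h : γ.IsHomLift (𝟙 o) φ) (h' : δ.IsHomLift g φ) : hd.right g t = t' :=
  Subtype.ext (congrArg Sigma.fst
    ((hd.existsUnique_right t.1 g t.2).choose_spec.2 ⟨t'.1, φ⟩ ⟨h, h'⟩)).symm

/-- The ends of an arrow have the same image in the fibre over its source and target. -/
theorem right_eq_left {o o' : O} {w w' : Word O} {k : o' ⟶ o} {g : w ⟶ w'} (t : Fibre γ δ o' w)
    (t' : Fibre γ δ o w') (φ : t.1 ⟶ t'.1) (hk : γ.IsHomLift k φ) (hg : δ.IsHomLift g φ) :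
    hd.right g t = hd.left k t' := by
  -- The middle object of the factorization is at once the transport of `t` along `g` and the
  -- restriction of `t'` along `k`.
  obtain ⟨c, κ, l, -, ⟨h₁, h₂⟩, h₃, h₄⟩ := hd.exists_factor φ hk hg
  let c' : Fibre γ δ o' w' := ⟨c, (lift_heq γ h₃).1, (lift_heq δ h₄).1⟩
  exact (hd.right_eq g t c' κ h₁ h₂).trans (hd.left_eq k t' c' l h₃ h₄).symm

/-- Compose the two lifts through the common object. With `right_eq_left` this identifies the pairs
underlying arrows of the total category with those underlying arrows of elements. -/
theorem exists_of_right_eq_left {o o' : O} {w w' : Word O} {k : o' ⟶ o} {g : w ⟶ w'}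
    {t : Fibre γ δ o' w} {t' : Fibre γ δ o w'} (h : hd.right g t = hd.left k t') :
    ∃ φ : t.1 ⟶ t'.1, γ.IsHomLift k φ ∧ δ.IsHomLift g φ := by
  obtain ⟨φ, h₁, h₂⟩ := hd.exists_right g t
  obtain ⟨ψ, h₃, h₄⟩ := hd.exists_left k t'
  generalize hd.right g t = c at h φ
  subst h
  exact ⟨φ ≫ ψ, isHomLift_comp_of_eq γ (Category.id_comp k) h₁ h₃,
    isHomLift_comp_of_eq δ (Category.comp_id g) h₂ h₄⟩

/-- The profunctor of fibres of a two-sided discrete fibration. -/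
noncomputable def fibres : Profunctor.{u} (Word O) O where
  obj w :=
    { obj := fun o => Fibre γ δ o.unop w
      map := fun k => ↾fun t => hd.left k.unop t
      map_id := fun o => ConcreteCategory.hom_ext _ _ fun t =>
        hd.left_eq (𝟙 o.unop) t t (𝟙 _) (IsHomLift.id t.2.1) (IsHomLift.id t.2.2)
      map_comp := fun k k' => ConcreteCategory.hom_ext _ _ fun t => by
        obtain ⟨φ, h₁, h₂⟩ := hd.exists_left k.unop t
        obtain ⟨ψ, h₃, h₄⟩ := hd.exists_left k'.unop (hd.left k.unop t)
        exact hd.left_eq (k ≫ k').unop t _ (ψ ≫ φ) (isHomLift_comp_of_eq γ rfl h₃ h₁)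
          (isHomLift_comp_of_eq δ (Category.comp_id _) h₄ h₂) }
  map {w w'} g :=
    { app := fun o => ↾fun t => hd.right g t
      naturality := fun o o' k => ConcreteCategory.hom_ext _ _ fun t => by
        obtain ⟨φ, h₁, h₂⟩ := hd.exists_left k.unop t
        obtain ⟨ψ, h₃, h₄⟩ := hd.exists_right g t
        -- The composite of the two lifts lies over `k` and `g` at once; factoring it the other way
        -- round is the interchange of the two actions.
        exact hd.right_eq_left (hd.left k.unop t) (hd.right g t) (φ ≫ ψ)
          (isHomLift_comp_of_eq γ (Category.comp_id _) h₁ h₃)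
          (isHomLift_comp_of_eq δ (Category.id_comp _) h₂ h₄) }
  map_id w := NatTrans.ext (funext fun o => ConcreteCategory.hom_ext _ _ fun t =>
    hd.right_eq (𝟙 w) t t (𝟙 _) (IsHomLift.id t.2.1) (IsHomLift.id t.2.2))
  map_comp g g' := NatTrans.ext (funext fun o => ConcreteCategory.hom_ext _ _ fun t => by
    obtain ⟨φ, h₁, h₂⟩ := hd.exists_right g t
    obtain ⟨ψ, h₃, h₄⟩ := hd.exists_right g' (hd.right g t)
    exact hd.right_eq (g ≫ g') t _ (φ ≫ ψ) (isHomLift_comp_of_eq γ (Category.comp_id _) h₁ h₃)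
      (isHomLift_comp_of_eq δ rfl h₂ h₄))

/-- A two-sided discrete fibration is isomorphic to the elements of its profunctor of fibres. -/
noncomputable def toElements : T ⥤ GElt hd.fibres where
  obj t := ⟨γ.obj t, δ.obj t, (⟨t, rfl, rfl⟩ : Fibre γ δ (γ.obj t) (δ.obj t))⟩
  map {t t'} φ := ⟨(γ.map φ, δ.map φ), hd.right_eq_left (⟨t, rfl, rfl⟩ : Fibre γ δ _ _)
    (⟨t', rfl, rfl⟩ : Fibre γ δ _ _) φ (Functor.IsHomLift.map φ) (Functor.IsHomLift.map φ)⟩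
  map_id t := Subtype.ext (Prod.ext (γ.map_id t) (δ.map_id t))
  map_comp φ ψ := Subtype.ext (Prod.ext (γ.map_comp φ ψ) (δ.map_comp φ ψ))

/-- Factor both arrows: the first factors lift the same arrow from `t`, so they agree together with
the middle objects; then the second factors lift the same arrow to `t'`. -/
theorem hom_ext (hd : IsTwoSidedDiscreteFib γ δ) {t t' : T} {φ ψ : t ⟶ t'}
    (h₁ : γ.map φ = γ.map ψ) (h₂ : δ.map φ = δ.map ψ) : φ = ψ := by
  obtain ⟨c, κ, l, rfl, hκ, hl⟩ := hd.factor φ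
  obtain ⟨c', κ', l', rfl, hκ', hl'⟩ := hd.factor ψ
  rw [← h₂] at hκ'
  rw [← h₁] at hl'
  have e := (hd.lift_right t (δ.map (κ ≫ l))).unique (y₁ := ⟨c, κ⟩) (y₂ := ⟨c', κ'⟩) hκ hκ'
  obtain rfl := congrArg Sigma.fst e
  obtain rfl := eq_of_heq (Sigma.mk.inj e).2
  have e' := (hd.lift_left t' (γ.map (κ ≫ l))).unique (y₁ := ⟨c, l⟩) (y₂ := ⟨c, l'⟩) hl hl'
  obtain rfl := eq_of_heq (Sigma.mk.inj e').2
  rfl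

theorem exists_inverse :
    ∃ H : GElt hd.fibres ⥤ T, hd.toElements ⋙ H = 𝟭 T ∧ H ⋙ hd.toElements = 𝟭 _ := by
  refine exists_inverse_functor hd.toElements ⟨fun t t' h => ?_, ?_⟩ fun t t' => ⟨fun φ ψ h => ?_, ?_⟩
  · exact congrArg (fun z : GElt hd.fibres => (show Fibre γ δ z.src z.tgt from z.elt).1) h
  · rintro ⟨o, w, t⟩
    obtain ⟨t, ht, ht'⟩ : Fibre γ δ o w := t
    subst ht ht'
    exact ⟨t, rfl⟩
  · exact hd.hom_ext (congrArg (fun k => (Subtype.val k).1) h)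
      (congrArg (fun k => (Subtype.val k).2) h)
  · rintro ⟨⟨k, g⟩, h⟩
    change γ.obj t ⟶ γ.obj t' at k
    change δ.obj t ⟶ δ.obj t' at g
    change hd.right g (⟨t, rfl, rfl⟩ : Fibre γ δ _ _) =
      hd.left k (⟨t', rfl, rfl⟩ : Fibre γ δ _ _) at h
    obtain ⟨φ, h₁, h₂⟩ := hd.exists_of_right_eq_left h
    exact ⟨φ, Subtype.ext (Prod.ext (isHomLift_eq γ h₁) (isHomLift_eq δ h₂))⟩

end IsTwoSidedDiscreteFib

end TwoSidedDiscreteFibrations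

theorem FibGraph.exists_iso_ofProfunctor {O : Cat.{u, u}} (Y : FibGraph O) :
    ∃ (A : Profunctor.{u} (Word O) O) (f : FibGraphs.{u}.Hom (𝟙 O) (FibGraph.ofProfunctor A) Y)
      (g : FibGraphs.{u}.Hom (𝟙 O) Y (FibGraph.ofProfunctor A)),
      FibGraphs.{u}.vcomp f g = FibGraphs.{u}.id (FibGraph.ofProfunctor A) ∧
        FibGraphs.{u}.vcomp g f = FibGraphs.{u}.id Y := by
  obtain ⟨H, h, h'⟩ := Y.isFib.exists_inverse
  refine ⟨Y.isFib.fibres, ⟨H, ?_, ?_⟩, ⟨Y.isFib.toElements, rfl, rfl⟩, Subtype.ext h',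
    Subtype.ext h⟩
  · exact congrArg (· ⋙ GElt.fst Y.isFib.fibres) h'
  · exact congrArg (· ⋙ GElt.snd Y.isFib.fibres) h'

theorem elGph_isEquivalence : elGph.{u}.IsEquivalence where
  bijective u A B := elGph_bijective u A B
  surjective Y := FibGraph.exists_iso_ofProfunctor Y

/-! ### The proposition -/

theorem mainTheorem9 :
    -- profunctors and presheaves are two-sided discrete fibrations and discrete fibrations
    (elGph.{u}.IsEquivalence ∧ elDFib.{u}.IsEquivalence) ∧
    -- `End(DFib)` is the exponential of `DFib` by itself
    (∀ E : CatOver.{w, v} Cat.{u, u}, Function.Bijective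
      (curry : CatOver.OneCell (E.prod DFib.{u}) DFib.{u} → CatOver.OneCell E EndDFib.{u})) ∧
    -- `r` is strong monoidal
    (∃ (m : CatOver.MonoidalStr gphTensor.{u} gphUnit.{u})
      (s : CatOver.LaxMonoidalStr m endMonoidal.{u} rep.{u}), s.IsStrong ∧
      (∀ (O : Cat.{u, u}) (X : PSh O) (o : O) (x : X.obj (op o)),
        EndDFib.val (s.φ₀.app (a := O) ⟨⟩) X x =
          act.mk (A := (Word.unit O).toProfunctorRev) (𝟙 ((Word.unit O).obj o)) (fun _ => x)) ∧
      (∀ (O : Cat.{u, u}) (A B : Profunctor.{u} (Word O) O) (X : PSh O) (o : O) (p w : Word O)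
        (a : (A.obj p).obj (op o)) (c : Word.Cut p.len w.len)
        (b : ∀ i, (B.obj (w.block c i)).obj (op (p.letter i)))
        (x : ∀ j, X.obj (op (w.letter j))),
        EndDFib.val (s.φ.app (a := O) (A, B)) X
            (act.mk (X := act B X) a fun i => act.mk (b i) fun j => x (c.index i j)) =
          act.mk (tens.mk a c b) x)) ∧
    -- `r` is a morphism of bifibrations
    rep.{u}.IsMorphismOfBifibrations ∧
    -- `r` has the rc right adjoint `U`
    (∃ adj : CatOver.Adj rep.{u} repRight.{u},
      (∀ (O : Cat.{u, u}) (A : Profunctor.{u} (Word O) O) (o : O) (w : Word O)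
        (a : (A.obj w).obj (op o)),
        Gph.val (adj.unit.app (a := O) A) a = act.mk (X := (iota O).obj w) a (iotaGen w)) ∧
      (∀ (O : Cat.{u, u}) (H : PSh O ⥤ PSh O) (X : PSh O) (o : O) (w : Word O)
        (h : (H.obj ((iota O).obj w)).obj (op o)) (x : ∀ i, X.obj (op (w.letter i))),
        EndDFib.val (adj.counit.app (a := O) H) X (act.mk (A := iota O ⋙ H) h x) =
          (H.map (iotaDesc x)).app (op o) h)) ∧
    CatOver.OneCell.IsRC.{u + 1, u + 1, u + 1, u, u, u + 1, w, v} repRight.{u} := by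
  refine ⟨⟨elGph_isEquivalence, elDFib_isEquivalence⟩, curry_bijective,
    ⟨gphMonoidal, repMonoidal, repMonoidal_isStrong, fun O X o x => rfl, fun O => repMonoidal_φ⟩,
    rep_isMorphismOfBifibrations, ⟨repAdj, fun O A o w a => rfl, fun O H X o w h x => rfl⟩,
    repRight_isRC⟩
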